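/- Let $m<n$, let $N$ be a smooth $n$-manifold with a smooth Riemannian metric $h$ and a smooth vector field $W$ with $h(W,W)<1$ everywhere, and let $$F(y)=\frac{\sqrt{\lambda\,h(y,y)+h(W,y)^2}-h(W,y)}{\lambda},\qquad \lambda=1-h(W,W),$$ be the Randers metric with navigation datum $(h,W)$. Let $g_{ij}=\tfrac12[F^2]_{y^iy^j}$ be its fundamental tensor, $G^i=\tfrac14 g^{il}\{[F^2]_{x^ky^l}y^k-[F^2]_{x^l}\}$ its geodesic coefficients, $D^{v}$ the covariant derivative of its Chern connection with reference vector $v$, and $S(x,y)=\partial G^i/\partial y^i-y^i\,\partial(\ln\sigma)/\partial x^i$ its $\mathbf S$-curvature with respect to the Busemann–Hausdorff volume form $d\mu_{BH}=\sigma\,dx^1\wedge\cdots\wedge dx^n$. Suppose that $S(x,y)=(n+1)k(x)F(x,y)$ for all $x\in N$ and $0\ne y\in T_xN$, where $k:N\to\mathbb R$ is a function. Let $\phi:M\to N$ be a smooth immersion of a smooth $m$-manifold, and identify $T_pM$ with $d\phi(T_pM)\subset T_{\phi(p)}N$. Let $p\in M$, and let $\mathbf n\in T_{\phi(p)}N$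 be a unit normal vector of $M$ with respect to $F$, that is, $F(\mathbf n)=1$ and $F(\mathbf n)\,(dF_{\phi(p)})_{\mathbf n}(X)=0$ for all $X\in T_pM$, where $dF_{\phi(p)}$ is the derivative of $F$ on the fibre $T_{\phi(p)}N$. Then: 1. $\bar{\mathbf n}:=\mathbf n-W$ is a unit normal vector of $M$ with respect to $h$. 2. The shape operators $A_{\mathbf n}X=-(D^{\mathbf n}_X\mathbf n)^{\top}_{g_{\mathbf n}}$ of $M$ in $(N,F)$ and $\bar A_{\bar{\mathbf n}}X=-(\nabla^h_X\bar{\mathbf n})^{\top}_{h}$ of $M$ in $(N,h)$ are well-defined linear operators on $T_pM$. Here $\top$ is the orthogonal projection to $T_pM$ for the indicated inner product, $\nabla^h$ is the Levi-Civita connection of $h$, and $\mathbf n$ (resp. $\bar{\mathbf n}$) is extended to a smooth field of $F$-unit (resp. $h$-unit) normal vectors along $\phi$ near $p$; such extensions exist, and the operators do not depend on their choice. 3. $A_{\mathbf n}$ and $\bar A_{\bar{\mathbf n}}$ have the same principal vectors (eigenvectors). 4. If $X\in T_pM$ is a principal vector, with principal curvatures $A_{\mathbf n}X=\lambda X$ and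 $\bar A_{\bar{\mathbf n}}X=\bar\lambda X$, then $\lambda=\bar\lambda+k(\phi(p))$. -/

import Mathlib

open scoped Manifold ContDiff Topology
open MeasureTheory

noncomputable section

namespace Randers

/-! ### Finsler geometry in coordinates

A Finsler function on a coordinate domain is a function `L : E n → E n → ℝ`, where `L u v` is the
length of the vector `v` attached to the point `u`. -/

/-- The coordinate space `ℝⁿ`. -/
abbrev E (n : ℕ) : Type := EuclideanSpace ℝ (Fin n)

/-- The `i`-th coordinate vector of `ℝⁿ`. -/
def e {n : ℕ} (i : Fin n) : E n := EuclideanSpace.single i (1 : ℝ)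

/-- The partial derivative `∂f/∂xⁱ` of a function `f(x, y)`. -/
def dX {n : ℕ} (i : Fin n) (f : E n → E n → ℝ) (u v : E n) : ℝ :=
  fderiv ℝ (fun u' => f u' v) u (e i)

/-- The partial derivative `∂f/∂yⁱ` of a function `f(x, y)`. -/
def dY {n : ℕ} (i : Fin n) (f : E n → E n → ℝ) (u v : E n) : ℝ :=
  fderiv ℝ (fun v' => f u v') v (e i)

/-- The square `L²` of a Finsler function. -/
def sq {n : ℕ} (L : E n → E n → ℝ) (u v : E n) : ℝ := L u v ^ 2

/-- The fundamental tensor `g_{ij} = ½ [L²]_{yⁱ yʲ}`. -/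
def fundTensor {n : ℕ} (L : E n → E n → ℝ) (i j : Fin n) (u v : E n) : ℝ :=
  (1 / 2 : ℝ) * dY j (dY i (sq L)) u v

/-- The inverse `g^{ij}` of the fundamental tensor. -/
def fundTensorInv {n : ℕ} (L : E n → E n → ℝ) (i j : Fin n) (u v : E n) : ℝ :=
  (Matrix.of fun a b : Fin n => fundTensor L a b u v)⁻¹ i j

/-- The geodesic coefficients `Gⁱ = ¼ g^{il} ([L²]_{x^k y^l} y^k - [L²]_{x^l})`. -/
def geodCoeff {n : ℕ} (L : E n → E n → ℝ) (i : Fin n) (u v : E n) : ℝ :=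
  (1 / 4 : ℝ) * ∑ l, fundTensorInv L i l u v *
    ((∑ k, dX k (dY l (sq L)) u v * v k) - dX l (sq L) u v)

/-- The nonlinear connection coefficients `Nⁱ_j = ∂Gⁱ/∂yʲ`. -/
def nonlinConn {n : ℕ} (L : E n → E n → ℝ) (i j : Fin n) (u v : E n) : ℝ :=
  dY j (geodCoeff L i) u v

/-- The horizontal derivative `δf/δx^k = ∂f/∂x^k - N^r_k ∂f/∂y^r`. -/
def horDeriv {n : ℕ} (L : E n → E n → ℝ) (k : Fin n) (f : E n → E n → ℝ) (u v : E n) : ℝ :=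
  dX k f u v - ∑ r, nonlinConn L r k u v * dY r f u v

/-- The coefficients `Γⁱ_{jk}` of the Chern connection, that is, the solution of
`Γⁱ_{jk} = Γⁱ_{kj}` and `dg_{ij} - g_{ir} Γ^r_{jk} dx^k - g_{rj} Γ^r_{ik} dx^k
= 2 C_{ijk} (dy^k + N^k_r dx^r)`:
`Γⁱ_{jk} = ½ g^{il} (δg_{jl}/δx^k + δg_{kl}/δx^j - δg_{jk}/δx^l)`. -/
def chern {n : ℕ} (L : E n → E n → ℝ) (i j k : Fin n) (u v : E n) : ℝ :=
  (1 / 2 : ℝ) * ∑ l, fundTensorInv L i l u v *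
    (horDeriv L k (fundTensor L j l) u v + horDeriv L j (fundTensor L k l) u v
      - horDeriv L l (fundTensor L j k) u v)

/-- The Busemann–Hausdorff volume density
`σ(u) = vol {v | |v| < 1} / vol {v | L(u, v) < 1}`. -/
def bhDensity {n : ℕ} (L : E n → E n → ℝ) (u : E n) : ℝ :=
  (volume (Metric.ball (0 : E n) 1)).toReal / (volume {v : E n | L u v < 1}).toReal

/-- The `S`-curvature `S = ∂Gⁱ/∂yⁱ - yⁱ ∂(ln σ)/∂xⁱ` for the Busemann–Hausdorff volume form
`σ dx¹ ∧ ⋯ ∧ dxⁿ`. -/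
def sCurvCoord {n : ℕ} (L : E n → E n → ℝ) (u v : E n) : ℝ :=
  (∑ i, dY i (geodCoeff L i) u v)
    - ∑ i, v i * fderiv ℝ (fun u' => Real.log (bhDensity L u')) u (e i)

/-- The inverse `g^{ij}` of a Riemannian metric `g_{ij}` in coordinates. -/
def riemInv {n : ℕ} (g : Fin n → Fin n → E n → ℝ) (i j : Fin n) (u : E n) : ℝ :=
  (Matrix.of fun a b : Fin n => g a b u)⁻¹ i j

/-- The Christoffel symbols of the Levi-Civita connection of a Riemannian metric `g_{ij}` in
coordinates: `½ g^{il} (∂g_{jl}/∂x^k + ∂g_{kl}/∂x^j - ∂g_{jk}/∂x^l)`. -/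
def christoffel {n : ℕ} (g : Fin n → Fin n → E n → ℝ) (i j k : Fin n) (u : E n) : ℝ :=
  (1 / 2 : ℝ) * ∑ l, riemInv g i l u *
    (fderiv ℝ (g j l) u (e k) + fderiv ℝ (g k l) u (e j) - fderiv ℝ (g j k) u (e l))

/-! ### The passage to a manifold -/

section Manifold

variable {n : ℕ} {N : Type*} [TopologicalSpace N] [ChartedSpace (E n) N]

/-- The coordinates, in the preferred chart at `x₀`, of a vector tangent at `x`. -/
def toCoord (x₀ x : N) (v : TangentSpace (𝓡 n) x) : E n :=
  mfderiv (𝓡 n) 𝓘(ℝ, E n) (extChartAt (𝓡 n) x₀) x v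

/-- The point with coordinates `u` in the preferred chart at `x₀`. -/
def ptOfCoord (x₀ : N) (u : E n) : N := (extChartAt (𝓡 n) x₀).symm u

/-- The tangent vector `vⁱ ∂/∂xⁱ` at the point with coordinates `u` in the preferred chart at
`x₀`. -/
def ofCoord (x₀ : N) (u v : E n) : TangentSpace (𝓡 n) (ptOfCoord x₀ u) :=
  mfderiv 𝓘(ℝ, E n) (𝓡 n) (extChartAt (𝓡 n) x₀).symm u v

/-- The expression of a function on the tangent bundle in the preferred chart at `x₀`. -/
def localFinsler (F : ∀ x : N, TangentSpace (𝓡 n) x → ℝ) (x₀ : N) (u v : E n) : ℝ :=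
  F (ptOfCoord x₀ u) (ofCoord x₀ u v)

/-- The `S`-curvature `S(x, y)` of a Finsler metric with its Busemann–Hausdorff volume form
(computed in the preferred chart at `x`). -/
def sCurv (F : ∀ x : N, TangentSpace (𝓡 n) x → ℝ) (x : N) (y : TangentSpace (𝓡 n) x) : ℝ :=
  sCurvCoord (localFinsler F x) (extChartAt (𝓡 n) x x) (toCoord x x y)

/-- The Legendre transformation `ℒ(y)(X) = F(y) · (dF_x)_y(X)`. -/
def legendre (F : ∀ x : N, TangentSpace (𝓡 n) x → ℝ) (x : N) (y X : TangentSpace (𝓡 n) x) : ℝ :=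
  F x y * lineDeriv ℝ (F x) y X

variable (n N) in
/-- Smooth Riemannian metrics on `N`. -/
abbrev RMetric [IsManifold (𝓡 n) ∞ N] : Type _ :=
  Bundle.ContMDiffRiemannianMetric (𝓡 n) ∞ (E n) (fun x : N => TangentSpace (𝓡 n) x)

/-- The components `h_{ij}` of a Riemannian metric in the preferred chart at `x₀`. -/
def localMetric [IsManifold (𝓡 n) ∞ N] (h : RMetric n N) (x₀ : N) (i j : Fin n) (u : E n) : ℝ :=
  h.inner (ptOfCoord x₀ u) (ofCoord x₀ u (e i)) (ofCoord x₀ u (e j))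

/-- The Randers metric with navigation datum `(h, W)`,
`F(y) = (√(λ h(y,y) + h(W,y)²) - h(W,y)) / λ` with `λ = 1 - h(W,W)`. -/
def randers [IsManifold (𝓡 n) ∞ N] (h : RMetric n N) (W : ∀ x : N, TangentSpace (𝓡 n) x)
    (x : N) (y : TangentSpace (𝓡 n) x) : ℝ :=
  (√((1 - h.inner x (W x) (W x)) * h.inner x y y + h.inner x (W x) y ^ 2) - h.inner x (W x) y)
    / (1 - h.inner x (W x) (W x))

/-- `F` has isotropic `S`-curvature `S = (n + 1) k(x) F`, with respect to the
Busemann–Hausdorff volume form. -/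
def IsotropicSCurv (F : ∀ x : N, TangentSpace (𝓡 n) x → ℝ) (k : N → ℝ) : Prop :=
  ∀ (x : N) (y : TangentSpace (𝓡 n) x), y ≠ 0 → sCurv F x y = ((n : ℝ) + 1) * k x * F x y

/-! ### Normal vectors and shape operators -/

variable {m : ℕ} {M : Type*} [TopologicalSpace M] [ChartedSpace (E m) M]

variable (m) in
/-- `v` belongs to the unit normal bundle of the immersion `φ` in `(N, F)`, over the point `p`. -/
def IsUnitNormal (F : ∀ x : N, TangentSpace (𝓡 n) x → ℝ) (φ : M → N) (p : M)
    (v : TangentSpace (𝓡 n) (φ p)) : Prop :=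
  F (φ p) v = 1 ∧
    ∀ X : TangentSpace (𝓡 m) p, legendre F (φ p) v (mfderiv (𝓡 m) (𝓡 n) φ p X) = 0

variable (m) in
/-- `v` is a unit normal vector of the immersion `φ` in the Riemannian manifold `(N, h)`, over the
point `p`. -/
def IsRiemUnitNormal [IsManifold (𝓡 n) ∞ N] (h : RMetric n N) (φ : M → N) (p : M)
    (v : TangentSpace (𝓡 n) (φ p)) : Prop :=
  h.inner (φ p) v v = 1 ∧
    ∀ X : TangentSpace (𝓡 m) p, h.inner (φ p) v (mfderiv (𝓡 m) (𝓡 n) φ p X) = 0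

variable (m) in
/-- `ν` is an extension of the vector `v` to a vector field along `φ` that, on a neighbourhood of
`p`, is smooth and takes its values in the vectors satisfying `P` (for `P`, see `IsUnitNormal` and
`IsRiemUnitNormal`). -/
def IsLocalExtension [IsManifold (𝓡 n) ∞ N] (φ : M → N) (P : ∀ q : M, TangentSpace (𝓡 n) (φ q) → Prop) (p : M)
    (v : TangentSpace (𝓡 n) (φ p)) (ν : ∀ q : M, TangentSpace (𝓡 n) (φ q)) : Prop :=
  ν p = v ∧ ∃ U ∈ 𝓝 p,
    ContMDiffOn (𝓡 m) (𝓡 n).tangent ∞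
      (fun q => (⟨φ q, ν q⟩ : TangentBundle (𝓡 n) N)) U ∧
    ∀ q ∈ U, P q (ν q)

/-- The covariant derivative at `p` along `X ∈ T_pM` of a vector field `ν` along `φ`, for the
connection coefficients `Γⁱ_{jk}` at `φ p`, in the preferred chart at `φ p`: the vector with
components `X(νⁱ) + Γⁱ_{jk} (dφ X)ʲ ν^k`. -/
def covDeriv (φ : M → N) (p : M) (Γ : Fin n → Fin n → Fin n → ℝ)
    (ν : ∀ q : M, TangentSpace (𝓡 n) (φ q)) (X : TangentSpace (𝓡 m) p) : E n :=
  let dν : E n := mfderiv (𝓡 m) 𝓘(ℝ, E n) (fun q : M => toCoord (φ p) (φ q) (ν q)) p X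
  let dφX : E n := toCoord (φ p) (φ p) (mfderiv (𝓡 m) (𝓡 n) φ p X)
  WithLp.toLp 2 fun i =>
    dν i + ∑ j, ∑ k, Γ i j k * dφX j * (toCoord (φ p) (φ p) (ν p)) k

/-- The bilinear form with matrix `g` on `ℝⁿ`. -/
def bilin (g : Fin n → Fin n → ℝ) (a b : E n) : ℝ := ∑ i, ∑ j, g i j * a i * b j

/-- The coefficients `Γⁱ_{jk}(v)` at `x` of the Chern connection of `F` with reference vector `v`,
in the preferred chart at `x`. -/
def chernAt (F : ∀ x : N, TangentSpace (𝓡 n) x → ℝ) (x : N) (v : TangentSpace (𝓡 n) x)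
    (i j k : Fin n) : ℝ :=
  chern (localFinsler F x) i j k (extChartAt (𝓡 n) x x) (toCoord x x v)

/-- The components of `g_v` at `x`, in the preferred chart at `x`. -/
def fundTensorAt (F : ∀ x : N, TangentSpace (𝓡 n) x → ℝ) (x : N) (v : TangentSpace (𝓡 n) x)
    (i j : Fin n) : ℝ :=
  fundTensor (localFinsler F x) i j (extChartAt (𝓡 n) x x) (toCoord x x v)

variable (m) in
/-- `A : T_pM → T_pM` is the shape operator `A_v` of `φ` in `(N, F)` at the unit normal vector `v`:
`A X = -(D^v_X v)^⊤`, where `D` is the covariant derivative of the Chern connection, `v` is extended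
to a unit normal vector field along `φ`, and `⊤` is the `g_v`-orthogonal projection to `T_pM`; that
is, `D^v_X v + dφ (A X)` is `g_v`-orthogonal to `T_pM`. An extension is required to exist, and the
choice of the extension is required not to matter. -/
def IsShapeOperator [IsManifold (𝓡 n) ∞ N] (F : ∀ x : N, TangentSpace (𝓡 n) x → ℝ) (φ : M → N) (p : M)
    (v : TangentSpace (𝓡 n) (φ p)) (A : Module.End ℝ (TangentSpace (𝓡 m) p)) : Prop :=
  (∃ ν, IsLocalExtension m φ (IsUnitNormal m F φ) p v ν) ∧
  ∀ ν, IsLocalExtension m φ (IsUnitNormal m F φ) p v ν →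
    ∀ X Y : TangentSpace (𝓡 m) p,
      bilin (fundTensorAt F (φ p) v)
        (covDeriv φ p (chernAt F (φ p) v) ν X
          + toCoord (φ p) (φ p) (mfderiv (𝓡 m) (𝓡 n) φ p (A X)))
        (toCoord (φ p) (φ p) (mfderiv (𝓡 m) (𝓡 n) φ p Y)) = 0

variable (m) in
/-- `A : T_pM → T_pM` is the shape operator of `φ` in the Riemannian manifold `(N, h)` at the unit
normal vector `v`: `A X = -(∇^h_X v)^⊤`, where `∇^h` is the Levi-Civita connection, `v` is extended
to a unit normal vector field along `φ`, and `⊤` is the `h`-orthogonal projection to `T_pM`. -/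
def IsRiemShapeOperator [IsManifold (𝓡 n) ∞ N] (h : RMetric n N) (φ : M → N) (p : M)
    (v : TangentSpace (𝓡 n) (φ p)) (A : Module.End ℝ (TangentSpace (𝓡 m) p)) : Prop :=
  (∃ ν, IsLocalExtension m φ (IsRiemUnitNormal m h φ) p v ν) ∧
  ∀ ν, IsLocalExtension m φ (IsRiemUnitNormal m h φ) p v ν →
    ∀ X Y : TangentSpace (𝓡 m) p,
      bilin (fun i j => localMetric h (φ p) i j (extChartAt (𝓡 n) (φ p) (φ p)))
        (covDeriv φ p
            (fun i j k => christoffel (localMetric h (φ p)) i j k (extChartAt (𝓡 n) (φ p) (φ p)))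
            ν X
          + toCoord (φ p) (φ p) (mfderiv (𝓡 m) (𝓡 n) φ p (A X)))
        (toCoord (φ p) (φ p) (mfderiv (𝓡 m) (𝓡 n) φ p Y)) = 0

variable (m) in
/-- The shape operator `A_v` of `φ` in `(N, F)`. -/
def shapeOperator [IsManifold (𝓡 n) ∞ N] (F : ∀ x : N, TangentSpace (𝓡 n) x → ℝ) (φ : M → N) (p : M)
    (v : TangentSpace (𝓡 n) (φ p)) : Module.End ℝ (TangentSpace (𝓡 m) p) :=
  Classical.epsilon (IsShapeOperator m F φ p v)

variable (m) in
/-- The shape operator of `φ` in the Riemannian manifold `(N, h)`. -/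
def riemShapeOperator [IsManifold (𝓡 n) ∞ N] (h : RMetric n N) (φ : M → N) (p : M)
    (v : TangentSpace (𝓡 n) (φ p)) : Module.End ℝ (TangentSpace (𝓡 m) p) :=
  Classical.epsilon (IsRiemShapeOperator m h φ p v)

/-- `X` is a principal vector of the shape operator `A`, with principal curvature `μ`. -/
abbrev IsPrincipal {p : M} (A : Module.End ℝ (TangentSpace (𝓡 m) p)) (μ : ℝ)
    (X : TangentSpace (𝓡 m) p) : Prop :=
  Module.End.HasEigenvector A μ X

end Manifold

end Randers

end

/-! In Zermelo navigation the indicatrix of `F` is the `h`-unit sphere translated by `W`: with `p =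
y - F W`, the metric is determined implicitly by `h(p, p) = F²` (`metric_relVec`). Implicit
differentiation gives `m · F_y(b) = h(p, b)`, where `m = F + h(p, W)` is positive (`fderiv_len`).
Hence `𝐧` is an `F`-unit normal exactly when `𝐧 - W` is an `h`-unit normal (`isUnitNormal_iff`), and
on `T_pM` the form `m g_𝐧` coincides with `h` (`relFactor_mul_bilin_fundTensor`).

The curvature hypothesis is decoded through the geodesic spray `s`. For a Finsler function, the
trace of the nonlinear connection is `½ s(ln det g)` (`sum_dY_geodCoeff`). For a Randers metric,
`det g = det h · (F/m)^(n+1)` (`det_fundTensor`), and the Busemann–Hausdorff density is `√det h`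
(`bhDensity_eq`). The `det h` terms cancel, and `s(F) = 0`, so `S = -(n+1)/2 · s(m)/m`
(`sCurvCoord_eq`). On the indicatrix `s(m) = ½ m (𝓛_W h)(p, p)` (`fderiv_relFactor_spray`). Isotropy
`S = (n+1)kF` at a point is thus turned into `𝓛_W h = -4k h` there (`lieMetric_eq_of_isotropic`).

For the shape operators, the Chern connection with reference vector `y`, contracted with `y`, is the
nonlinear connection (`bilin_chern`), whose lowered form involves only derivatives of `½F²`.
Expanding these for `X, Y` tangent to the submanifold gives `m g_𝐧(D_X 𝐧, Y) = h(∇_X (𝐧 - W), Y) - k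
h(X, Y)` (`bilin_chern_add`). The Lie derivative contributes `-2k` and the derivative of `m` along
the spray contributes `+k`. Since `m g_𝐧 = h` on `T_pM`, projecting yields `A_𝐧 = Ā + k · 1`
(`isShapeOperator_iff`, `shapeOperator_eq`), from which the claims on principal vectors and
curvatures follow.

Well-definedness is proved on the Riemannian side. Projecting a constant coordinate vector to the
moving normal space and normalising gives an extension (`exists_smooth_unit_normal`), and
differentiating the orthogonality relation shows that the tangential part does not depend on the
extension (`coordMetric_fderiv_locField`). Subtracting `W` transports both facts to the Finsler
side. -/

noncomputable section

namespace Randers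

/-! ### Finsler functions in coordinates -/

section Finsler

variable {n : ℕ}

/-- The energy `½ L²`, as a function on the product. -/
def energy (L : E n → E n → ℝ) (z : E n × E n) : ℝ := (1 / 2 : ℝ) * L z.1 z.2 ^ 2

lemma sum_smul_e (v : E n) : ∑ i, v i • e i = v := by
  ext j
  simp [e, Pi.single_apply]

/-- Turns coordinate partials into Fréchet derivatives on the product. Agreement is only asked near
the point, so the rule can be iterated on expressions that are identified only over an open set. -/
lemma dY_eq {g : E n → E n → ℝ} {f : E n × E n → ℝ} {z : E n × E n}
    (h : ∀ᶠ z in 𝓝 z, g z.1 z.2 = f z) (hf : DifferentiableAt ℝ f z) (i : Fin n) :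
    dY i g z.1 z.2 = fderiv ℝ f z (0, e i) := by
  unfold dY
  have h1 : (fun v' => g z.1 v') =ᶠ[𝓝 z.2] fun v' => f (z.1, v') :=
    (Continuous.tendsto (by fun_prop : Continuous fun v' : E n => (z.1, v')) z.2).eventually h
  have h2 : HasFDerivAt (fun v' : E n => (z.1, v')) (ContinuousLinearMap.inr ℝ (E n) (E n)) z.2 :=
    hasFDerivAt_prodMk_right z.1 z.2
  rw [h1.fderiv_eq, show (fun v' => f (z.1, v')) = f ∘ fun v' => (z.1, v') from rfl,
    (hf.hasFDerivAt.comp z.2 h2).fderiv]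
  simp

lemma dX_eq {g : E n → E n → ℝ} {f : E n × E n → ℝ} {z : E n × E n}
    (h : ∀ᶠ z in 𝓝 z, g z.1 z.2 = f z) (hf : DifferentiableAt ℝ f z) (i : Fin n) :
    dX i g z.1 z.2 = fderiv ℝ f z (e i, 0) := by
  unfold dX
  have h1 : (fun u' => g u' z.2) =ᶠ[𝓝 z.1] fun u' => f (u', z.2) :=
    (Continuous.tendsto (by fun_prop : Continuous fun u' : E n => (u', z.2)) z.1).eventually h
  have h2 : HasFDerivAt (fun u' : E n => (u', z.2)) (ContinuousLinearMap.inl ℝ (E n) (E n)) z.1 :=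
    hasFDerivAt_prodMk_left z.1 z.2
  rw [h1.fderiv_eq, show (fun u' => f (u', z.2)) = f ∘ fun u' => (u', z.2) from rfl,
    (hf.hasFDerivAt.comp z.1 h2).fderiv]
  simp

/-! ### Symmetry of second and third Fréchet derivatives. -/

section Calculus

variable {V G : Type*} [NormedAddCommGroup V] [NormedSpace ℝ V] [NormedAddCommGroup G]
  [NormedSpace ℝ G]

lemma contDiffAt_fderiv {f : V → G} {z : V} (hf : ContDiffAt ℝ ∞ f z) :
    ContDiffAt ℝ ∞ (fderiv ℝ f) z := hf.fderiv_right (by norm_num)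

lemma differentiableAt_of_smooth {f : V → G} {z : V} (hf : ContDiffAt ℝ ∞ f z) :
    DifferentiableAt ℝ f z := hf.differentiableAt (by norm_num)

lemma fderiv_fderiv_apply {f : V → G} {z : V} (hf : ContDiffAt ℝ ∞ f z) (a b : V) :
    fderiv ℝ (fun z => fderiv ℝ f z a) z b = fderiv ℝ (fderiv ℝ f) z b a := by
  rw [fderiv_clm_apply (differentiableAt_of_smooth (contDiffAt_fderiv hf)) (by fun_prop)]
  simp

lemma fderiv_fderiv_comm {f : V → G} {z : V} (hf : ContDiffAt ℝ ∞ f z) (a b : V) :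
    fderiv ℝ (fderiv ℝ f) z a b = fderiv ℝ (fderiv ℝ f) z b a :=
  (hf.isSymmSndFDerivAt (by
    rw [minSmoothness_of_isRCLikeNormedField]; exact WithTop.coe_le_coe.mpr le_top)).eq a b

lemma fderiv_fderiv_fderiv_apply {f : V → G} {z : V} (hf : ContDiffAt ℝ ∞ f z) (a b c : V) :
    fderiv ℝ (fun z => fderiv ℝ (fderiv ℝ f) z b c) z a
      = fderiv ℝ (fderiv ℝ (fderiv ℝ f)) z a b c := by
  have h := differentiableAt_of_smooth (contDiffAt_fderiv (contDiffAt_fderiv hf))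
  rw [fderiv_clm_apply (h.clm_apply (by fun_prop)) (by fun_prop),
    fderiv_clm_apply h (by fun_prop)]
  simp

lemma fderiv_three_comm_left {f : V → G} {z : V} (hf : ContDiffAt ℝ ∞ f z) (a b c : V) :
    fderiv ℝ (fderiv ℝ (fderiv ℝ f)) z a b c = fderiv ℝ (fderiv ℝ (fderiv ℝ f)) z b a c := by
  rw [fderiv_fderiv_comm (contDiffAt_fderiv hf)]

/-- Symmetry in the two inner slots comes from differentiating the symmetry of the Hessian, so
smoothness is needed at nearby points too. -/
lemma fderiv_three_comm_right {f : V → G} {z : V} (hf : ∀ᶠ y in 𝓝 z, ContDiffAt ℝ ∞ f y) (a b c : V) :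
    fderiv ℝ (fderiv ℝ (fderiv ℝ f)) z a b c = fderiv ℝ (fderiv ℝ (fderiv ℝ f)) z a c b := by
  rw [← fderiv_fderiv_fderiv_apply hf.self_of_nhds, ← fderiv_fderiv_fderiv_apply hf.self_of_nhds]
  have h : (fun z => fderiv ℝ (fderiv ℝ f) z b c) =ᶠ[𝓝 z]
      fun z => fderiv ℝ (fderiv ℝ f) z c b := by
    filter_upwards [hf] with y hy using fderiv_fderiv_comm hy b c
  rw [h.fderiv_eq]

end Calculus

/-- The conditions on `L` under which the Finsler calculus is used over `Ω`. -/
structure IsFinslerOn (L : E n → E n → ℝ) (Ω : Set (E n × E n)) : Prop where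
  isOpen : IsOpen Ω
  smooth : ∀ z ∈ Ω, ContDiffAt ℝ ∞ (energy L) z
  euler : ∀ z ∈ Ω, fderiv ℝ (energy L) z (0, z.2) = 2 * energy L z
  det_ne_zero : ∀ z ∈ Ω, (Matrix.of fun a b => fundTensor L a b z.1 z.2).det ≠ 0

lemma dY_sq_eq {L : E n → E n → ℝ} {z : E n × E n} (hf : ContDiffAt ℝ ∞ (energy L) z)
    (i : Fin n) : dY i (sq L) z.1 z.2 = 2 * fderiv ℝ (energy L) z (0, e i) := by
  rw [dY_eq (f := fun z => 2 * energy L z)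
    (.of_forall fun z => by simp [sq, energy]) ((differentiableAt_of_smooth hf).const_mul 2),
    fderiv_const_mul (differentiableAt_of_smooth hf)]
  simp

lemma dX_sq_eq {L : E n → E n → ℝ} {z : E n × E n} (hf : ContDiffAt ℝ ∞ (energy L) z)
    (i : Fin n) : dX i (sq L) z.1 z.2 = 2 * fderiv ℝ (energy L) z (e i, 0) := by
  rw [dX_eq (f := fun z => 2 * energy L z)
    (.of_forall fun z => by simp [sq, energy]) ((differentiableAt_of_smooth hf).const_mul 2),
    fderiv_const_mul (differentiableAt_of_smooth hf)]
  simp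

lemma fundTensor_eq {L : E n → E n → ℝ} {z : E n × E n}
    (hf : ∀ᶠ y in 𝓝 z, ContDiffAt ℝ ∞ (energy L) y)
    (i j : Fin n) :
    fundTensor L i j z.1 z.2 = fderiv ℝ (fderiv ℝ (energy L)) z (0, e j) (0, e i) := by
  have hd : DifferentiableAt ℝ (fun z => fderiv ℝ (energy L) z (0, e i)) z :=
    (differentiableAt_of_smooth (contDiffAt_fderiv hf.self_of_nhds)).clm_apply (by fun_prop)
  rw [fundTensor, dY_eq (f := fun z => 2 * fderiv ℝ (energy L) z (0, e i))
    (hf.mono fun z hz => dY_sq_eq hz i) (hd.const_mul 2),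
    fderiv_const_mul hd, smul_apply, fderiv_fderiv_apply hf.self_of_nhds]
  simp

lemma dX_dY_sq_eq {L : E n → E n → ℝ} {z : E n × E n}
    (hf : ∀ᶠ y in 𝓝 z, ContDiffAt ℝ ∞ (energy L) y)
    (k l : Fin n) :
    dX k (dY l (sq L)) z.1 z.2 = 2 * fderiv ℝ (fderiv ℝ (energy L)) z (e k, 0) (0, e l) := by
  have hd : DifferentiableAt ℝ (fun z => fderiv ℝ (energy L) z (0, e l)) z :=
    (differentiableAt_of_smooth (contDiffAt_fderiv hf.self_of_nhds)).clm_apply (by fun_prop)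
  rw [dX_eq (f := fun z => 2 * fderiv ℝ (energy L) z (0, e l))
    (hf.mono fun z hz => dY_sq_eq hz l) (hd.const_mul 2),
    fderiv_const_mul hd, smul_apply, fderiv_fderiv_apply hf.self_of_nhds]
  simp

lemma bilin_fundTensor {L : E n → E n → ℝ} {z : E n × E n}
    (hf : ∀ᶠ y in 𝓝 z, ContDiffAt ℝ ∞ (energy L) y)
    (a b : E n) :
    bilin (fun i j => fundTensor L i j z.1 z.2) a b
      = fderiv ℝ (fderiv ℝ (energy L)) z (0, a) (0, b) := by
  have h : ∀ c : E n, ((0, c) : E n × E n) = ∑ i, c i • ((0, e i) : E n × E n) := fun c => by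
    ext1
    · simp [Prod.fst_sum]
    · simp [Prod.snd_sum, sum_smul_e]
  rw [fderiv_fderiv_comm hf.self_of_nhds, h a, h b]
  simp only [map_sum, map_smul, sum_apply, smul_apply,
    bilin, smul_eq_mul, Finset.mul_sum]
  refine Finset.sum_congr rfl fun j _ => Finset.sum_congr rfl fun i _ => ?_
  rw [fundTensor_eq hf]
  ring

end Finsler

/-! ### Determinants and inverses of matrices of functions -/

section MatrixCalculus

variable {n : ℕ} {V : Type*} [NormedAddCommGroup V] [NormedSpace ℝ V]

lemma contDiffAt_det {A : V → Matrix (Fin n) (Fin n) ℝ} {z : V} {k : WithTop ℕ∞}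
    (h : ∀ i j, ContDiffAt ℝ k (fun z => A z i j) z) : ContDiffAt ℝ k (fun z => (A z).det) z := by
  simp only [Matrix.det_apply']
  exact ContDiffAt.sum fun σ _ => contDiffAt_const.mul (contDiffAt_prod fun i _ => h _ _)

lemma contDiffAt_inv_apply {A : V → Matrix (Fin n) (Fin n) ℝ} {z : V} {k : WithTop ℕ∞}
    (h : ∀ i j, ContDiffAt ℝ k (fun z => A z i j) z) (hd : (A z).det ≠ 0) (i j : Fin n) :
    ContDiffAt ℝ k (fun z => (A z)⁻¹ i j) z := by
  simp only [Matrix.inv_def, Ring.inverse_eq_inv', Matrix.smul_apply, smul_eq_mul,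
    Matrix.adjugate_apply]
  refine ((contDiffAt_det h).inv hd).mul (contDiffAt_det fun a b => ?_)
  by_cases hab : a = j
  · subst hab
    simpa using contDiffAt_const
  · simpa [Matrix.updateRow_ne hab] using h a b

/-- Jacobi's formula. The product rule in the Leibniz expansion produces, for each column, the
determinant with that column replaced by its derivative; Cramer's rule rewrites it through the
inverse matrix. -/
lemma fderiv_det {A : V → Matrix (Fin n) (Fin n) ℝ} {z : V}
    (h : ∀ i j, DifferentiableAt ℝ (fun z => A z i j) z) (hd : (A z).det ≠ 0) (s : V) :
    fderiv ℝ (fun z => (A z).det) z s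
      = (A z).det * ∑ i, ∑ l, (A z)⁻¹ i l * fderiv ℝ (fun z => A z l i) z s := by
  have h1 : HasFDerivAt (fun z => (A z).det)
      (∑ σ : Equiv.Perm (Fin n), ((Equiv.Perm.sign σ : ℤ) : ℝ) •
        ∑ i, (∏ j ∈ Finset.univ.erase i, A z (σ j) j) • fderiv ℝ (fun z => A z (σ i) i) z) z := by
    simp only [Matrix.det_apply']
    refine HasFDerivAt.fun_sum fun σ _ => HasFDerivAt.const_mul ?_ _
    exact HasFDerivAt.finsetProd fun i _ => (h (σ i) i).hasFDerivAt
  have h2 : ∀ i, ((A z).updateCol i fun l => fderiv ℝ (fun z => A z l i) z s).det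
      = (A z).det * ∑ l, (A z)⁻¹ i l * fderiv ℝ (fun z => A z l i) z s := by
    intro i
    rw [← Matrix.cramer_apply, Matrix.cramer_eq_adjugate_mulVec, Matrix.inv_def,
      Ring.inverse_eq_inv']
    simp only [Matrix.mulVec, dotProduct, Matrix.smul_apply, smul_eq_mul, Finset.mul_sum]
    refine Finset.sum_congr rfl fun l _ => ?_
    field_simp
  rw [h1.fderiv, Finset.mul_sum, ← Finset.sum_congr rfl fun i _ => h2 i]
  simp only [Matrix.det_apply', sum_apply, smul_apply, smul_eq_mul, Finset.mul_sum]
  rw [Finset.sum_comm]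
  refine Finset.sum_congr rfl fun i _ => Finset.sum_congr rfl fun σ _ => ?_
  rw [← Finset.mul_prod_erase Finset.univ _ (Finset.mem_univ i)]
  have h3 : ∀ j ∈ Finset.univ.erase i,
      (A z).updateCol i (fun l => fderiv ℝ (fun z => A z l i) z s) (σ j) j = A z (σ j) j :=
    fun j hj => by simp [Matrix.updateCol_ne (Finset.ne_of_mem_erase hj)]
  rw [Finset.prod_congr rfl h3]
  simp
  ring

/-- Raising an index and lowering it again is the identity. This and its converse
`eq_inv_mul_of_bilin` replace formulas containing `g^{il}` by identities between bilinear forms. -/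
lemma bilin_inv_mul {g : Fin n → Fin n → ℝ} (hg : ∀ i j, g i j = g j i)
    (hd : (Matrix.of fun a b => g a b).det ≠ 0) (c : Fin n → ℝ) (b : E n) :
    bilin g (WithLp.toLp 2 fun i => ∑ l, (Matrix.of fun a b => g a b)⁻¹ i l * c l) b
      = ∑ l, c l * b l := by
  set A : Matrix (Fin n) (Fin n) ℝ := Matrix.of fun a b => g a b with hA
  have h : A.mulVec (A⁻¹.mulVec c) = c := by
    rw [Matrix.mulVec_mulVec, Matrix.mul_nonsing_inv _ (isUnit_iff_ne_zero.2 hd),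
      Matrix.one_mulVec]
  have h' : ∀ j, ∑ i, g i j * ∑ l, A⁻¹ i l * c l = c j := fun j => by
    have := congrFun h j
    simp only [Matrix.mulVec, dotProduct] at this
    rw [← this]
    exact Finset.sum_congr rfl fun i _ => by rw [hg]; rfl
  rw [bilin, Finset.sum_comm]
  refine Finset.sum_congr rfl fun j _ => ?_
  rw [← Finset.sum_mul, h']

lemma eq_inv_mul_of_bilin {g : Fin n → Fin n → ℝ} (hg : ∀ i j, g i j = g j i)
    (hd : (Matrix.of fun a b => g a b).det ≠ 0) {c : Fin n → ℝ} {x : E n}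
    (h : ∀ l, bilin g x (e l) = c l) (i : Fin n) :
    x i = ∑ l, (Matrix.of fun a b => g a b)⁻¹ i l * c l := by
  set A : Matrix (Fin n) (Fin n) ℝ := Matrix.of fun a b => g a b with hA
  have h' : A.mulVec x.ofLp = c := by
    ext l
    rw [← h l]
    simp only [bilin, Matrix.mulVec, dotProduct, e, PiLp.single_apply]
    refine Finset.sum_congr rfl fun i _ => ?_
    simp [hA, hg l i]
  have h2 : A⁻¹.mulVec (A.mulVec x.ofLp) = x.ofLp := by
    rw [Matrix.mulVec_mulVec, Matrix.nonsing_inv_mul _ (isUnit_iff_ne_zero.2 hd),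
      Matrix.one_mulVec]
  rw [h'] at h2
  exact (congrFun h2 i).symm

end MatrixCalculus

/-! ### The spray, the nonlinear connection and the Chern connection -/

section Spray

variable {n : ℕ} {L : E n → E n → ℝ} {Ω : Set (E n × E n)} {z : E n × E n}

/-- The vector with components the geodesic coefficients. -/
def geodVec (L : E n → E n → ℝ) (z : E n × E n) : E n :=
  WithLp.toLp 2 fun i => geodCoeff L i z.1 z.2

/-- The geodesic spray. -/
def spray (L : E n → E n → ℝ) (z : E n × E n) : E n × E n := (z.2, -((2 : ℝ) • geodVec L z))

lemma prod_eq_sum_left (c : E n) : ((c, 0) : E n × E n) = ∑ i, c i • ((e i, 0) : E n × E n) := by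
  ext1
  · simp [Prod.fst_sum, sum_smul_e]
  · simp [Prod.snd_sum]

lemma prod_eq_sum_right (c : E n) : ((0, c) : E n × E n) = ∑ i, c i • ((0, e i) : E n × E n) := by
  ext1
  · simp [Prod.fst_sum]
  · simp [Prod.snd_sum, sum_smul_e]

namespace IsFinslerOn

lemma eventually_mem (hL : IsFinslerOn L Ω) (hz : z ∈ Ω) : ∀ᶠ y in 𝓝 z, y ∈ Ω :=
  hL.isOpen.mem_nhds hz

lemma eventually_smooth (hL : IsFinslerOn L Ω) (hz : z ∈ Ω) :
    ∀ᶠ y in 𝓝 z, ContDiffAt ℝ ∞ (energy L) y :=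
  (hL.eventually_mem hz).mono fun y hy => hL.smooth y hy

lemma fundTensor_comm (hL : IsFinslerOn L Ω) (hz : z ∈ Ω) (i j : Fin n) :
    fundTensor L i j z.1 z.2 = fundTensor L j i z.1 z.2 := by
  rw [fundTensor_eq (hL.eventually_smooth hz), fundTensor_eq (hL.eventually_smooth hz),
    fderiv_fderiv_comm (hL.smooth z hz)]

lemma contDiffAt_fundTensor (hL : IsFinslerOn L Ω) (hz : z ∈ Ω) (i j : Fin n) :
    ContDiffAt ℝ ∞ (fun z => fundTensor L i j z.1 z.2) z := by
  have h : (fun z : E n × E n => fundTensor L i j z.1 z.2) =ᶠ[𝓝 z]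
      fun z => fderiv ℝ (fderiv ℝ (energy L)) z (0, e j) (0, e i) :=
    (hL.eventually_mem hz).mono fun y hy => fundTensor_eq (hL.eventually_smooth hy) i j
  refine ContDiffAt.congr_of_eventuallyEq ?_ h
  exact ((contDiffAt_fderiv (contDiffAt_fderiv (hL.smooth z hz))).clm_apply
    contDiffAt_const).clm_apply contDiffAt_const

lemma geodCoeff_eq (hL : IsFinslerOn L Ω) (hz : z ∈ Ω) (i : Fin n) :
    geodCoeff L i z.1 z.2 = ∑ l, fundTensorInv L i l z.1 z.2 *
      ((1 / 2 : ℝ) * (fderiv ℝ (fderiv ℝ (energy L)) z (z.2, 0) (0, e l)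
        - fderiv ℝ (energy L) z (e l, 0))) := by
  rw [geodCoeff, Finset.mul_sum]
  refine Finset.sum_congr rfl fun l _ => ?_
  rw [dX_sq_eq (hL.smooth z hz), Finset.sum_congr rfl fun k _ => by
    rw [dX_dY_sq_eq (hL.eventually_smooth hz) k l], prod_eq_sum_left z.2]
  simp only [map_sum, map_smul, sum_apply, smul_apply, smul_eq_mul]
  rw [Finset.sum_congr rfl fun k _ => by rw [mul_assoc, mul_comm _ (z.2 k)], ← Finset.mul_sum]
  ring

lemma contDiffAt_geodVec (hL : IsFinslerOn L Ω) (hz : z ∈ Ω) : ContDiffAt ℝ ∞ (geodVec L) z := by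
  rw [contDiffAt_euclidean]
  intro i
  have h : (fun z : E n × E n => geodVec L z i) =ᶠ[𝓝 z] fun z => _ :=
    (hL.eventually_mem hz).mono fun y hy => hL.geodCoeff_eq hy i
  refine ContDiffAt.congr_of_eventuallyEq ?_ h
  have h1 := contDiffAt_fderiv (hL.smooth z hz)
  refine ContDiffAt.sum fun l _ => ContDiffAt.mul ?_ (contDiffAt_const.mul (ContDiffAt.sub ?_ ?_))
  · exact contDiffAt_inv_apply (fun a b => hL.contDiffAt_fundTensor hz a b) (hL.det_ne_zero z hz) i l
  · exact ((contDiffAt_fderiv h1).clm_apply (contDiffAt_snd.prodMk contDiffAt_const)).clm_apply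
      contDiffAt_const
  · exact h1.clm_apply contDiffAt_const

/-- The Euler-Lagrange equation. -/
lemma spray_euler_lagrange (hL : IsFinslerOn L Ω) (hz : z ∈ Ω) (Y : E n) :
    fderiv ℝ (fderiv ℝ (energy L)) z (spray L z) (0, Y) = fderiv ℝ (energy L) z (Y, 0) := by
  have h := bilin_inv_mul (fun i j => hL.fundTensor_comm hz i j) (hL.det_ne_zero z hz)
    (fun l => (1 / 2 : ℝ) * (fderiv ℝ (fderiv ℝ (energy L)) z (z.2, 0) (0, e l)
        - fderiv ℝ (energy L) z (e l, 0))) Y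
  have h1 : geodVec L z = WithLp.toLp 2 fun i => ∑ l, fundTensorInv L i l z.1 z.2 *
      ((1 / 2 : ℝ) * (fderiv ℝ (fderiv ℝ (energy L)) z (z.2, 0) (0, e l)
        - fderiv ℝ (energy L) z (e l, 0))) := by
    ext i
    exact hL.geodCoeff_eq hz i
  have h2 := h1 ▸ bilin_fundTensor (hL.eventually_smooth hz) (geodVec L z) Y
  have h3 : ∑ l, (1 / 2 : ℝ) * (fderiv ℝ (fderiv ℝ (energy L)) z (z.2, 0) (0, e l)
        - fderiv ℝ (energy L) z (e l, 0)) * Y l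
      = (1 / 2 : ℝ) * (fderiv ℝ (fderiv ℝ (energy L)) z (z.2, 0) (0, Y)
        - fderiv ℝ (energy L) z (Y, 0)) := by
    rw [prod_eq_sum_left Y, prod_eq_sum_right Y]
    simp only [map_sum, map_smul, smul_eq_mul, ← Finset.sum_sub_distrib, Finset.mul_sum]
    exact Finset.sum_congr rfl fun l _ => by ring
  have h4 : spray L z = (z.2, 0) - (2 : ℝ) • ((0, geodVec L z) : E n × E n) := by
    simp [spray]
  rw [h4, map_sub, map_smul, sub_apply, smul_apply, h1, ← h2, smul_eq_mul]
  simp only [fundTensorInv]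
  rw [h, h3]
  ring

/-- Euler's relation for the 2-homogeneous energy, differentiated once; the extra first-order term
comes from the moving argument `(0, y)`. Differentiating again gives `euler_three`. -/
lemma euler_two (hL : IsFinslerOn L Ω) (hz : z ∈ Ω) (w : E n × E n) :
    fderiv ℝ (fderiv ℝ (energy L)) z w (0, z.2) + fderiv ℝ (energy L) z (0, w.2)
      = 2 * fderiv ℝ (energy L) z w := by
  have h1 : (fun z => fderiv ℝ (energy L) z (0, z.2)) =ᶠ[𝓝 z] fun z => 2 * energy L z :=
    (hL.eventually_mem hz).mono hL.euler
  have h2 := congrArg (fun T : E n × E n →L[ℝ] ℝ => T w) h1.fderiv_eq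
  have h3 : HasFDerivAt (fun z : E n × E n => ((0, z.2) : E n × E n))
      ((ContinuousLinearMap.inr ℝ (E n) (E n)).comp (ContinuousLinearMap.snd ℝ (E n) (E n))) z :=
    ((ContinuousLinearMap.inr ℝ (E n) (E n)).comp (ContinuousLinearMap.snd ℝ (E n) (E n))).hasFDerivAt
  rw [fderiv_const_mul (differentiableAt_of_smooth (hL.smooth z hz)),
    ((differentiableAt_of_smooth
      (contDiffAt_fderiv (hL.smooth z hz))).hasFDerivAt.clm_apply h3).fderiv] at h2
  simp at h2
  linarith

lemma euler_three (hL : IsFinslerOn L Ω) (hz : z ∈ Ω) (w' w : E n × E n) :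
    fderiv ℝ (fderiv ℝ (fderiv ℝ (energy L))) z w' w (0, z.2)
        + fderiv ℝ (fderiv ℝ (energy L)) z w (0, w'.2)
        + fderiv ℝ (fderiv ℝ (energy L)) z w' (0, w.2)
      = 2 * fderiv ℝ (fderiv ℝ (energy L)) z w' w := by
  have h1 : (fun z => fderiv ℝ (fderiv ℝ (energy L)) z w (0, z.2)
      + fderiv ℝ (energy L) z (0, w.2)) =ᶠ[𝓝 z] fun z => 2 * fderiv ℝ (energy L) z w :=
    (hL.eventually_mem hz).mono fun y hy => hL.euler_two hy w
  have h2 := congrArg (fun T : E n × E n →L[ℝ] ℝ => T w') h1.fderiv_eq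
  have h3 : HasFDerivAt (fun z : E n × E n => ((0, z.2) : E n × E n))
      ((ContinuousLinearMap.inr ℝ (E n) (E n)).comp (ContinuousLinearMap.snd ℝ (E n) (E n))) z :=
    ((ContinuousLinearMap.inr ℝ (E n) (E n)).comp (ContinuousLinearMap.snd ℝ (E n) (E n))).hasFDerivAt
  have d1 := contDiffAt_fderiv (hL.smooth z hz)
  have d2 := (differentiableAt_of_smooth (contDiffAt_fderiv d1)).clm_apply
    (differentiableAt_const w)
  have d3 : ∀ w, DifferentiableAt ℝ (fun z => fderiv ℝ (energy L) z w) z := fun w =>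
    (differentiableAt_of_smooth d1).clm_apply (differentiableAt_const w)
  rw [fderiv_const_mul (d3 w), fderiv_fun_add
    (d2.clm_apply h3.differentiableAt) (d3 _), (d2.hasFDerivAt.clm_apply h3).fderiv,
    add_apply, smul_apply, fderiv_fderiv_apply (hL.smooth z hz),
    fderiv_fderiv_apply (hL.smooth z hz),
    fderiv_clm_apply (differentiableAt_of_smooth (contDiffAt_fderiv d1))
      (differentiableAt_const w)] at h2
  simp at h2
  linarith

/-- The energy is constant along the geodesic spray. -/
lemma fderiv_energy_spray (hL : IsFinslerOn L Ω) (hz : z ∈ Ω) :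
    fderiv ℝ (energy L) z (spray L z) = 0 := by
  -- Differentiated homogeneity along the spray, combined with the Euler–Lagrange equation tested on
  -- `y`, yields `dE(s) = 2 dE(s)`.
  have h1 := hL.euler_two hz (spray L z)
  have h2 := hL.spray_euler_lagrange hz z.2
  have h3 : spray L z = (z.2, 0) + (0, (spray L z).2) := by simp [spray]
  have h4 : fderiv ℝ (energy L) z (spray L z)
      = fderiv ℝ (energy L) z (z.2, 0) + fderiv ℝ (energy L) z (0, (spray L z).2) := by
    rw [← map_add, ← h3]
  linarith

/-- The nonlinear connection, with lower index. -/
lemma fderiv_two_nonlin (hL : IsFinslerOn L Ω) (hz : z ∈ Ω) (X Y : E n) :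
    fderiv ℝ (fderiv ℝ (energy L)) z (0, fderiv ℝ (geodVec L) z (0, X)) (0, Y)
      = (1 / 2 : ℝ) * (fderiv ℝ (fderiv ℝ (fderiv ℝ (energy L))) z (spray L z) (0, X) (0, Y)
        + fderiv ℝ (fderiv ℝ (energy L)) z (X, 0) (0, Y)
        - fderiv ℝ (fderiv ℝ (energy L)) z (Y, 0) (0, X)) := by
  have hs := hL.smooth z hz
  have d1 := contDiffAt_fderiv hs
  -- The Euler–Lagrange equation is differentiated in the vertical direction `X`. The spray itself
  -- varies by `(X, -2 N X)`, and this is where the nonlinear connection `N` enters.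
  have h1 : (fun z => fderiv ℝ (fderiv ℝ (energy L)) z (spray L z) (0, Y)) =ᶠ[𝓝 z]
      fun z => fderiv ℝ (energy L) z (Y, 0) :=
    (hL.eventually_mem hz).mono fun y hy => hL.spray_euler_lagrange hy Y
  have h2 := congrArg (fun T : E n × E n →L[ℝ] ℝ => T (0, X)) h1.fderiv_eq
  have dG := (differentiableAt_of_smooth (hL.contDiffAt_geodVec hz)).hasFDerivAt
  have h3 : HasFDerivAt (spray L) ((ContinuousLinearMap.snd ℝ (E n) (E n)).prod
      (-((2 : ℝ) • fderiv ℝ (geodVec L) z))) z :=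
    hasFDerivAt_snd.prodMk (dG.const_smul (2 : ℝ)).neg
  have d2 := (differentiableAt_of_smooth (contDiffAt_fderiv d1)).hasFDerivAt.clm_apply h3
  rw [(d2.clm_apply (hasFDerivAt_const (0, Y) z)).fderiv, fderiv_fderiv_apply hs] at h2
  simp at h2
  have h4 : ((X, -((2 : ℝ) • fderiv ℝ (geodVec L) z (0, X))) : E n × E n)
      = (X, 0) - (2 : ℝ) • (0, fderiv ℝ (geodVec L) z (0, X)) := by simp
  rw [h4, map_sub, map_smul, sub_apply, smul_apply, smul_eq_mul,
    fderiv_three_comm_left hs, fderiv_fderiv_comm hs (0, X) (Y, 0)] at h2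
  linarith

lemma nonlinConn_eq (hL : IsFinslerOn L Ω) (hz : z ∈ Ω) (i j : Fin n) :
    nonlinConn L i j z.1 z.2 = fderiv ℝ (geodVec L) z (0, e j) i := by
  have h : HasFDerivAt (fun z => geodVec L z i)
      ((EuclideanSpace.proj (𝕜 := ℝ) i).comp (fderiv ℝ (geodVec L) z)) z :=
    (EuclideanSpace.proj (𝕜 := ℝ) i).hasFDerivAt.comp z
      (differentiableAt_of_smooth (hL.contDiffAt_geodVec hz)).hasFDerivAt
  rw [nonlinConn, dY_eq (f := fun z => geodVec L z i) (.of_forall fun _ => rfl)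
    h.differentiableAt, h.fderiv]
  simp

end IsFinslerOn

end Spray

/-! ### Contraction of the Chern connection with its reference vector, and the trace of the
nonlinear connection. -/

section ChernTrace

variable {n : ℕ} {L : E n → E n → ℝ} {Ω : Set (E n × E n)} {z : E n × E n}

lemma sum_sum_mul_apply_e (B : E n →ₗ[ℝ] E n →ₗ[ℝ] ℝ) (a b : E n) :
    ∑ j, ∑ k, a j * b k * B (e j) (e k) = B a b := by
  conv_rhs => rw [← sum_smul_e a, ← sum_smul_e b]
  simp only [map_sum, map_smul, LinearMap.sum_apply, LinearMap.smul_apply, smul_eq_mul,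
    Finset.mul_sum]
  rw [Finset.sum_comm]
  exact Finset.sum_congr rfl fun j _ => Finset.sum_congr rfl fun k _ => by ring

namespace IsFinslerOn

/-- The horizontal lift of a vector. -/
def horLift (L : E n → E n → ℝ) (z : E n × E n) : E n →L[ℝ] E n × E n :=
  (ContinuousLinearMap.id ℝ (E n)).prod
    (-(fderiv ℝ (geodVec L) z).comp (ContinuousLinearMap.inr ℝ (E n) (E n)))

lemma horDeriv_fundTensor (hL : IsFinslerOn L Ω) (hz : z ∈ Ω) (k i j : Fin n) :
    horDeriv L k (fundTensor L i j) z.1 z.2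
      = fderiv ℝ (fderiv ℝ (fderiv ℝ (energy L))) z (horLift L z (e k)) (0, e j) (0, e i) := by
  have hd : DifferentiableAt ℝ
      (fun z => fderiv ℝ (fderiv ℝ (energy L)) z (0, e j) (0, e i)) z :=
    ((differentiableAt_of_smooth (contDiffAt_fderiv (contDiffAt_fderiv
      (hL.smooth z hz)))).clm_apply (differentiableAt_const _)).clm_apply (differentiableAt_const _)
  have hev : ∀ᶠ y in 𝓝 z, fundTensor L i j y.1 y.2
      = fderiv ℝ (fderiv ℝ (energy L)) y (0, e j) (0, e i) :=
    (hL.eventually_mem hz).mono fun y hy => fundTensor_eq (hL.eventually_smooth hy) i j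
  have h1 : horLift L z (e k) = (e k, 0)
      - ∑ r, nonlinConn L r k z.1 z.2 • ((0, e r) : E n × E n) := by
    have : ∀ r, nonlinConn L r k z.1 z.2 = fderiv ℝ (geodVec L) z (0, e k) r :=
      fun r => hL.nonlinConn_eq hz r k
    simp only [this, ← prod_eq_sum_right]
    simp [horLift]
  rw [horDeriv, dX_eq hev hd, h1]
  simp only [dY_eq hev hd, fderiv_fderiv_fderiv_apply (hL.smooth z hz), map_sub, map_sum,
    map_smul, sub_apply, sum_apply, smul_apply, smul_eq_mul]

/-- The 2-homogeneity of the geodesic coefficients is extracted from that of the energy: both sides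
have the same pairing with every `Y` under the nondegenerate fundamental tensor. Consequently the
horizontal lift of `y` is the spray. -/
lemma fderiv_geodVec_self (hL : IsFinslerOn L Ω) (hz : z ∈ Ω) :
    fderiv ℝ (geodVec L) z (0, z.2) = (2 : ℝ) • geodVec L z := by
  have hb : ∀ x : E n, (∀ Y : E n, fderiv ℝ (fderiv ℝ (energy L)) z (0, x) (0, Y) = 0) →
      x = 0 := fun x hx => by
    ext i
    rw [eq_inv_mul_of_bilin (fun i j => hL.fundTensor_comm hz i j) (hL.det_ne_zero z hz)
      (c := fun _ => 0) (x := x)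
      (fun l => by rw [bilin_fundTensor (hL.eventually_smooth hz), hx])]
    simp
  rw [← sub_eq_zero]
  refine hb _ fun Y => ?_
  have hs := hL.smooth z hz
  have h1 : ((0, fderiv ℝ (geodVec L) z (0, z.2) - (2 : ℝ) • geodVec L z) : E n × E n)
      = (0, fderiv ℝ (geodVec L) z (0, z.2)) + (spray L z - (z.2, 0)) := by
    simp [spray, sub_eq_add_neg]
  rw [h1, map_add, map_sub, add_apply, sub_apply, hL.fderiv_two_nonlin hz,
    fderiv_three_comm_right (hL.eventually_smooth hz), hL.spray_euler_lagrange hz]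
  have h2 := hL.euler_three hz (spray L z) (0, Y)
  have h3 := hL.euler_two hz (Y, 0)
  have h4 : spray L z = (z.2, 0) + (0, (spray L z).2) := by simp [spray]
  have h5 := hL.spray_euler_lagrange hz Y
  have h6 : fderiv ℝ (fderiv ℝ (energy L)) z (spray L z) (0, Y)
      = fderiv ℝ (fderiv ℝ (energy L)) z (z.2, 0) (0, Y)
        + fderiv ℝ (fderiv ℝ (energy L)) z (0, (spray L z).2) (0, Y) := by
    rw [← add_apply, ← map_add, ← h4]
  rw [fderiv_fderiv_comm hs (0, Y)] at h2
  have h7 : fderiv ℝ (energy L) z ((0 : E n), (0 : E n)) = 0 := map_zero _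
  simp only [h7] at h3
  linarith

/-- The Chern connection with reference vector, contracted with the reference vector. -/
lemma bilin_chern (hL : IsFinslerOn L Ω) (hz : z ∈ Ω) (X Y : E n) :
    bilin (fun i j => fundTensor L i j z.1 z.2)
        (WithLp.toLp 2 fun i => ∑ j, ∑ k, chern L i j k z.1 z.2 * X j * z.2 k) Y
      = fderiv ℝ (fderiv ℝ (energy L)) z (0, fderiv ℝ (geodVec L) z (0, X)) (0, Y) := by
  have hs := hL.smooth z hz
  set T := fderiv ℝ (fderiv ℝ (fderiv ℝ (energy L))) z with hT
  set P := horLift L z with hP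
  set Q := ContinuousLinearMap.inr ℝ (E n) (E n) with hQ
  have hPz : P z.2 = spray L z := by
    simp [hP, horLift, spray, hL.fderiv_geodVec_self hz]
  have hy : ∀ w Y, T w (0, Y) (0, z.2) = 2 * fderiv ℝ (fderiv ℝ (energy L)) z w (0, Y)
      - fderiv ℝ (fderiv ℝ (energy L)) z (0, w.2) (0, Y)
      - fderiv ℝ (fderiv ℝ (energy L)) z w (0, Y) := fun w Y => by
    have := hL.euler_three hz w (0, Y)
    rw [fderiv_fderiv_comm hs (0, Y) (0, w.2)] at this
    simp only at this
    linarith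
  -- The vertical part of the horizontal lift drops out by homogeneity, because the Cartan tensor
  -- vanishes when contracted with `y`.
  have hyP : ∀ a b, T (P a) (0, z.2) (0, b)
      = fderiv ℝ (fderiv ℝ (energy L)) z (a, 0) (0, b) := fun a b => by
    rw [hT, fderiv_three_comm_right (hL.eventually_smooth hz), hy]
    have : P a = (a, 0) + (0, (P a).2) := by simp [hP, horLift]
    have h' : fderiv ℝ (fderiv ℝ (energy L)) z (P a) (0, b)
      = fderiv ℝ (fderiv ℝ (energy L)) z (a, 0) (0, b)
        + fderiv ℝ (fderiv ℝ (energy L)) z (0, (P a).2) (0, b) := by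
      rw [← add_apply, ← map_add, ← this]
    rw [h']
    ring
  -- `e1`, `e2` and `e3` are the three terms of the Christoffel-type formula after contraction with
  -- `X` and `y`. The first becomes a derivative along the spray; the other two reduce to mixed
  -- Hessian terms by `hyP`.
  have e1 : ∀ l, ∑ j, ∑ k, X j * z.2 k * T (P (e k)) (Q (e l)) (Q (e j))
      = T (P z.2) (Q (e l)) (Q X) := fun l =>
    sum_sum_mul_apply_e (LinearMap.mk₂ ℝ (fun a b => T (P b) (Q (e l)) (Q a))
      (by simp) (by simp) (by simp) (by simp)) X z.2
  have e2 : ∀ l, ∑ j, ∑ k, X j * z.2 k * T (P (e j)) (Q (e l)) (Q (e k))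
      = T (P X) (Q (e l)) (Q z.2) := fun l =>
    sum_sum_mul_apply_e (LinearMap.mk₂ ℝ (fun a b => T (P a) (Q (e l)) (Q b))
      (by simp) (by simp) (by simp) (by simp)) X z.2
  have e3 : ∀ l, ∑ j, ∑ k, X j * z.2 k * T (P (e l)) (Q (e k)) (Q (e j))
      = T (P (e l)) (Q z.2) (Q X) := fun l =>
    sum_sum_mul_apply_e (LinearMap.mk₂ ℝ (fun a b => T (P (e l)) (Q b) (Q a))
      (by simp) (by simp) (by simp) (by simp)) X z.2
  have h1 : (WithLp.toLp 2 fun i => ∑ j, ∑ k, chern L i j k z.1 z.2 * X j * z.2 k)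
      = WithLp.toLp 2 fun i => ∑ l, (Matrix.of fun a b => fundTensor L a b z.1 z.2)⁻¹ i l *
        ((1 / 2 : ℝ) * (T (P z.2) (Q (e l)) (Q X) + T (P X) (Q (e l)) (Q z.2)
          - T (P (e l)) (Q z.2) (Q X))) := by
    ext i
    simp only [← e1, ← e2, ← e3, ← Finset.sum_add_distrib, ← Finset.sum_sub_distrib,
      Finset.mul_sum]
    simp only [chern, Finset.mul_sum, Finset.sum_mul, hL.horDeriv_fundTensor hz, fundTensorInv]
    rw [Finset.sum_congr rfl fun j _ => Finset.sum_comm, Finset.sum_comm]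
    refine Finset.sum_congr rfl fun l _ => Finset.sum_congr rfl fun j _ =>
      Finset.sum_congr rfl fun k _ => ?_
    simp only [hP, hQ, hT, ContinuousLinearMap.inr_apply]
    ring
  rw [h1, bilin_inv_mul (fun i j => hL.fundTensor_comm hz i j) (hL.det_ne_zero z hz),
    hL.fderiv_two_nonlin hz, hPz]
  have h2 : ∑ l, (1 / 2 : ℝ) * (T (spray L z) (Q (e l)) (Q X) + T (P X) (Q (e l)) (Q z.2)
          - T (P (e l)) (Q z.2) (Q X)) * Y l
      = (1 / 2 : ℝ) * (T (spray L z) (Q Y) (Q X) + T (P X) (Q Y) (Q z.2)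
          - T (P Y) (Q z.2) (Q X)) := by
    conv_rhs => rw [← sum_smul_e Y]
    simp only [map_sum, map_smul, sum_apply, smul_apply, smul_eq_mul, ← Finset.sum_add_distrib,
      ← Finset.sum_sub_distrib, Finset.mul_sum]
    exact Finset.sum_congr rfl fun l _ => by ring
  rw [h2]
  simp only [hQ, ContinuousLinearMap.inr_apply]
  rw [hyP, hT, fderiv_three_comm_right (hL.eventually_smooth hz) (P X), ← hT, hyP,
    fderiv_three_comm_right (hL.eventually_smooth hz)]

/-- The trace of the nonlinear connection. -/
lemma sum_dY_geodCoeff (hL : IsFinslerOn L Ω) (hz : z ∈ Ω) :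
    ∑ i, dY i (geodCoeff L i) z.1 z.2
      = (1 / 2 : ℝ) * (fderiv ℝ (fun z : E n × E n =>
          (Matrix.of fun a b => fundTensor L a b z.1 z.2).det) z (spray L z)
        / (Matrix.of fun a b => fundTensor L a b z.1 z.2).det) := by
  have hs := hL.smooth z hz
  have hcomm : ∀ i l, (Matrix.of fun a b => fundTensor L a b z.1 z.2)⁻¹ i l
      = (Matrix.of fun a b => fundTensor L a b z.1 z.2)⁻¹ l i := fun i l => by
    have h : (Matrix.of fun a b => fundTensor L a b z.1 z.2).IsSymm := by
      ext a b
      exact hL.fundTensor_comm hz b a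
    exact (h.inv).apply l i
  rw [fderiv_det (A := fun z : E n × E n => Matrix.of fun a b => fundTensor L a b z.1 z.2)
    (fun i j => differentiableAt_of_smooth (hL.contDiffAt_fundTensor hz i j))
    (hL.det_ne_zero z hz), mul_div_cancel_left₀ _ (hL.det_ne_zero z hz)]
  have hf : ∀ i l, fderiv ℝ (fun z : E n × E n =>
      (Matrix.of fun a b => fundTensor L a b z.1 z.2) l i) z (spray L z)
      = fderiv ℝ (fderiv ℝ (fderiv ℝ (energy L))) z (spray L z) (0, e i) (0, e l) := fun i l => by
    have hev : (fun z : E n × E n =>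
      (Matrix.of fun a b => fundTensor L a b z.1 z.2) l i) =ᶠ[𝓝 z]
      fun y => fderiv ℝ (fderiv ℝ (energy L)) y (0, e i) (0, e l) :=
      (hL.eventually_mem hz).mono fun y hy => fundTensor_eq (hL.eventually_smooth hy) l i
    rw [hev.fderiv_eq, fderiv_fderiv_fderiv_apply hs]
  have hN : ∀ i, dY i (geodCoeff L i) z.1 z.2
      = ∑ l, (Matrix.of fun a b => fundTensor L a b z.1 z.2)⁻¹ i l * ((1 / 2 : ℝ) *
        (fderiv ℝ (fderiv ℝ (fderiv ℝ (energy L))) z (spray L z) (0, e i) (0, e l)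
        + fderiv ℝ (fderiv ℝ (energy L)) z (e i, 0) (0, e l)
        - fderiv ℝ (fderiv ℝ (energy L)) z (e l, 0) (0, e i))) := fun i => by
    have h1 := hL.nonlinConn_eq hz i i
    rw [nonlinConn] at h1
    rw [h1]
    refine eq_inv_mul_of_bilin (fun i j => hL.fundTensor_comm hz i j) (hL.det_ne_zero z hz)
      (fun l => ?_) i
    rw [bilin_fundTensor (hL.eventually_smooth hz), hL.fderiv_two_nonlin hz]
  simp only [hN, hf]
  -- The two mixed Hessian terms in the lowered nonlinear connection form its antisymmetric part, so
  -- the trace against the symmetric inverse matrix cancels them.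
  have hanti : ∑ i, ∑ l, (Matrix.of fun a b => fundTensor L a b z.1 z.2)⁻¹ i l *
      fderiv ℝ (fderiv ℝ (energy L)) z (e i, 0) (0, e l)
      = ∑ i, ∑ l, (Matrix.of fun a b => fundTensor L a b z.1 z.2)⁻¹ i l *
      fderiv ℝ (fderiv ℝ (energy L)) z (e l, 0) (0, e i) := by
    rw [Finset.sum_comm]
    exact Finset.sum_congr rfl fun i _ => Finset.sum_congr rfl fun l _ => by rw [hcomm]
  simp only [mul_sub, mul_add, Finset.sum_sub_distrib, Finset.sum_add_distrib,
    mul_left_comm _ (1 / 2 : ℝ), ← Finset.mul_sum, hanti]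
  ring

end IsFinslerOn

end ChernTrace

/-! ### Randers metrics in coordinates -/

section RandersScalar

/-- The value of the Randers metric with `λ = 1 - h(W,W)` on a vector `y` with `h(y,y) = α` and
`h(W,y) = β`. -/
def randersVal (lam α β : ℝ) : ℝ := (√(lam * α + β ^ 2) - β) / lam

variable {lam α β : ℝ}

/-- The navigation equation `h(y - FW, y - FW) = F²`, written in the scalars `λ`, `α`, `β`; the
Randers formula solves this quadratic in `F`. -/
lemma randersVal_quadratic (hl : 0 < lam) (hα : 0 ≤ α) :
    lam * randersVal lam α β ^ 2 + 2 * β * randersVal lam α β = α := by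
  have h := Real.sq_sqrt (by positivity : 0 ≤ lam * α + β ^ 2)
  unfold randersVal
  field_simp
  linear_combination h

lemma randersVal_pos (hl : 0 < lam) (hα : 0 < α) : 0 < randersVal lam α β := by
  refine div_pos (sub_pos.2 ?_) hl
  calc β ≤ |β| := le_abs_self β
    _ = √(β ^ 2) := (Real.sqrt_sq_eq_abs β).symm
    _ < √(lam * α + β ^ 2) := Real.sqrt_lt_sqrt (sq_nonneg _) (by nlinarith [mul_pos hl hα])

/-- With `1 - λ = h(W, W)`, the right-hand expression is `h(y - W, y - W)`: the unit ball of `F` is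
the `h`-unit ball translated by `W`. -/
lemma randersVal_lt_one_iff (hl : 0 < lam) (hα : 0 ≤ α) :
    randersVal lam α β < 1 ↔ α - 2 * β + (1 - lam) < 1 := by
  rw [randersVal, div_lt_one hl, sub_lt_iff_lt_add]
  constructor
  · intro h
    have h0 : 0 < lam + β := (Real.sqrt_nonneg _).trans_lt h
    rw [Real.sqrt_lt' h0] at h
    nlinarith
  · intro h
    have h0 : 0 < lam + β := by linarith
    rw [Real.sqrt_lt' h0]
    nlinarith [mul_lt_mul_of_pos_left h hl]

lemma randersVal_eq_one_iff (hl : 0 < lam) (hα : 0 ≤ α) :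
    randersVal lam α β = 1 ↔ α - 2 * β + (1 - lam) = 1 := by
  rw [randersVal, div_eq_one_iff_eq hl.ne', sub_eq_iff_eq_add]
  constructor
  · intro h
    have h1 := Real.sq_sqrt (by positivity : 0 ≤ lam * α + β ^ 2)
    rw [h] at h1
    have : lam * (α - 2 * β - lam) = 0 := by linarith
    rcases mul_eq_zero.1 this with h2 | h2
    · exact absurd h2 hl.ne'
    · linarith
  · intro h
    have h0 : 0 ≤ lam + β := by linarith
    rw [Real.sqrt_eq_iff_mul_self_eq (by positivity) h0]
    have : α = lam + 2 * β := by linarith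
    rw [this]
    ring

end RandersScalar

/-! ### Product rules for a variable bilinear form. -/

section BilinCalculus

variable {V G : Type*} [NormedAddCommGroup V] [NormedSpace ℝ V] [NormedAddCommGroup G]
  [NormedSpace ℝ G]

lemma fderiv_bilin {H : V → G →L[ℝ] G →L[ℝ] ℝ} {a b : V → G} {z : V}
    (hH : DifferentiableAt ℝ H z) (ha : DifferentiableAt ℝ a z) (hb : DifferentiableAt ℝ b z)
    (w : V) :
    fderiv ℝ (fun z => H z (a z) (b z)) z w
      = fderiv ℝ H z w (a z) (b z) + H z (fderiv ℝ a z w) (b z) + H z (a z) (fderiv ℝ b z w) := by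
  rw [((hH.hasFDerivAt.clm_apply ha.hasFDerivAt).clm_apply hb.hasFDerivAt).fderiv]
  simp
  ring

lemma fderiv_comp_fst {X : Type*} [NormedAddCommGroup X] [NormedSpace ℝ X] {H : V → G}
    {z : V × X} (hH : DifferentiableAt ℝ H z.1) (w : V × X) :
    fderiv ℝ (fun z : V × X => H z.1) z w = fderiv ℝ H z.1 w.1 := by
  rw [show (fun z : V × X => H z.1) = H ∘ Prod.fst from rfl,
    (hH.hasFDerivAt.comp z hasFDerivAt_fst).fderiv]
  simp

end BilinCalculus

/-! ### Derivatives of a Randers metric up to third order. -/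

section RandersCoord

variable {n : ℕ}

/-- `L` is over `U` the Randers metric with navigation datum `(H, W)`. -/
structure IsRandersOn (U : Set (E n)) (H : E n → E n →L[ℝ] E n →L[ℝ] ℝ) (W : E n → E n)
    (L : E n → E n → ℝ) : Prop where
  isOpen : IsOpen U
  smooth_metric : ∀ u ∈ U, ContDiffAt ℝ ∞ H u
  smooth_wind : ∀ u ∈ U, ContDiffAt ℝ ∞ W u
  symm : ∀ u ∈ U, ∀ a b, H u a b = H u b a
  pos : ∀ u ∈ U, ∀ a, a ≠ 0 → 0 < H u a a
  lt_one : ∀ u ∈ U, H u (W u) (W u) < 1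
  eq_val : ∀ u ∈ U, ∀ v, L u v = randersVal (1 - H u (W u) (W u)) (H u v v) (H u (W u) v)

/-- The domain of the slit tangent bundle over `U`. -/
def slit (U : Set (E n)) : Set (E n × E n) := {z | z.1 ∈ U ∧ z.2 ≠ 0}

/-- `L`, as a function on the product. -/
def len (L : E n → E n → ℝ) (z : E n × E n) : ℝ := L z.1 z.2

/-- The vector `y - L W`. -/
def relVec (W : E n → E n) (L : E n → E n → ℝ) (z : E n × E n) : E n := z.2 - len L z • W z.1

/-- The factor `L + h(y - L W, W)`. -/
def relFactor (H : E n → E n →L[ℝ] E n →L[ℝ] ℝ) (W : E n → E n) (L : E n → E n → ℝ)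
    (z : E n × E n) : ℝ := len L z + H z.1 (relVec W L z) (W z.1)

namespace IsRandersOn

variable {U : Set (E n)} {H : E n → E n →L[ℝ] E n →L[ℝ] ℝ} {W : E n → E n} {L : E n → E n → ℝ}
  {z : E n × E n}

lemma nonneg (hR : IsRandersOn U H W L) {u : E n} (hu : u ∈ U) (a : E n) : 0 ≤ H u a a := by
  rcases eq_or_ne a 0 with rfl | ha
  · simp
  · exact (hR.pos u hu a ha).le

lemma isOpen_slit (hR : IsRandersOn U H W L) : IsOpen (slit U) :=
  (hR.isOpen.preimage continuous_fst).inter (isOpen_ne.preimage continuous_snd)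

lemma eventually_mem (hR : IsRandersOn U H W L) (hz : z ∈ slit U) : ∀ᶠ y in 𝓝 z, y ∈ slit U :=
  hR.isOpen_slit.mem_nhds hz

lemma len_pos (hR : IsRandersOn U H W L) (hz : z ∈ slit U) : 0 < len L z := by
  rw [len, hR.eq_val _ hz.1]
  exact randersVal_pos (by linarith [hR.lt_one _ hz.1]) (hR.pos _ hz.1 _ hz.2)

/-- The implicit equation of the metric. All derivatives of `L` below are found by differentiating
it, which avoids the square root. -/
lemma metric_relVec (hR : IsRandersOn U H W L) (hz : z.1 ∈ U) :
    H z.1 (relVec W L z) (relVec W L z) = len L z ^ 2 := by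
  have h := randersVal_quadratic (β := H z.1 (W z.1) z.2)
    (by linarith [hR.lt_one _ hz] : 0 < 1 - H z.1 (W z.1) (W z.1)) (hR.nonneg hz z.2)
  rw [← hR.eq_val _ hz] at h
  simp only [relVec, len, map_sub, map_smul, sub_apply, smul_apply, smul_eq_mul,
    hR.symm _ hz z.2 (W z.1)]
  linear_combination -h

lemma smooth_metric_fst (hR : IsRandersOn U H W L) (hz : z ∈ slit U) :
    ContDiffAt ℝ ∞ (fun z : E n × E n => H z.1) z :=
  (hR.smooth_metric _ hz.1).comp z contDiffAt_fst

lemma smooth_wind_fst (hR : IsRandersOn U H W L) (hz : z ∈ slit U) :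
    ContDiffAt ℝ ∞ (fun z : E n × E n => W z.1) z :=
  (hR.smooth_wind _ hz.1).comp z contDiffAt_fst

lemma smooth_len (hR : IsRandersOn U H W L) (hz : z ∈ slit U) : ContDiffAt ℝ ∞ (len L) z := by
  have hev : len L =ᶠ[𝓝 z] fun z => randersVal (1 - H z.1 (W z.1) (W z.1)) (H z.1 z.2 z.2)
      (H z.1 (W z.1) z.2) := (hR.eventually_mem hz).mono fun y hy => hR.eq_val _ hy.1 _
  refine ContDiffAt.congr_of_eventuallyEq ?_ hev
  have h1 := hR.smooth_metric_fst hz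
  have h2 := hR.smooth_wind_fst hz
  have h3 : ContDiffAt ℝ ∞ (fun z : E n × E n => 1 - H z.1 (W z.1) (W z.1)) z :=
    contDiffAt_const.sub ((h1.clm_apply h2).clm_apply h2)
  have h4 : ContDiffAt ℝ ∞ (fun z : E n × E n => H z.1 z.2 z.2) z :=
    (h1.clm_apply contDiffAt_snd).clm_apply contDiffAt_snd
  have h5 : ContDiffAt ℝ ∞ (fun z : E n × E n => H z.1 (W z.1) z.2) z :=
    (h1.clm_apply h2).clm_apply contDiffAt_snd
  have hl : 0 < 1 - H z.1 (W z.1) (W z.1) := by linarith [hR.lt_one _ hz.1]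
  refine ContDiffAt.div (ContDiffAt.sub (ContDiffAt.sqrt ((h3.mul h4).add (h5.pow 2)) ?_) h5)
    h3 hl.ne'
  have := mul_pos hl (hR.pos _ hz.1 _ hz.2)
  positivity

lemma smooth_relVec (hR : IsRandersOn U H W L) (hz : z ∈ slit U) :
    ContDiffAt ℝ ∞ (relVec W L) z :=
  contDiffAt_snd.sub ((hR.smooth_len hz).smul (hR.smooth_wind_fst hz))

lemma smooth_relFactor (hR : IsRandersOn U H W L) (hz : z ∈ slit U) :
    ContDiffAt ℝ ∞ (relFactor H W L) z :=
  (hR.smooth_len hz).add (((hR.smooth_metric_fst hz).clm_apply (hR.smooth_relVec hz)).clm_apply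
    (hR.smooth_wind_fst hz))

lemma fderiv_relVec (hR : IsRandersOn U H W L) (hz : z ∈ slit U) (w : E n × E n) :
    fderiv ℝ (relVec W L) z w
      = w.2 - fderiv ℝ (len L) z w • W z.1 - len L z • fderiv ℝ W z.1 w.1 := by
  have h1 := differentiableAt_of_smooth (hR.smooth_len hz)
  have h2 := differentiableAt_of_smooth (hR.smooth_wind_fst hz)
  have h3 : HasFDerivAt (relVec W L) _ z :=
    hasFDerivAt_snd.sub (h1.hasFDerivAt.smul h2.hasFDerivAt)
  rw [h3.fderiv]
  simp only [sub_apply, add_apply, smul_apply, ContinuousLinearMap.coe_snd',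
    ContinuousLinearMap.smulRight_apply,
    fderiv_comp_fst (differentiableAt_of_smooth (hR.smooth_wind _ hz.1))]
  abel

lemma fderiv_metric (hR : IsRandersOn U H W L) (hz : z ∈ slit U) {a b : E n × E n → E n}
    (ha : DifferentiableAt ℝ a z) (hb : DifferentiableAt ℝ b z) (w : E n × E n) :
    fderiv ℝ (fun z => H z.1 (a z) (b z)) z w = fderiv ℝ H z.1 w.1 (a z) (b z)
      + H z.1 (fderiv ℝ a z w) (b z) + H z.1 (a z) (fderiv ℝ b z w) := by
  rw [fderiv_bilin (H := fun z : E n × E n => H z.1)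
    (differentiableAt_of_smooth (hR.smooth_metric_fst hz)) ha hb,
    fderiv_comp_fst (differentiableAt_of_smooth (hR.smooth_metric _ hz.1))]

lemma fderiv_metric_symm (hR : IsRandersOn U H W L) {u : E n} (hu : u ∈ U) (c a b : E n) :
    fderiv ℝ H u c a b = fderiv ℝ H u c b a := by
  have hd := differentiableAt_of_smooth (hR.smooth_metric u hu)
  have h1 := fderiv_bilin hd (differentiableAt_const a) (differentiableAt_const b) c
  have h2 := fderiv_bilin hd (differentiableAt_const b) (differentiableAt_const a) c
  have h3 : (fun u => H u a b) =ᶠ[𝓝 u] fun u => H u b a := by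
    filter_upwards [hR.isOpen.mem_nhds hu] with y hy using hR.symm y hy a b
  rw [h3.fderiv_eq, h2] at h1
  simpa using h1.symm

/-- The first derivatives of a Randers metric. -/
lemma fderiv_len (hR : IsRandersOn U H W L) (hz : z ∈ slit U) (w : E n × E n) :
    fderiv ℝ (len L) z w * relFactor H W L z
      = (1 / 2 : ℝ) * fderiv ℝ H z.1 w.1 (relVec W L z) (relVec W L z) + H z.1 (relVec W L z) w.2
        - len L z * H z.1 (relVec W L z) (fderiv ℝ W z.1 w.1) := by
  have hp := differentiableAt_of_smooth (hR.smooth_relVec hz)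
  -- Differentiating `h(p, p) = L²` gives a term `-dL(w) h(p, W)` from the variation of `p = y - L
  -- W`. Collected with `L dL(w)`, it produces the factor `m`.
  have h1 : (fun z => H z.1 (relVec W L z) (relVec W L z)) =ᶠ[𝓝 z] fun z => len L z ^ 2 :=
    (hR.eventually_mem hz).mono fun y hy => hR.metric_relVec hy.1
  have h2 := hR.fderiv_metric hz hp hp w
  rw [h1.fderiv_eq, fderiv_fun_pow 2 (differentiableAt_of_smooth (hR.smooth_len hz)),
    hR.symm _ hz.1 (fderiv ℝ (relVec W L) z w), hR.fderiv_relVec hz] at h2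
  simp only [map_sub, map_smul, smul_apply, smul_eq_mul, nsmul_eq_mul] at h2
  rw [relFactor]
  norm_num at h2
  linear_combination (1 / 2 : ℝ) * h2

lemma fderiv_len_inr (hR : IsRandersOn U H W L) (hz : z ∈ slit U) (b : E n) :
    fderiv ℝ (len L) z (0, b) * relFactor H W L z = H z.1 (relVec W L z) b := by
  simpa using hR.fderiv_len hz (0, b)

lemma fderiv_relFactor (hR : IsRandersOn U H W L) (hz : z ∈ slit U) (w : E n × E n) :
    fderiv ℝ (relFactor H W L) z w = fderiv ℝ (len L) z w
      + fderiv ℝ H z.1 w.1 (relVec W L z) (W z.1)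
      + H z.1 (w.2 - fderiv ℝ (len L) z w • W z.1 - len L z • fderiv ℝ W z.1 w.1) (W z.1)
      + H z.1 (relVec W L z) (fderiv ℝ W z.1 w.1) := by
  have hp := differentiableAt_of_smooth (hR.smooth_relVec hz)
  have hW := differentiableAt_of_smooth (hR.smooth_wind_fst hz)
  have hl := differentiableAt_of_smooth (hR.smooth_len hz)
  have hm : DifferentiableAt ℝ (fun z => H z.1 (relVec W L z) (W z.1)) z :=
    ((differentiableAt_of_smooth (hR.smooth_metric_fst hz)).clm_apply hp).clm_apply hW
  have : fderiv ℝ (relFactor H W L) z = _ := fderiv_fun_add hl hm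
  rw [this, add_apply, hR.fderiv_metric hz hp hW, hR.fderiv_relVec hz,
    fderiv_comp_fst (differentiableAt_of_smooth (hR.smooth_wind _ hz.1))]
  ring

/-- The second derivatives of a Randers metric. -/
lemma fderiv_two_len (hR : IsRandersOn U H W L) (hz : z ∈ slit U) (w : E n × E n) (b : E n) :
    fderiv ℝ (fderiv ℝ (len L)) z w (0, b) * relFactor H W L z
        + fderiv ℝ (len L) z (0, b) * fderiv ℝ (relFactor H W L) z w
      = fderiv ℝ H z.1 w.1 (relVec W L z) b
        + H z.1 (w.2 - fderiv ℝ (len L) z w • W z.1 - len L z • fderiv ℝ W z.1 w.1) b := by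
  have hp := differentiableAt_of_smooth (hR.smooth_relVec hz)
  have hm := differentiableAt_of_smooth (hR.smooth_relFactor hz)
  have hl : DifferentiableAt ℝ (fun z => fderiv ℝ (len L) z (0, b)) z :=
    (differentiableAt_of_smooth (contDiffAt_fderiv (hR.smooth_len hz))).clm_apply
      (differentiableAt_const _)
  have h1 : (fun z => fderiv ℝ (len L) z (0, b) * relFactor H W L z) =ᶠ[𝓝 z]
      fun z => H z.1 (relVec W L z) b :=
    (hR.eventually_mem hz).mono fun y hy => hR.fderiv_len_inr hy b
  have h2 := hR.fderiv_metric hz hp (differentiableAt_const b) w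
  rw [← h1.fderiv_eq, fderiv_fun_mul hl hm, hR.fderiv_relVec hz] at h2
  simp only [add_apply, smul_apply, smul_eq_mul, fderiv_fderiv_apply (hR.smooth_len hz)] at h2
  rw [fderiv_fun_const] at h2
  simp at h2
  simp
  linear_combination h2

/-- For vectors tangent to the indicatrix the correction terms vanish and `m` times the vertical
Hessian is `h`. -/
lemma fderiv_two_len_inr (hR : IsRandersOn U H W L) (hz : z ∈ slit U) (a b : E n) :
    fderiv ℝ (fderiv ℝ (len L)) z (0, a) (0, b) * relFactor H W L z
      = H z.1 (a - fderiv ℝ (len L) z (0, a) • W z.1) (b - fderiv ℝ (len L) z (0, b) • W z.1)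
        - fderiv ℝ (len L) z (0, a) * fderiv ℝ (len L) z (0, b) := by
  have h1 := hR.fderiv_two_len hz (0, a) b
  rw [hR.fderiv_relFactor hz] at h1
  simp only [map_zero, zero_apply, smul_zero, sub_zero, map_sub, map_smul, sub_apply, smul_apply,
    smul_eq_mul, add_zero, zero_add] at h1 ⊢
  linear_combination h1

/-- The derivative of the vertical Hessian of a Randers metric, in a direction that preserves
the metric, on vectors tangent to the indicatrix. -/
lemma fderiv_three_len (hR : IsRandersOn U H W L) (hz : z ∈ slit U) {s : E n × E n}
    {X Y : E n} (hX : fderiv ℝ (len L) z (0, X) = 0) (hY : fderiv ℝ (len L) z (0, Y) = 0) :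
    fderiv ℝ (fderiv ℝ (fderiv ℝ (len L))) z s (0, X) (0, Y) * relFactor H W L z
        + fderiv ℝ (fderiv ℝ (len L)) z (0, X) (0, Y) * fderiv ℝ (relFactor H W L) z s
      = fderiv ℝ H z.1 s.1 X Y - fderiv ℝ (fderiv ℝ (len L)) z s (0, X) * H z.1 (W z.1) Y
        - fderiv ℝ (fderiv ℝ (len L)) z s (0, Y) * H z.1 (W z.1) X := by
  have hl := hR.smooth_len hz
  have hm := differentiableAt_of_smooth (hR.smooth_relFactor hz)
  have hl1 : ∀ b : E n, DifferentiableAt ℝ (fun z => fderiv ℝ (len L) z (0, b)) z := fun b =>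
    (differentiableAt_of_smooth (contDiffAt_fderiv hl)).clm_apply (differentiableAt_const _)
  have hl2 : DifferentiableAt ℝ (fun z => fderiv ℝ (fderiv ℝ (len L)) z (0, X) (0, Y)) z :=
    ((differentiableAt_of_smooth (contDiffAt_fderiv (contDiffAt_fderiv hl))).clm_apply
      (differentiableAt_const _)).clm_apply (differentiableAt_const _)
  have hW := differentiableAt_of_smooth (hR.smooth_wind_fst hz)
  have hv : ∀ b : E n, HasFDerivAt (fun z => b - fderiv ℝ (len L) z (0, b) • W z.1) _ z :=
    fun b => ((hl1 b).hasFDerivAt.smul hW.hasFDerivAt).const_sub b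
  -- The full Hessian formula must be differentiated, since `dL(0, X)` and `dL(0, Y)` vanish only at
  -- `z`. Their derivatives produce the two terms containing `W`, whereas their product contributes
  -- nothing to first order.
  have h1 : (fun z => fderiv ℝ (fderiv ℝ (len L)) z (0, X) (0, Y) * relFactor H W L z) =ᶠ[𝓝 z]
      fun z => H z.1 (X - fderiv ℝ (len L) z (0, X) • W z.1)
          (Y - fderiv ℝ (len L) z (0, Y) • W z.1)
        - fderiv ℝ (len L) z (0, X) * fderiv ℝ (len L) z (0, Y) :=
    (hR.eventually_mem hz).mono fun y hy => hR.fderiv_two_len_inr hy X Y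
  have h2 := congrArg (fun T : E n × E n →L[ℝ] ℝ => T s) h1.fderiv_eq
  have hd : DifferentiableAt ℝ (fun z => H z.1 (X - fderiv ℝ (len L) z (0, X) • W z.1)
          (Y - fderiv ℝ (len L) z (0, Y) • W z.1)) z :=
    ((differentiableAt_of_smooth (hR.smooth_metric_fst hz)).clm_apply
      (hv X).differentiableAt).clm_apply (hv Y).differentiableAt
  rw [fderiv_fun_mul hl2 hm, fderiv_fun_sub hd ((hl1 X).fun_mul (hl1 Y)), sub_apply,
    hR.fderiv_metric hz (hv X).differentiableAt (hv Y).differentiableAt, (hv X).fderiv,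
    (hv Y).fderiv, fderiv_fun_mul (hl1 X) (hl1 Y)] at h2
  simp only [add_apply, smul_apply, neg_apply, smul_eq_mul, fderiv_fderiv_apply hl,
    fderiv_fderiv_fderiv_apply hl, ContinuousLinearMap.smulRight_apply, hX, hY, zero_smul, zero_apply,
    sub_zero, add_zero, zero_add, map_neg, map_smul] at h2
  rw [hR.symm _ hz.1 X (W z.1)] at h2
  linear_combination h2

end IsRandersOn

end RandersCoord

/-! ### Volume density and determinant of the fundamental tensor of a Randers metric. -/

section RandersDet

variable {n : ℕ}

/-- The matrix of a bilinear form on `ℝⁿ`. -/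
def gramMatrix (B : E n →L[ℝ] E n →L[ℝ] ℝ) : Matrix (Fin n) (Fin n) ℝ :=
  Matrix.of fun i j => B (e i) (e j)

lemma clm_eq_sum (B : E n →L[ℝ] E n →L[ℝ] ℝ) (a b : E n) :
    B a b = ∑ i, ∑ j, a i * b j * B (e i) (e j) := by
  have h := sum_sum_mul_apply_e (LinearMap.mk₂ ℝ (fun a b => B a b) (by simp) (by simp)
    (by simp) (by simp)) a b
  simpa using h.symm

lemma gramMatrix_mul (B : E n →L[ℝ] E n →L[ℝ] ℝ) (P Q : Matrix (Fin n) (Fin n) ℝ) (a b : Fin n) :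
    (P.transpose * gramMatrix B * Q) a b
      = B (WithLp.toLp 2 fun i => P i a) (WithLp.toLp 2 fun j => Q j b) := by
  rw [clm_eq_sum, Finset.sum_comm]
  simp only [Matrix.mul_apply, Matrix.transpose_apply, gramMatrix, Matrix.of_apply,
    Finset.sum_mul]
  exact Finset.sum_congr rfl fun j _ => Finset.sum_congr rfl fun i _ => by ring

lemma det_one_add_vecMulVec (u v : Fin n → ℝ) :
    (1 + Matrix.vecMulVec u v).det = 1 + ∑ i, v i * u i := by
  rw [Matrix.vecMulVec_eq Unit, Matrix.det_one_add_replicateCol_mul_replicateRow]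
  rfl

lemma toLp_one_add_vecMulVec (u : E n) (v : Fin n → ℝ) (a : Fin n) :
    (WithLp.toLp 2 fun i => (1 + Matrix.vecMulVec u.ofLp v) i a) = e a + v a • u := by
  ext i
  simp [Matrix.vecMulVec_apply, Matrix.one_apply, e, mul_comm]

lemma sum_apply_e_mul (l : E n →L[ℝ] ℝ) (v : E n) : ∑ i, l (e i) * v i = l v := by
  conv_rhs => rw [← sum_smul_e v]
  simp [mul_comm]

lemma gramMatrix_posDef {B : E n →L[ℝ] E n →L[ℝ] ℝ} (hs : ∀ a b, B a b = B b a)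
    (hp : ∀ a, a ≠ 0 → 0 < B a a) : (gramMatrix B).PosDef := by
  refine Matrix.PosDef.of_dotProduct_mulVec_pos ?_ fun x hx => ?_
  · rw [Matrix.IsHermitian]
    ext i j
    simp [gramMatrix, hs (e i)]
  · have hx' : (WithLp.toLp 2 x : E n) ≠ 0 := fun h => hx (by simpa using h)
    have := hp _ hx'
    rw [clm_eq_sum] at this
    have h2 : star x ⬝ᵥ (gramMatrix B).mulVec x = ∑ i, ∑ j, x i * x j * B (e i) (e j) := by
      simp only [dotProduct, Matrix.mulVec, gramMatrix, Finset.mul_sum, Matrix.of_apply]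
      exact Finset.sum_congr rfl fun i _ => Finset.sum_congr rfl fun j _ => by
        rw [star_trivial]
        ring
    rw [h2]
    exact this

open scoped MatrixOrder in
/-- The volume of the unit ball of a positive definite quadratic form. -/
lemma volume_quadratic_ball {B : E n →L[ℝ] E n →L[ℝ] ℝ} (hs : ∀ a b, B a b = B b a)
    (hp : ∀ a, a ≠ 0 → 0 < B a a) (w : E n) :
    (volume {v : E n | B (v - w) (v - w) < 1}).toReal
      = (volume (Metric.ball (0 : E n) 1)).toReal / √(gramMatrix B).det := by
  have hpd := gramMatrix_posDef hs hp
  -- The positive square root of the Gram matrix carries the centred ellipsoid to the Euclidean unit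
  -- ball; its determinant gives the volume ratio, and the translation by `w` has no effect.
  set A := CFC.sqrt (gramMatrix B) with hA
  have hAA : A * A = gramMatrix B := CFC.sqrt_mul_sqrt_self _ hpd.posSemidef.nonneg
  have hAH : A.transpose = A := by
    have := (Matrix.nonneg_iff_posSemidef.1 (CFC.sqrt_nonneg (gramMatrix B))).isHermitian
    rw [← Matrix.conjTranspose_eq_transpose_of_trivial]
    exact this
  have hdet : A.det ^ 2 = (gramMatrix B).det := by rw [pow_two, ← Matrix.det_mul, hAA]
  have hA0 : A.det ≠ 0 := fun h => by
    rw [h] at hdet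
    exact hpd.det_pos.ne' (by simpa using hdet.symm)
  set f : E n →ₗ[ℝ] E n := Matrix.toLpLin 2 2 A with hf
  have hfB : ∀ v, ‖f v‖ ^ 2 = B v v := by
    intro v
    rw [← real_inner_self_eq_norm_sq]
    have h1 : inner ℝ (f v) (f v) = v.ofLp ⬝ᵥ ((A.transpose * A).mulVec v.ofLp) := by
      rw [← Matrix.mulVec_mulVec, Matrix.dotProduct_mulVec, Matrix.vecMul_transpose]
      rw [hf, Matrix.toLpLin_apply, EuclideanSpace.inner_eq_star_dotProduct]
      simp
    rw [h1, hAH, hAA, clm_eq_sum]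
    simp only [dotProduct, Matrix.mulVec, gramMatrix, Finset.mul_sum, Matrix.of_apply]
    exact Finset.sum_congr rfl fun i _ => Finset.sum_congr rfl fun j _ => by ring
  have hset : {v : E n | B (v - w) (v - w) < 1} = (fun v => v - w) ⁻¹' (f ⁻¹' Metric.ball 0 1) := by
    ext v
    simp only [Set.mem_ofPred_eq, Set.mem_preimage, mem_ball_zero_iff, ← hfB]
    rw [sq_lt_one_iff₀ (norm_nonneg _)]
  have hfdet : LinearMap.det f = A.det := LinearMap.det_toLpLin 2 A
  rw [hset, show (fun v : E n => v - w) = fun v => v + -w from funext fun v => sub_eq_add_neg v w,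
    measure_preimage_add_right, Measure.addHaar_preimage_linearMap volume
    (by rw [hfdet]; exact hA0), hfdet, ENNReal.toReal_mul,
    ENNReal.toReal_ofReal (abs_nonneg _), ← hdet, Real.sqrt_sq_eq_abs, abs_inv]
  ring

namespace IsRandersOn

variable {U : Set (E n)} {H : E n → E n →L[ℝ] E n →L[ℝ] ℝ} {W : E n → E n} {L : E n → E n → ℝ}
  {z : E n × E n}

/-- The `F`-unit ball is a translate of the `h`-unit ball, and Lebesgue measure is translation
invariant. The density is therefore the Riemannian one, with no trace of the wind. -/
lemma bhDensity_eq (hR : IsRandersOn U H W L) {u : E n} (hu : u ∈ U) :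
    bhDensity L u = √(gramMatrix (H u)).det := by
  have hset : {v : E n | L u v < 1} = {v : E n | H u (v - W u) (v - W u) < 1} := by
    ext v
    rw [Set.mem_ofPred_eq, Set.mem_ofPred_eq, hR.eq_val u hu,
      randersVal_lt_one_iff (by linarith [hR.lt_one u hu]) (hR.nonneg hu v)]
    simp only [map_sub, sub_apply, hR.symm u hu v (W u)]
    constructor <;> intro h <;> linarith
  have hb : (volume (Metric.ball (0 : E n) 1)).toReal ≠ 0 :=
    (ENNReal.toReal_pos (Metric.measure_ball_pos volume 0 one_pos).ne'
      measure_ball_lt_top.ne).ne'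
  rw [bhDensity, hset, volume_quadratic_ball (hR.symm u hu) (hR.pos u hu), div_div_eq_mul_div,
    mul_div_cancel_left₀ _ hb]

/-- The factor `m = λL + h(W, y)` is exactly the square root in the Randers formula. -/
lemma relFactor_pos (hR : IsRandersOn U H W L) (hz : z ∈ slit U) : 0 < relFactor H W L z := by
  have hl : 0 < 1 - H z.1 (W z.1) (W z.1) := by linarith [hR.lt_one _ hz.1]
  have h1 : len L z = randersVal (1 - H z.1 (W z.1) (W z.1)) (H z.1 z.2 z.2) (H z.1 (W z.1) z.2) :=
    hR.eq_val _ hz.1 _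
  have h2 : relFactor H W L z = √((1 - H z.1 (W z.1) (W z.1)) * H z.1 z.2 z.2
      + H z.1 (W z.1) z.2 ^ 2) := by
    have h3 : len L z * (1 - H z.1 (W z.1) (W z.1)) + H z.1 (W z.1) z.2 = √((1 - H z.1 (W z.1) (W z.1)) * H z.1 z.2 z.2
      + H z.1 (W z.1) z.2 ^ 2) := by
      rw [h1, randersVal, div_mul_cancel₀ _ hl.ne']
      ring
    rw [← h3, relFactor, relVec, map_sub, sub_apply, map_smul, smul_apply, smul_eq_mul,
      hR.symm _ hz.1 z.2]
    ring
  rw [h2]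
  have := mul_pos hl (hR.pos _ hz.1 _ hz.2)
  positivity

lemma smooth_energy (hR : IsRandersOn U H W L) (hz : z ∈ slit U) :
    ContDiffAt ℝ ∞ (energy L) z :=
  contDiffAt_const.mul ((hR.smooth_len hz).pow 2)

lemma fderiv_energy (hR : IsRandersOn U H W L) (hz : z ∈ slit U) (w : E n × E n) :
    fderiv ℝ (energy L) z w = len L z * fderiv ℝ (len L) z w := by
  have hl := differentiableAt_of_smooth (hR.smooth_len hz)
  rw [show energy L = fun z => (1 / 2 : ℝ) * len L z ^ 2 from rfl,
    fderiv_const_mul (hl.fun_pow 2), fderiv_fun_pow 2 hl]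
  simp
  ring

lemma fderiv_two_energy (hR : IsRandersOn U H W L) (hz : z ∈ slit U) (a b : E n × E n) :
    fderiv ℝ (fderiv ℝ (energy L)) z a b = fderiv ℝ (len L) z a * fderiv ℝ (len L) z b
      + len L z * fderiv ℝ (fderiv ℝ (len L)) z a b := by
  have hl := hR.smooth_len hz
  have h1 : (fun z => fderiv ℝ (energy L) z b) =ᶠ[𝓝 z] fun z => len L z * fderiv ℝ (len L) z b :=
    (hR.eventually_mem hz).mono fun y hy => hR.fderiv_energy hy b
  rw [← fderiv_fderiv_apply (hR.smooth_energy hz), h1.fderiv_eq,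
    fderiv_fun_mul (differentiableAt_of_smooth hl)
      ((differentiableAt_of_smooth (contDiffAt_fderiv hl)).clm_apply (differentiableAt_const _)),
    add_apply, smul_apply, smul_apply, fderiv_fderiv_apply hl]
  simp only [smul_eq_mul]
  ring

lemma fderiv_three_energy (hR : IsRandersOn U H W L) (hz : z ∈ slit U) (a b c : E n × E n) :
    fderiv ℝ (fderiv ℝ (fderiv ℝ (energy L))) z a b c
      = fderiv ℝ (fderiv ℝ (len L)) z a b * fderiv ℝ (len L) z c
      + fderiv ℝ (len L) z b * fderiv ℝ (fderiv ℝ (len L)) z a c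
      + fderiv ℝ (len L) z a * fderiv ℝ (fderiv ℝ (len L)) z b c
      + len L z * fderiv ℝ (fderiv ℝ (fderiv ℝ (len L))) z a b c := by
  have hl := hR.smooth_len hz
  have hl0 := differentiableAt_of_smooth hl
  have hl1 : ∀ b, DifferentiableAt ℝ (fun z => fderiv ℝ (len L) z b) z := fun b =>
    (differentiableAt_of_smooth (contDiffAt_fderiv hl)).clm_apply (differentiableAt_const _)
  have hl2 : DifferentiableAt ℝ (fun z => fderiv ℝ (fderiv ℝ (len L)) z b c) z :=
    ((differentiableAt_of_smooth (contDiffAt_fderiv (contDiffAt_fderiv hl))).clm_apply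
      (differentiableAt_const _)).clm_apply (differentiableAt_const _)
  have h1 : (fun z => fderiv ℝ (fderiv ℝ (energy L)) z b c) =ᶠ[𝓝 z] fun z =>
      fderiv ℝ (len L) z b * fderiv ℝ (len L) z c
      + len L z * fderiv ℝ (fderiv ℝ (len L)) z b c :=
    (hR.eventually_mem hz).mono fun y hy => hR.fderiv_two_energy hy b c
  rw [← fderiv_fderiv_fderiv_apply (hR.smooth_energy hz), h1.fderiv_eq,
    fderiv_fun_add ((hl1 b).fun_mul (hl1 c)) (hl0.fun_mul hl2), fderiv_fun_mul (hl1 b) (hl1 c),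
    fderiv_fun_mul hl0 hl2]
  simp only [add_apply, smul_apply, smul_eq_mul, fderiv_fderiv_apply hl,
    fderiv_fderiv_fderiv_apply hl]
  ring

lemma fundTensor_eq (hR : IsRandersOn U H W L) (hz : z ∈ slit U) (a b : Fin n) :
    fundTensor L a b z.1 z.2
      = fderiv ℝ (len L) z (0, e b) * fderiv ℝ (len L) z (0, e a)
        + len L z * fderiv ℝ (fderiv ℝ (len L)) z (0, e b) (0, e a) := by
  rw [Randers.fundTensor_eq ((hR.eventually_mem hz).mono fun y hy => hR.smooth_energy hy),
    hR.fderiv_two_energy hz]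

lemma det_fundTensor (hR : IsRandersOn U H W L) (hz : z ∈ slit U) :
    (Matrix.of fun a b => fundTensor L a b z.1 z.2).det
      = (gramMatrix (H z.1)).det * (len L z / relFactor H W L z) ^ (n + 1) := by
  have hl := hR.len_pos hz
  have hm := hR.relFactor_pos hz
  set l := len L z with hl_def
  set m := relFactor H W L z with hm_def
  set p := relVec W L z with hp_def
  set η : E n →L[ℝ] ℝ := (fderiv ℝ (len L) z).comp (ContinuousLinearMap.inr ℝ (E n) (E n)) with hη
  -- With `η` the vertical differential of `L`, the fundamental tensor is `l/m` times `h(a - η(a)W,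
  -- b - η(b)W) + ((m - l)/l) η(a)η(b)`. Since `h(a - η(a)W, p) = l η(a)`, adding `(m - l)/l² · p`
  -- to `-W` in the second slot absorbs the rank-one term. Both factors are then rank-one
  -- perturbations of the identity, with determinants `l/m` and `1`.
  set q : E n := ((m - l) / l ^ 2) • p - W z.1 with hq
  have hη_apply : ∀ b, η b = H z.1 p b / m := fun b => by
    rw [eq_div_iff hm.ne', ← hR.fderiv_len_inr hz b]
    simp [hη, hm_def]
  have hpp : H z.1 p p = l ^ 2 := hR.metric_relVec hz.1
  have hpW : H z.1 p (W z.1) = m - l := by simp [hm_def, relFactor, hl_def, hp_def]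
  have hWp : H z.1 (W z.1) p = m - l := by rw [hR.symm _ hz.1, hpW]
  have hmat : (Matrix.of fun a b => fundTensor L a b z.1 z.2)
      = (l / m) • ((1 + Matrix.vecMulVec (-W z.1).ofLp fun a => η (e a)).transpose
        * gramMatrix (H z.1) * (1 + Matrix.vecMulVec q.ofLp fun a => η (e a))) := by
    ext a b
    rw [Matrix.smul_apply, gramMatrix_mul, toLp_one_add_vecMulVec, toLp_one_add_vecMulVec,
      Matrix.of_apply, hR.fundTensor_eq hz]
    have h2 := hR.fderiv_two_len_inr hz (e b) (e a)
    have hη' : ∀ b, fderiv ℝ (len L) z (0, b) = η b := fun b => by simp [hη]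
    have h3 : H z.1 (e a) p = m * η (e a) := by
      rw [hη_apply, hR.symm _ hz.1]
      field_simp
    rw [hη', hη', ← eq_div_iff hm.ne'] at h2
    rw [hη', hη', h2, hq]
    simp only [map_add, map_sub, map_smul, add_apply, sub_apply, smul_apply, smul_eq_mul,
      map_neg, neg_apply, smul_neg]
    rw [h3, hWp, hR.symm _ hz.1 (e b) (e a), hR.symm _ hz.1 (e b) (W z.1),
      hR.symm _ hz.1 (W z.1) (e a)]
    field_simp
    ring
  have hηp : η p = l ^ 2 / m := by rw [hη_apply, hpp]
  have hηW : η (W z.1) = (m - l) / m := by rw [hη_apply, hpW]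
  have hdet1 : (1 + Matrix.vecMulVec (-W z.1).ofLp fun a => η (e a)).det = l / m := by
    rw [det_one_add_vecMulVec, sum_apply_e_mul, map_neg, hηW]
    field_simp
    ring
  have hdet2 : (1 + Matrix.vecMulVec q.ofLp fun a => η (e a)).det = 1 := by
    rw [det_one_add_vecMulVec, sum_apply_e_mul, hq, map_sub, map_smul, hηW, hηp, smul_eq_mul]
    field_simp
    ring
  rw [hmat, Matrix.det_smul, Matrix.det_mul, Matrix.det_mul, Matrix.det_transpose, hdet1, hdet2,
    Fintype.card_fin]
  ring

lemma isFinslerOn (hR : IsRandersOn U H W L) : IsFinslerOn L (slit U) where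
  isOpen := hR.isOpen_slit
  smooth z hz := hR.smooth_energy hz
  euler z hz := by
    have hm := hR.relFactor_pos hz
    -- Homogeneity of `L` read off from the first derivative: `h(p, y) = h(p, p) + L h(p, W) = L m`.
    have h : fderiv ℝ (len L) z (0, z.2) = len L z := by
      refine mul_right_cancel₀ hm.ne' ?_
      rw [hR.fderiv_len_inr hz]
      have h1 := hR.metric_relVec hz.1
      have h2 : z.2 = relVec W L z + len L z • W z.1 := by simp [relVec]
      conv_lhs => rw [h2]
      rw [map_add, map_smul, h1, relFactor, smul_eq_mul]
      ring
    rw [hR.fderiv_energy hz, h, energy, len]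
    ring
  det_ne_zero z hz := by
    rw [hR.det_fundTensor hz]
    exact mul_ne_zero (gramMatrix_posDef (hR.symm _ hz.1) (hR.pos _ hz.1)).det_pos.ne'
      (pow_ne_zero _ (div_pos (hR.len_pos hz) (hR.relFactor_pos hz)).ne')

end IsRandersOn

end RandersDet

/-! ### The `S`-curvature and the normal derivative of a Randers metric. -/

section RandersCurvature

variable {n : ℕ}

/-- The Lie derivative of the metric `H` along `W`. -/
def lieMetric (H : E n → E n →L[ℝ] E n →L[ℝ] ℝ) (W : E n → E n) (u a b : E n) : ℝ :=
  fderiv ℝ H u (W u) a b + H u (fderiv ℝ W u a) b + H u a (fderiv ℝ W u b)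

/-- The Levi-Civita connection form `h(Γ(a, p), b)` of the metric `H`. -/
def leviCivita (H : E n → E n →L[ℝ] E n →L[ℝ] ℝ) (u p a b : E n) : ℝ :=
  (1 / 2 : ℝ) * (fderiv ℝ H u a p b + fderiv ℝ H u p a b - fderiv ℝ H u b a p)

namespace IsRandersOn

variable {U : Set (E n)} {H : E n → E n →L[ℝ] E n →L[ℝ] ℝ} {W : E n → E n} {L : E n → E n → ℝ}
  {z : E n × E n}

lemma fderiv_len_spray (hR : IsRandersOn U H W L) (hz : z ∈ slit U) :
    fderiv ℝ (len L) z (spray L z) = 0 := by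
  have h := hR.isFinslerOn.fderiv_energy_spray hz
  rw [hR.fderiv_energy hz] at h
  exact (mul_eq_zero.1 h).resolve_left (hR.len_pos hz).ne'

lemma smooth_det (hR : IsRandersOn U H W L) {u : E n} (hu : u ∈ U) :
    ContDiffAt ℝ ∞ (fun u => (gramMatrix (H u)).det) u :=
  contDiffAt_det fun _ _ => ((hR.smooth_metric u hu).clm_apply contDiffAt_const).clm_apply
    contDiffAt_const

lemma det_pos (hR : IsRandersOn U H W L) {u : E n} (hu : u ∈ U) :
    0 < (gramMatrix (H u)).det :=
  (gramMatrix_posDef (hR.symm _ hu) (hR.pos _ hu)).det_pos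

lemma sum_fderiv_log_bhDensity (hR : IsRandersOn U H W L) {u : E n} (hu : u ∈ U) (v : E n) :
    ∑ i, v i * fderiv ℝ (fun u' => Real.log (bhDensity L u')) u (e i)
      = (1 / 2 : ℝ) * (fderiv ℝ (fun u => (gramMatrix (H u)).det) u v
        / (gramMatrix (H u)).det) := by
  have hD := differentiableAt_of_smooth (hR.smooth_det hu)
  have hev : (fun u' => Real.log (bhDensity L u')) =ᶠ[𝓝 u]
      fun u' => (1 / 2 : ℝ) * Real.log (gramMatrix (H u')).det := by
    filter_upwards [hR.isOpen.mem_nhds hu] with y hy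
    rw [hR.bhDensity_eq hy, Real.log_sqrt (hR.det_pos hy).le]
    ring
  rw [hev.fderiv_eq, fderiv_const_mul (hD.log (hR.det_pos hu).ne'),
    fderiv.log hD (hR.det_pos hu).ne']
  simp only [mul_comm (v _), sum_apply_e_mul]
  simp
  ring

/-- The `S`-curvature of a Randers metric. -/
lemma sCurvCoord_eq (hR : IsRandersOn U H W L) (hz : z ∈ slit U) :
    sCurvCoord L z.1 z.2 = -(((n : ℝ) + 1) / 2)
      * (fderiv ℝ (relFactor H W L) z (spray L z) / relFactor H W L z) := by
  have hl := hR.len_pos hz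
  have hm := hR.relFactor_pos hz
  have hD := hR.det_pos hz.1
  have hev : (fun z : E n × E n => (Matrix.of fun a b => fundTensor L a b z.1 z.2).det) =ᶠ[𝓝 z]
      fun z => (gramMatrix (H z.1)).det * (len L z / relFactor H W L z) ^ (n + 1) :=
    (hR.eventually_mem hz).mono fun y hy => hR.det_fundTensor hy
  have dD : DifferentiableAt ℝ (fun z : E n × E n => (gramMatrix (H z.1)).det) z :=
    (differentiableAt_of_smooth (hR.smooth_det hz.1)).comp z differentiableAt_fst
  have dl := differentiableAt_of_smooth (hR.smooth_len hz)
  have dm := differentiableAt_of_smooth (hR.smooth_relFactor hz)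
  have dr : DifferentiableAt ℝ (fun z => len L z / relFactor H W L z) z :=
    differentiableAt_of_smooth ((hR.smooth_len hz).div (hR.smooth_relFactor hz) hm.ne')
  have hsp : (spray L z).1 = z.2 := rfl
  -- As `L` is constant along the spray, only `m` contributes to the derivative of `(L/m)^(n+1)`;
  -- the `det h` part of the trace is cancelled by the volume term.
  have hq : fderiv ℝ (fun z => len L z / relFactor H W L z) z (spray L z)
      = -(len L z * fderiv ℝ (relFactor H W L) z (spray L z)) / relFactor H W L z ^ 2 := by
    have h1 : (fun z => len L z / relFactor H W L z * relFactor H W L z) =ᶠ[𝓝 z] len L :=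
      (hR.eventually_mem hz).mono fun y hy => div_mul_cancel₀ _ (hR.relFactor_pos hy).ne'
    have h2 := congrArg (fun T : E n × E n →L[ℝ] ℝ => T (spray L z)) h1.fderiv_eq
    rw [fderiv_fun_mul dr dm, hR.fderiv_len_spray hz] at h2
    simp only [add_apply, smul_apply, smul_eq_mul] at h2
    field_simp at h2 ⊢
    linarith
  rw [sCurvCoord, hR.isFinslerOn.sum_dY_geodCoeff hz, hR.sum_fderiv_log_bhDensity hz.1,
    hR.det_fundTensor hz, hev.fderiv_eq,
    fderiv_fun_mul dD (dr.fun_pow (n + 1)),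
    fderiv_fun_pow (n + 1) dr]
  simp only [add_apply, smul_apply, smul_eq_mul, nsmul_eq_mul, hq, hsp,
    fderiv_comp_fst (H := fun u => (gramMatrix (H u)).det)
      (differentiableAt_of_smooth (hR.smooth_det hz.1))]
  simp only [Nat.add_sub_cancel, pow_succ]
  push_cast
  have hr : (len L z / relFactor H W L z) ^ n ≠ 0 := (pow_pos (div_pos hl hm) n).ne'
  generalize (len L z / relFactor H W L z) ^ n = r at *
  field_simp
  ring

/-- On the indicatrix the Euler–Lagrange equation for `½L²` passes to `L` itself, because `L` is
conserved along the spray. -/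
lemma fderiv_two_len_spray (hR : IsRandersOn U H W L) (hz : z ∈ slit U) (hz1 : len L z = 1)
    (Y : E n) :
    fderiv ℝ (fderiv ℝ (len L)) z (spray L z) (0, Y) = fderiv ℝ (len L) z (Y, 0) := by
  have h := hR.isFinslerOn.spray_euler_lagrange hz Y
  rw [hR.fderiv_two_energy hz, hR.fderiv_energy hz, hR.fderiv_len_spray hz, hz1] at h
  linarith

/-- Testing the second-derivative formula on `b = W` and subtracting it from the derivative of `m`
eliminates the unknown acceleration of the spray. What remains is `(1 - dL(0, W)) s(m) = ½ (𝓛_W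
h)(p, p)`, and `1 - dL(0, W) = 1/m`. -/
lemma fderiv_relFactor_spray (hR : IsRandersOn U H W L) (hz : z ∈ slit U) (hz1 : len L z = 1) :
    fderiv ℝ (relFactor H W L) z (spray L z)
      = (1 / 2 : ℝ) * relFactor H W L z
        * lieMetric H W z.1 (relVec W L z) (relVec W L z) := by
  have hm := hR.relFactor_pos hz
  have h1 := hR.fderiv_two_len hz (spray L z) (W z.1)
  have h2 := hR.fderiv_relFactor hz (spray L z)
  have h3 := hR.fderiv_len hz (W z.1, 0)
  have h4 := hR.fderiv_len_inr hz (W z.1)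
  have hy : z.2 = relVec W L z + W z.1 := by simp [relVec, hz1]
  have hm1 : H z.1 (relVec W L z) (W z.1) = relFactor H W L z - 1 := by simp [relFactor, hz1]
  have hW' : fderiv ℝ W z.1 z.2 = fderiv ℝ W z.1 (relVec W L z) + fderiv ℝ W z.1 (W z.1) := by
    rw [← map_add, ← hy]
  have hsp : (spray L z).1 = z.2 := rfl
  rw [hR.fderiv_two_len_spray hz hz1, hR.fderiv_len_spray hz] at h1
  rw [hR.fderiv_len_spray hz] at h2
  rw [hm1] at h4
  simp only [hsp, hz1, one_smul, zero_smul, sub_zero, zero_add, map_zero, one_mul, hW',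
    map_add, map_sub, add_apply, sub_apply, add_zero] at h1 h2 h3
  rw [lieMetric, hR.symm _ hz.1 (fderiv ℝ W z.1 (relVec W L z))]
  generalize fderiv ℝ (relFactor H W L) z (spray L z) = S at *
  generalize fderiv ℝ (len L) z (0, W z.1) = lW at *
  generalize fderiv ℝ (len L) z (W z.1, 0) = lxW at *
  generalize relFactor H W L z = m at *
  have h5 : (1 - lW) * m = 1 := by linarith
  have h6 : S * (1 - lW) = H z.1 (relVec W L z) (fderiv ℝ W z.1 (relVec W L z))
      + (1 / 2 : ℝ) * fderiv ℝ H z.1 (W z.1) (relVec W L z) (relVec W L z) := by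
    linear_combination h2 - h1 + h3
  linear_combination m * h6 - S * h5

lemma lieMetric_symm (hR : IsRandersOn U H W L) {u : E n} (hu : u ∈ U) (a b : E n) :
    lieMetric H W u a b = lieMetric H W u b a := by
  rw [lieMetric, lieMetric, hR.fderiv_metric_symm hu, hR.symm u hu a, hR.symm u hu _ b]
  ring

lemma lieMetric_add (a b : E n) (u : E n) (hs : lieMetric H W u a b = lieMetric H W u b a) :
    lieMetric H W u (a + b) (a + b)
      = lieMetric H W u a a + 2 * lieMetric H W u a b + lieMetric H W u b b := by
  have : lieMetric H W u (a + b) (a + b)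
      = lieMetric H W u a a + lieMetric H W u a b + lieMetric H W u b a + lieMetric H W u b b := by
    simp only [lieMetric, map_add, add_apply]
    ring
  rw [this, ← hs]
  ring

/-- If the `S`-curvature is isotropic at a point, the wind is infinitesimally conformal there. -/
lemma lieMetric_eq_of_isotropic (hR : IsRandersOn U H W L) {u : E n} (hu : u ∈ U) {κ : ℝ}
    (hS : ∀ v, v ≠ 0 → sCurvCoord L u v = ((n : ℝ) + 1) * κ * L u v) (a b : E n) :
    lieMetric H W u a b = -4 * κ * H u a b := by
  -- Every `h`-unit vector `p` arises from the `F`-unit vector `p + W`, which is nonzero because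
  -- `h(W, W) < 1`. Scaling and polarisation then give the full identity.
  have h1 : ∀ p, H u p p = 1 → lieMetric H W u p p = -4 * κ := fun p hp => by
    have hv : p + W u ≠ 0 := fun h => by
      have := hR.lt_one u hu
      rw [← neg_eq_of_add_eq_zero_right h] at this
      simp [hp] at this
    set z : E n × E n := (u, p + W u) with hz_def
    have hz : z ∈ slit U := ⟨hu, hv⟩
    have hL1 : len L z = 1 := by
      rw [len, hR.eq_val _ hu, randersVal_eq_one_iff (by linarith [hR.lt_one u hu])
        (hR.nonneg hu _)]
      simp only [hz_def, map_add, add_apply, hp, hR.symm u hu p (W u)]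
      ring
    have hpz : relVec W L z = p := by
      rw [relVec, hL1]
      simp [hz_def]
    have hm := hR.relFactor_pos hz
    have h2 := hS z.2 hv
    have h3 := hR.sCurvCoord_eq hz
    rw [hR.fderiv_relFactor_spray hz hL1, hpz] at h3
    have h4 : L u z.2 = 1 := hL1
    rw [h4] at h2
    have h5 : z.1 = u := rfl
    rw [h5, h2] at h3
    have hn : (0 : ℝ) < (n : ℝ) + 1 := by positivity
    field_simp at h3
    linarith
  have h2 : ∀ a, lieMetric H W u a a = -4 * κ * H u a a := fun a => by
    rcases eq_or_ne a 0 with rfl | ha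
    · simp [lieMetric]
    have hpos := hR.pos u hu a ha
    set t := √(H u a a) with ht
    have htt : t ^ 2 = H u a a := Real.sq_sqrt hpos.le
    have ht0 : t ≠ 0 := (Real.sqrt_pos.2 hpos).ne'
    have h3 := h1 (t⁻¹ • a) (by
      simp only [map_smul, smul_apply, smul_eq_mul, ← htt]
      field_simp)
    have h4 : lieMetric H W u (t⁻¹ • a) (t⁻¹ • a) = t⁻¹ ^ 2 * lieMetric H W u a a := by
      simp only [lieMetric, map_smul, smul_apply, smul_eq_mul]
      ring
    rw [h4] at h3
    rw [← htt]
    field_simp at h3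
    linarith
  have h3 := h2 (a + b)
  rw [lieMetric_add _ _ _ (hR.lieMetric_symm hu a b), h2, h2] at h3
  simp only [map_add, add_apply, hR.symm u hu b a] at h3
  linarith

/-- The normal derivative in the Chern connection of a Randers metric with isotropic
`S`-curvature, compared with the one in the Levi-Civita connection. -/
lemma bilin_chern_add (hR : IsRandersOn U H W L) (hz : z ∈ slit U) (hz1 : len L z = 1) {κ : ℝ}
    (hS : ∀ v, v ≠ 0 → sCurvCoord L z.1 v = ((n : ℝ) + 1) * κ * L z.1 v) {V X Y : E n}
    (hX : H z.1 (relVec W L z) X = 0) (hY : H z.1 (relVec W L z) Y = 0)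
    (hV : (1 / 2 : ℝ) * fderiv ℝ H z.1 X (relVec W L z) (relVec W L z)
      + H z.1 (relVec W L z) (V - fderiv ℝ W z.1 X) = 0) :
    relFactor H W L z * bilin (fun i j => fundTensor L i j z.1 z.2)
        (V + WithLp.toLp 2 fun i => ∑ j, ∑ k, chern L i j k z.1 z.2 * X j * z.2 k) Y
      = H z.1 (V - fderiv ℝ W z.1 X) Y + leviCivita H z.1 (relVec W L z) X Y
        - κ * H z.1 X Y := by
  have hF := hR.isFinslerOn
  have hm := hR.relFactor_pos hz
  have hlX : fderiv ℝ (len L) z (0, X) = 0 :=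
    (mul_eq_zero.1 ((hR.fderiv_len_inr hz X).trans hX)).resolve_right hm.ne'
  have hlY : fderiv ℝ (len L) z (0, Y) = 0 :=
    (mul_eq_zero.1 ((hR.fderiv_len_inr hz Y).trans hY)).resolve_right hm.ne'
  -- The hypothesis `hV` is the linearised unit-length condition for `p`; equivalently, `(X, V)` is
  -- tangent to the level set `L = 1`.
  have hXV : fderiv ℝ (len L) z (0, V) = -fderiv ℝ (len L) z (X, 0) := by
    have h := hR.fderiv_len hz (X, V)
    rw [show ((X, V) : E n × E n) = (X, 0) + (0, V) by simp, map_add, hz1] at h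
    rw [map_sub] at hV
    simp only [Prod.mk_add_mk, add_zero, zero_add] at h
    have h' : (fderiv ℝ (len L) z (X, 0) + fderiv ℝ (len L) z (0, V)) * relFactor H W L z = 0 := by
      linarith
    linarith [(mul_eq_zero.1 h').resolve_right hm.ne']
  have hb := bilin_fundTensor (hF.eventually_smooth hz)
    (V + WithLp.toLp 2 fun i => ∑ j, ∑ k, chern L i j k z.1 z.2 * X j * z.2 k) Y
  have hc := hF.bilin_chern hz X Y
  rw [bilin_fundTensor (hF.eventually_smooth hz), hF.fderiv_two_nonlin hz] at hc
  rw [show ∀ a b : E n, ((0, a + b) : E n × E n) = (0, a) + (0, b) by simp, map_add,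
    add_apply, hc, hR.fderiv_two_energy hz, hR.fderiv_two_energy hz, hR.fderiv_two_energy hz,
    hR.fderiv_three_energy hz, hR.fderiv_len_spray hz, hlX, hlY, hz1] at hb
  have e1 := hR.fderiv_two_len_inr hz V Y
  have e2 := hR.fderiv_two_len hz (X, 0) Y
  have e3 := hR.fderiv_two_len hz (Y, 0) X
  have e4 := hR.fderiv_three_len hz (s := spray L z) hlX hlY
  have e5 := hR.fderiv_two_len_inr hz X Y
  have e6 := hR.fderiv_relFactor_spray hz hz1
  have e7 := hR.lieMetric_eq_of_isotropic hz.1 hS X Y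
  rw [hR.lieMetric_eq_of_isotropic hz.1 hS, hR.metric_relVec hz.1, hz1] at e6
  rw [hR.fderiv_two_len_spray hz hz1, hR.fderiv_two_len_spray hz hz1, e6] at e4
  have hy : z.2 = relVec W L z + W z.1 := by simp [relVec, hz1]
  have hsp : (spray L z).1 = z.2 := rfl
  rw [hlX, hlY] at e5
  rw [hlY, hXV] at e1
  rw [hlY, hz1] at e2
  rw [hlX, hz1] at e3
  rw [hsp, hy] at e4
  rw [hb, leviCivita]
  rw [lieMetric] at e7
  simp only [map_add, map_sub, map_smul, zero_smul, sub_zero, zero_sub, zero_add,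
    add_zero, one_smul, neg_smul, map_neg, add_apply, sub_apply, smul_apply, neg_apply,
    smul_eq_mul, zero_mul, mul_zero, one_mul, neg_mul, mul_neg] at e1 e2 e3 e4 e5 e7 ⊢
  rw [hR.symm _ hz.1 (fderiv ℝ W z.1 Y)] at e3
  rw [hR.fderiv_metric_symm hz.1 Y X]
  -- The terms containing `dL(X, 0)` and `dL(Y, 0)` cancel. Splitting `y = p + W`, the derivative of
  -- `h` along `p` completes the Levi-Civita form, and the derivative along `W` combines with the
  -- `dW` terms into `½ 𝓛_W h(X, Y) - h(dW X, Y)`. The Lie term contributes `-2κ h` and the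
  -- variation of `m` contributes `+κ h`.
  linear_combination e1 + (1 / 2 : ℝ) * e2 - (1 / 2 : ℝ) * e3 + (1 / 2 : ℝ) * e4
    + (1 / 2 : ℝ) * e7 + κ * e5

end IsRandersOn

end RandersCurvature

/-! ### Coordinates on a manifold -/

section ManifoldCoord

variable {n : ℕ} {N : Type*} [TopologicalSpace N] [ChartedSpace (E n) N]

lemma toCoord_add (x₀ x : N) (v w : TangentSpace (𝓡 n) x) :
    toCoord x₀ x (v + w) = toCoord x₀ x v + toCoord x₀ x w := map_add _ _ _

lemma toCoord_sub (x₀ x : N) (v w : TangentSpace (𝓡 n) x) :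
    toCoord x₀ x (v - w) = toCoord x₀ x v - toCoord x₀ x w := map_sub _ _ _

lemma ptOfCoord_mem {x₀ : N} {u : E n} (hu : u ∈ (extChartAt (𝓡 n) x₀).target) :
    ptOfCoord x₀ u ∈ (chartAt (E n) x₀).source := by
  rw [← extChartAt_source (𝓡 n)]
  exact (extChartAt (𝓡 n) x₀).map_target hu

lemma ofCoord_add (x₀ : N) (u v w : E n) :
    ofCoord x₀ u (v + w) = ofCoord x₀ u v + ofCoord x₀ u w := map_add _ _ _

lemma ofCoord_smul (x₀ : N) (u v : E n) (c : ℝ) :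
    ofCoord x₀ u (c • v) = c • ofCoord x₀ u v := map_smul _ _ _

/-- The coordinates of a vector field. -/
def coordField (W : ∀ x : N, TangentSpace (𝓡 n) x) (x₀ : N) (u : E n) : E n :=
  toCoord x₀ (ptOfCoord x₀ u) (W (ptOfCoord x₀ u))

lemma coordField_extChartAt (W : ∀ x : N, TangentSpace (𝓡 n) x) {x₀ x : N}
    (hx : x ∈ (chartAt (E n) x₀).source) :
    coordField W x₀ (extChartAt (𝓡 n) x₀ x) = toCoord x₀ x (W x) := by
  rw [← extChartAt_source (𝓡 n)] at hx
  rw [coordField, ptOfCoord, (extChartAt (𝓡 n) x₀).left_inv hx]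

variable [IsManifold (𝓡 n) ∞ N]

/-- The tangent space at `x` is modelled on the preferred chart at `x`, whose derivative there is
the identity. -/
lemma toCoord_self (x : N) (v : TangentSpace (𝓡 n) x) : toCoord x x v = v := by
  have : IsManifold (𝓡 n) 1 N := .of_le (n := ∞) (by norm_num)
  rw [toCoord, mfderiv_extChartAt_self]
  rfl

lemma toCoord_ofCoord {x₀ : N} {u : E n} (hu : u ∈ (extChartAt (𝓡 n) x₀).target) (v : E n) :
    toCoord x₀ (ptOfCoord x₀ u) (ofCoord x₀ u v) = v := by
  have : IsManifold (𝓡 n) 1 N := .of_le (n := ∞) (by norm_num)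
  have h := mfderiv_extChartAt_comp_mfderivWithin_extChartAt_symm hu
  rw [ModelWithCorners.range_eq_univ, mfderivWithin_univ] at h
  exact congrArg (fun T : E n →L[ℝ] E n => T v) h

lemma ofCoord_toCoord {x₀ : N} {u : E n} (hu : u ∈ (extChartAt (𝓡 n) x₀).target)
    (v : TangentSpace (𝓡 n) (ptOfCoord x₀ u)) :
    ofCoord x₀ u (toCoord x₀ (ptOfCoord x₀ u) v) = v := by
  have : IsManifold (𝓡 n) 1 N := .of_le (n := ∞) (by norm_num)
  have h := mfderivWithin_extChartAt_symm_comp_mfderiv_extChartAt hu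
  rw [ModelWithCorners.range_eq_univ, mfderivWithin_univ] at h
  exact congrArg (fun T : E n →L[ℝ] E n => T v) h

section

variable {F : Type*} [NormedAddCommGroup F] [NormedSpace ℝ F] {G : Type*} [TopologicalSpace G]
  {I : ModelWithCorners ℝ F G} {M : Type*} [TopologicalSpace M] [ChartedSpace G M]

/-- On the chart domain, the fibre part of the tangent bundle trivialisation at `x₀` is the
derivative of the chart, so smoothness can be tested on coordinate expressions. -/
lemma contMDiffAt_totalSpace_iff_toCoord {φ : M → N} {ν : ∀ q, TangentSpace (𝓡 n) (φ q)} {q : M}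
    {x₀ : N} (hq : φ q ∈ (chartAt (E n) x₀).source) :
    ContMDiffAt I (𝓡 n).tangent ∞ (fun q => (⟨φ q, ν q⟩ : TangentBundle (𝓡 n) N)) q ↔
      ContMDiffAt I (𝓡 n) ∞ φ q ∧
        ContMDiffAt I 𝓘(ℝ, E n) ∞ (fun q => toCoord x₀ (φ q) (ν q)) q := by
  have : IsManifold (𝓡 n) 1 N := .of_le (n := ∞) (by norm_num)
  set t := trivializationAt (E n) (TangentSpace (𝓡 n) : N → Type _) x₀ with ht
  have hbase : t.baseSet = (chartAt (E n) x₀).source := TangentBundle.trivializationAt_baseSet x₀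
  have hsrc : (⟨φ q, ν q⟩ : TangentBundle (𝓡 n) N) ∈ t.source := by
    rw [t.mem_source, hbase]
    exact hq
  have h1 := t.contMDiffAt_iff (IB := 𝓡 n) (IM := I) (n := ∞)
    (f := fun q => (⟨φ q, ν q⟩ : TangentBundle (𝓡 n) N)) hsrc
  refine h1.trans (and_congr_right fun hφ => ?_)
  refine Filter.EventuallyEq.contMDiffAt_iff ?_
  filter_upwards [hφ.continuousAt ((chartAt (E n) x₀).open_source.mem_nhds hq)] with y hy
  have h2 : (t ⟨φ y, ν y⟩).2 = t.continuousLinearMapAt ℝ (φ y) (ν y) := by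
    rw [Bundle.Trivialization.continuousLinearMapAt_apply,
      Bundle.Trivialization.coe_linearMapAt_of_mem _ (by rw [hbase]; exact hy)]
  rw [h2]
  exact congrArg (fun T : TangentSpace (𝓡 n) (φ y) →L[ℝ] E n => T (ν y))
    (TangentBundle.continuousLinearMapAt_trivializationAt hy)

end

lemma contMDiffAt_ptOfCoord {x₀ : N} {u : E n} (hu : u ∈ (extChartAt (𝓡 n) x₀).target) :
    ContMDiffAt 𝓘(ℝ, E n) (𝓡 n) ∞ (ptOfCoord x₀) u :=
  (contMDiffOn_extChartAt_symm x₀).contMDiffAt ((isOpen_extChartAt_target x₀).mem_nhds hu)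

lemma contMDiffAt_ofCoord {x₀ : N} {u : E n} (hu : u ∈ (extChartAt (𝓡 n) x₀).target) (v : E n) :
    ContMDiffAt 𝓘(ℝ, E n) (𝓡 n).tangent ∞
      (fun u => (⟨ptOfCoord x₀ u, ofCoord x₀ u v⟩ : TangentBundle (𝓡 n) N)) u := by
  rw [contMDiffAt_totalSpace_iff_toCoord (ptOfCoord_mem hu)]
  refine ⟨contMDiffAt_ptOfCoord hu, ?_⟩
  refine contMDiffAt_const (c := v) |>.congr_of_eventuallyEq ?_
  filter_upwards [(isOpen_extChartAt_target x₀).mem_nhds hu] with y hy using toCoord_ofCoord hy v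

lemma contDiffAt_localMetric (h : RMetric n N) {x₀ : N} {u : E n}
    (hu : u ∈ (extChartAt (𝓡 n) x₀).target) (i j : Fin n) :
    ContDiffAt ℝ ∞ (localMetric h x₀ i j) u := by
  have : IsManifold (𝓡 n) 1 N := .of_le (n := ∞) (by norm_num)
  have h1 : ContMDiffAt 𝓘(ℝ, E n) ((𝓡 n).prod 𝓘(ℝ)) ∞
      (fun u => Bundle.TotalSpace.mk' ℝ (E := Bundle.Trivial N ℝ) (ptOfCoord x₀ u)
        (h.inner (ptOfCoord x₀ u) (ofCoord x₀ u (e i)) (ofCoord x₀ u (e j)))) u :=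
    ContMDiffAt.clm_bundle_apply₂ (F₁ := E n) (F₂ := E n)
      (ContMDiffAt.comp u h.contMDiff.contMDiffAt (contMDiffAt_ptOfCoord hu))
      (contMDiffAt_ofCoord hu _) (contMDiffAt_ofCoord hu _)
  rw [Bundle.contMDiffAt_totalSpace] at h1
  exact h1.2.contDiffAt

/-- The metric in coordinates, as a bilinear form. -/
def coordMetric (h : RMetric n N) (x₀ : N) (u : E n) : E n →L[ℝ] E n →L[ℝ] ℝ :=
  ∑ i, ∑ j, localMetric h x₀ i j u •
    ContinuousLinearMap.smulRight (EuclideanSpace.proj (𝕜 := ℝ) i : E n →L[ℝ] ℝ)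
      (EuclideanSpace.proj (𝕜 := ℝ) j : E n →L[ℝ] ℝ)

lemma coordMetric_eq_bilin (h : RMetric n N) (x₀ : N) (u a b : E n) :
    coordMetric h x₀ u a b = bilin (fun i j => localMetric h x₀ i j u) a b := by
  simp [coordMetric, bilin, sum_apply, mul_assoc]

lemma coordMetric_eq (h : RMetric n N) (x₀ : N) (u a b : E n) :
    coordMetric h x₀ u a b
      = h.inner (ptOfCoord x₀ u) (ofCoord x₀ u a) (ofCoord x₀ u b) := by
  have hB := sum_sum_mul_apply_e (LinearMap.mk₂ ℝ
    (fun a b => h.inner (ptOfCoord x₀ u) (ofCoord x₀ u a) (ofCoord x₀ u b))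
    (fun a b c => by simp [ofCoord_add]) (fun a b c => by simp [ofCoord_smul])
    (fun a b c => by simp [ofCoord_add]) (fun a b c => by simp [ofCoord_smul])) a b
  rw [LinearMap.mk₂_apply] at hB
  rw [coordMetric_eq_bilin, bilin, ← hB]
  exact Finset.sum_congr rfl fun i _ => Finset.sum_congr rfl fun j _ => by
    rw [LinearMap.mk₂_apply, localMetric]
    ring

lemma contDiffAt_coordMetric (h : RMetric n N) {x₀ : N} {u : E n}
    (hu : u ∈ (extChartAt (𝓡 n) x₀).target) : ContDiffAt ℝ ∞ (coordMetric h x₀) u :=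
  ContDiffAt.sum fun i _ => ContDiffAt.sum fun j _ =>
    (ContinuousLinearMap.toSpanSingleton ℝ _).contDiff.contDiffAt.comp u
      (contDiffAt_localMetric h hu i j)

lemma coordMetric_toCoord (h : RMetric n N) {x₀ x : N} (hx : x ∈ (chartAt (E n) x₀).source)
    (v w : TangentSpace (𝓡 n) x) :
    coordMetric h x₀ (extChartAt (𝓡 n) x₀ x) (toCoord x₀ x v) (toCoord x₀ x w)
      = h.inner x v w := by
  rw [← extChartAt_source (𝓡 n)] at hx
  obtain ⟨u, hu, rfl⟩ : ∃ u ∈ (extChartAt (𝓡 n) x₀).target, ptOfCoord x₀ u = x :=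
    ⟨_, (extChartAt (𝓡 n) x₀).map_source hx, (extChartAt (𝓡 n) x₀).left_inv hx⟩
  have h1 : extChartAt (𝓡 n) x₀ (ptOfCoord x₀ u) = u := (extChartAt (𝓡 n) x₀).right_inv hu
  rw [h1, coordMetric_eq, ofCoord_toCoord hu, ofCoord_toCoord hu]

lemma contDiffAt_coordField {W : ∀ x : N, TangentSpace (𝓡 n) x}
    (hW : ContMDiff (𝓡 n) (𝓡 n).tangent ∞ (fun x => (⟨x, W x⟩ : TangentBundle (𝓡 n) N)))
    {x₀ : N} {u : E n} (hu : u ∈ (extChartAt (𝓡 n) x₀).target) :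
    ContDiffAt ℝ ∞ (coordField W x₀) u := by
  have h1 : ContMDiffAt 𝓘(ℝ, E n) (𝓡 n).tangent ∞
      (fun u => (⟨ptOfCoord x₀ u, W (ptOfCoord x₀ u)⟩ : TangentBundle (𝓡 n) N)) u :=
    ContMDiffAt.comp u hW.contMDiffAt (contMDiffAt_ptOfCoord hu)
  rw [contMDiffAt_totalSpace_iff_toCoord (ptOfCoord_mem hu)] at h1
  exact h1.2.contDiffAt

lemma randers_eq_randersVal (h : RMetric n N) (W : ∀ x : N, TangentSpace (𝓡 n) x) (x : N)
    (y : TangentSpace (𝓡 n) x) :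
    randers h W x y
      = randersVal (1 - h.inner x (W x) (W x)) (h.inner x y y) (h.inner x (W x) y) := rfl

/-- A Randers metric in coordinates. -/
lemma isRandersOn_localFinsler (h : RMetric n N) {W : ∀ x : N, TangentSpace (𝓡 n) x}
    (hW : ContMDiff (𝓡 n) (𝓡 n).tangent ∞ (fun x => (⟨x, W x⟩ : TangentBundle (𝓡 n) N)))
    (hW1 : ∀ x : N, h.inner x (W x) (W x) < 1) (x₀ : N) :
    IsRandersOn (extChartAt (𝓡 n) x₀).target (coordMetric h x₀) (coordField W x₀)
      (localFinsler (randers h W) x₀) := by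
  have hWu : ∀ u ∈ (extChartAt (𝓡 n) x₀).target,
      ofCoord x₀ u (coordField W x₀ u) = W (ptOfCoord x₀ u) := fun u hu => ofCoord_toCoord hu _
  refine ⟨isOpen_extChartAt_target x₀, fun u hu => contDiffAt_coordMetric h hu,
    fun u hu => contDiffAt_coordField hW hu, fun u _ a b => ?_, fun u hu a ha => ?_,
    fun u hu => ?_, fun u hu v => ?_⟩
  · rw [coordMetric_eq, coordMetric_eq, h.symm]
  · rw [coordMetric_eq]
    refine h.pos _ _ fun h0 => ha ?_
    rw [← toCoord_ofCoord hu a, h0]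
    exact map_zero _
  · rw [coordMetric_eq, hWu u hu]
    exact hW1 _
  · simp only [coordMetric_eq, hWu u hu]
    rfl

end ManifoldCoord

/-! ### Maps between manifolds in coordinates -/

section Immersion

variable {n m : ℕ} {N : Type*} [TopologicalSpace N] [ChartedSpace (E n) N]
  {M : Type*} [TopologicalSpace M] [ChartedSpace (E m) M]

/-- The expression of `φ` in the preferred charts at `p` and `φ p`. -/
def locMap (n : ℕ) {N : Type*} [TopologicalSpace N] [ChartedSpace (E n) N] (φ : M → N) (p : M)
    (w : E m) : E n := extChartAt (𝓡 n) (φ p) (φ (ptOfCoord p w))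

/-- The coordinates of a vector field along `φ`. -/
def locField (φ : M → N) (p : M) (ν : ∀ q, TangentSpace (𝓡 n) (φ q)) (w : E m) : E n :=
  toCoord (φ p) (φ (ptOfCoord p w)) (ν (ptOfCoord p w))

lemma ptOfCoord_extChartAt {p q : M} (hq : q ∈ (chartAt (E m) p).source) :
    ptOfCoord p (extChartAt (𝓡 m) p q) = q := by
  rw [← extChartAt_source (𝓡 m)] at hq
  exact (extChartAt (𝓡 m) p).left_inv hq

lemma extChartAt_ptOfCoord {p : M} {w : E m} (hw : w ∈ (extChartAt (𝓡 m) p).target) :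
    extChartAt (𝓡 m) p (ptOfCoord p w) = w := (extChartAt (𝓡 m) p).right_inv hw

lemma locMap_extChartAt (φ : M → N) {p q : M} (hq : q ∈ (chartAt (E m) p).source) :
    locMap n φ p (extChartAt (𝓡 m) p q) = extChartAt (𝓡 n) (φ p) (φ q) := by
  rw [locMap, ptOfCoord_extChartAt hq]

lemma locField_extChartAt (φ : M → N) {p q : M} (ν : ∀ q, TangentSpace (𝓡 n) (φ q))
    (hq : q ∈ (chartAt (E m) p).source) :
    locField φ p ν (extChartAt (𝓡 m) p q) = toCoord (φ p) (φ q) (ν q) := by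
  rw [locField, ptOfCoord_extChartAt hq]

lemma mfderiv_eq_fderiv_comp_ptOfCoord {f : M → E n} {p : M}
    (hf : MDifferentiableAt (𝓡 m) 𝓘(ℝ, E n) f p) (X : TangentSpace (𝓡 m) p) :
    mfderiv (𝓡 m) 𝓘(ℝ, E n) f p X
      = fderiv ℝ (fun w => f (ptOfCoord p w)) (extChartAt (𝓡 m) p p) X := by
  rw [hf.mfderiv, ModelWithCorners.range_eq_univ, fderivWithin_univ]
  rfl

variable [IsManifold (𝓡 n) ∞ N] [IsManifold (𝓡 m) ∞ M]

lemma contDiffAt_locMap {φ : M → N} (hφ : ContMDiff (𝓡 m) (𝓡 n) ∞ φ) {p : M} {w : E m}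
    (hw : w ∈ (extChartAt (𝓡 m) p).target)
    (hw' : φ (ptOfCoord p w) ∈ (chartAt (E n) (φ p)).source) :
    ContDiffAt ℝ ∞ (locMap n φ p) w := by
  have h1 : ContMDiffAt 𝓘(ℝ, E m) 𝓘(ℝ, E n) ∞ (locMap n φ p) w :=
    (contMDiffAt_extChartAt' (I := 𝓡 n) (n := ∞) hw').comp w
      (ContMDiffAt.comp w hφ.contMDiffAt (contMDiffAt_ptOfCoord hw))
  exact h1.contDiffAt

lemma contDiffAt_locField {φ : M → N} {ν : ∀ q, TangentSpace (𝓡 n) (φ q)} {p : M} {w : E m}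
    (hw : w ∈ (extChartAt (𝓡 m) p).target)
    (hw' : φ (ptOfCoord p w) ∈ (chartAt (E n) (φ p)).source)
    (hν : ContMDiffAt (𝓡 m) (𝓡 n).tangent ∞
      (fun q => (⟨φ q, ν q⟩ : TangentBundle (𝓡 n) N)) (ptOfCoord p w)) :
    ContDiffAt ℝ ∞ (locField φ p ν) w := by
  rw [contMDiffAt_totalSpace_iff_toCoord hw'] at hν
  have h1 : ContMDiffAt 𝓘(ℝ, E m) 𝓘(ℝ, E n) ∞ (locField φ p ν) w :=
    ContMDiffAt.comp w hν.2 (contMDiffAt_ptOfCoord hw)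
  exact h1.contDiffAt

/-- The chain rule applied to the two factorisations of `φ` through the charts. It holds at nearby
points `q` as well, as needed to differentiate the normality equations. -/
lemma toCoord_mfderiv {φ : M → N} (hφ : ContMDiff (𝓡 m) (𝓡 n) ∞ φ) {p q : M}
    (hq : q ∈ (chartAt (E m) p).source) (hq' : φ q ∈ (chartAt (E n) (φ p)).source)
    (X : TangentSpace (𝓡 m) q) :
    toCoord (φ p) (φ q) (mfderiv (𝓡 m) (𝓡 n) φ q X)
      = fderiv ℝ (locMap n φ p) (extChartAt (𝓡 m) p q) (toCoord p q X) := by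
  have hw : extChartAt (𝓡 m) p q ∈ (extChartAt (𝓡 m) p).target :=
    (extChartAt (𝓡 m) p).map_source (by rwa [extChartAt_source])
  have h1 : MDifferentiableAt 𝓘(ℝ, E m) 𝓘(ℝ, E n) (locMap n φ p) (extChartAt (𝓡 m) p q) :=
    (differentiableAt_of_smooth (contDiffAt_locMap hφ hw
      (by rwa [ptOfCoord_extChartAt hq]))).mdifferentiableAt
  have h2 : MDifferentiableAt (𝓡 m) 𝓘(ℝ, E m) (extChartAt (𝓡 m) p) q :=
    (contMDiffAt_extChartAt' (n := ∞) hq).mdifferentiableAt (by norm_num)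
  have h3 : MDifferentiableAt (𝓡 n) 𝓘(ℝ, E n) (extChartAt (𝓡 n) (φ p)) (φ q) :=
    (contMDiffAt_extChartAt' (n := ∞) hq').mdifferentiableAt (by norm_num)
  have h4 : MDifferentiableAt (𝓡 m) (𝓡 n) φ q := hφ.contMDiffAt.mdifferentiableAt (by norm_num)
  have hev : (extChartAt (𝓡 n) (φ p) ∘ φ) =ᶠ[𝓝 q] (locMap n φ p ∘ extChartAt (𝓡 m) p) := by
    filter_upwards [(chartAt (E m) p).open_source.mem_nhds hq] with y hy
    exact (locMap_extChartAt φ hy).symm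
  have h5 := hev.mfderiv_eq (I := 𝓡 m) (I' := 𝓘(ℝ, E n))
  rw [mfderiv_comp q h3 h4, mfderiv_comp q h1 h2, mfderiv_eq_fderiv] at h5
  exact congrArg (fun T : E m →L[ℝ] E n => T X) h5

/-- The covariant derivative of a vector field along `φ`, in coordinates. -/
lemma covDeriv_eq {φ : M → N} (hφ : ContMDiff (𝓡 m) (𝓡 n) ∞ φ) {p : M}
    {ν : ∀ q, TangentSpace (𝓡 n) (φ q)}
    (hν : ContMDiffAt (𝓡 m) (𝓡 n).tangent ∞
      (fun q => (⟨φ q, ν q⟩ : TangentBundle (𝓡 n) N)) p)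
    (Γ : Fin n → Fin n → Fin n → ℝ) (X : TangentSpace (𝓡 m) p) :
    covDeriv φ p Γ ν X = fderiv ℝ (locField φ p ν) (extChartAt (𝓡 m) p p) X
      + WithLp.toLp 2 fun i => ∑ j, ∑ k,
        Γ i j k * (fderiv ℝ (locMap n φ p) (extChartAt (𝓡 m) p p) X) j
          * (toCoord (φ p) (φ p) (ν p)) k := by
  rw [contMDiffAt_totalSpace_iff_toCoord (mem_chart_source (E n) (φ p))] at hν
  have h1 := mfderiv_eq_fderiv_comp_ptOfCoord (hν.2.mdifferentiableAt (by norm_num)) X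
  have h2 := toCoord_mfderiv hφ (mem_chart_source (E m) p) (mem_chart_source (E n) (φ p)) X
  rw [toCoord_self p X] at h2
  ext i
  rw [covDeriv, h1, h2]
  rfl

end Immersion

/-! ### The Levi-Civita connection in a chart. -/

section LeviCivita

variable {n : ℕ} {N : Type*} [TopologicalSpace N] [ChartedSpace (E n) N] [IsManifold (𝓡 n) ∞ N]

lemma fderiv_localMetric (h : RMetric n N) {x₀ : N} {u : E n}
    (hu : u ∈ (extChartAt (𝓡 n) x₀).target) (i j : Fin n) (c : E n) :
    fderiv ℝ (localMetric h x₀ i j) u c = fderiv ℝ (coordMetric h x₀) u c (e i) (e j) := by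
  have h1 : localMetric h x₀ i j = fun u => coordMetric h x₀ u (e i) (e j) := by
    ext u
    rw [coordMetric_eq, localMetric]
  have h2 := fderiv_bilin (differentiableAt_of_smooth (contDiffAt_coordMetric h hu))
    (differentiableAt_const (e i)) (differentiableAt_const (e j)) c
  rw [h1, h2]
  simp

/-- The Levi-Civita connection, with lower index. -/
lemma bilin_christoffel (h : RMetric n N) {x₀ : N} {u : E n}
    (hu : u ∈ (extChartAt (𝓡 n) x₀).target) (p X Y : E n) :
    coordMetric h x₀ u
        (WithLp.toLp 2 fun i => ∑ j, ∑ k, christoffel (localMetric h x₀) i j k u * X j * p k) Y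
      = leviCivita (coordMetric h x₀) u p X Y := by
  set T := fderiv ℝ (coordMetric h x₀) u with hT
  have hsymm : ∀ i j, localMetric h x₀ i j u = localMetric h x₀ j i u := fun i j => by
    rw [localMetric, localMetric, h.symm]
  have hpos : (gramMatrix (coordMetric h x₀ u)).PosDef := by
    refine gramMatrix_posDef (fun a b => ?_) fun a ha => ?_
    · rw [coordMetric_eq, coordMetric_eq, h.symm]
    · rw [coordMetric_eq]
      refine h.pos _ _ fun h0 => ha ?_
      rw [← toCoord_ofCoord hu a, h0]
      exact map_zero _
  have hmat : (Matrix.of fun a b => localMetric h x₀ a b u) = gramMatrix (coordMetric h x₀ u) := by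
    ext a b
    simp [gramMatrix, coordMetric_eq, localMetric]
  have e1 : ∀ l, ∑ j, ∑ k, X j * p k * T (e k) (e j) (e l) = T p X (e l) := fun l =>
    sum_sum_mul_apply_e (LinearMap.mk₂ ℝ (fun a b => T b a (e l))
      (by simp) (by simp) (by simp) (by simp)) X p
  have e2 : ∀ l, ∑ j, ∑ k, X j * p k * T (e j) (e k) (e l) = T X p (e l) := fun l =>
    sum_sum_mul_apply_e (LinearMap.mk₂ ℝ (fun a b => T a b (e l))
      (by simp) (by simp) (by simp) (by simp)) X p
  have e3 : ∀ l, ∑ j, ∑ k, X j * p k * T (e l) (e j) (e k) = T (e l) X p := fun l =>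
    sum_sum_mul_apply_e (LinearMap.mk₂ ℝ (fun a b => T (e l) a b)
      (by simp) (by simp) (by simp) (by simp)) X p
  have h1 : (WithLp.toLp 2 fun i => ∑ j, ∑ k,
      christoffel (localMetric h x₀) i j k u * X j * p k)
      = WithLp.toLp 2 fun i => ∑ l, (Matrix.of fun a b => localMetric h x₀ a b u)⁻¹ i l *
        ((1 / 2 : ℝ) * (T p X (e l) + T X p (e l) - T (e l) X p)) := by
    ext i
    simp only [← e1, ← e2, ← e3, ← Finset.sum_add_distrib, ← Finset.sum_sub_distrib,
      Finset.mul_sum]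
    simp only [christoffel, Finset.mul_sum, Finset.sum_mul, fderiv_localMetric h hu, riemInv]
    rw [Finset.sum_congr rfl fun j _ => Finset.sum_comm, Finset.sum_comm]
    refine Finset.sum_congr rfl fun l _ => Finset.sum_congr rfl fun j _ =>
      Finset.sum_congr rfl fun k _ => ?_
    rw [hT]
    ring
  rw [coordMetric_eq_bilin, h1, bilin_inv_mul hsymm (by rw [hmat]; exact hpos.det_pos.ne'),
    leviCivita]
  conv_rhs => rw [← sum_smul_e Y]
  simp only [map_sum, map_smul, sum_apply, smul_apply, smul_eq_mul, ← Finset.sum_add_distrib,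
    ← Finset.sum_sub_distrib, Finset.mul_sum, ← hT]
  exact Finset.sum_congr rfl fun l _ => by ring

end LeviCivita

/-! ### Unit normals under translation by the wind. -/

section UnitNormal

variable {n : ℕ} {N : Type*} [TopologicalSpace N] [ChartedSpace (E n) N] [IsManifold (𝓡 n) ∞ N]

lemma localFinsler_toCoord (F : ∀ x : N, TangentSpace (𝓡 n) x → ℝ) {x₀ x : N}
    (hx : x ∈ (chartAt (E n) x₀).source) (v : TangentSpace (𝓡 n) x) :
    localFinsler F x₀ (extChartAt (𝓡 n) x₀ x) (toCoord x₀ x v) = F x v := by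
  rw [← extChartAt_source (𝓡 n)] at hx
  obtain ⟨u, hu, rfl⟩ : ∃ u ∈ (extChartAt (𝓡 n) x₀).target, ptOfCoord x₀ u = x :=
    ⟨_, (extChartAt (𝓡 n) x₀).map_source hx, (extChartAt (𝓡 n) x₀).left_inv hx⟩
  rw [extChartAt_ptOfCoord hu, localFinsler, ofCoord_toCoord hu]

lemma randers_eq_one_iff (h : RMetric n N) {W : ∀ x : N, TangentSpace (𝓡 n) x}
    (hW1 : ∀ x : N, h.inner x (W x) (W x) < 1) (x : N) (v : TangentSpace (𝓡 n) x) :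
    randers h W x v = 1 ↔ h.inner x (v - W x) (v - W x) = 1 := by
  have h0 : 0 ≤ h.inner x v v := by
    rcases eq_or_ne v 0 with rfl | hv
    · simp
    · exact (h.pos x v hv).le
  rw [randers_eq_randersVal, randersVal_eq_one_iff (by linarith [hW1 x]) h0]
  simp only [map_sub, sub_apply, h.symm x v (W x)]
  constructor <;> intro h <;> linarith

lemma ne_zero_of_randers_eq_one (h : RMetric n N) {W : ∀ x : N, TangentSpace (𝓡 n) x} {x : N}
    {v : TangentSpace (𝓡 n) x} (hv : randers h W x v = 1) : v ≠ 0 := by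
  rintro rfl
  simp [randers] at hv

section

variable (h : RMetric n N) {W : ∀ x : N, TangentSpace (𝓡 n) x} {x : N}
  {v : TangentSpace (𝓡 n) x}

/-- A tangent vector in coordinates, as a point of the slit tangent bundle. -/
def coordPoint (x : N) (v : TangentSpace (𝓡 n) x) : E n × E n :=
  (extChartAt (𝓡 n) x x, toCoord x x v)

lemma coordPoint_mem (hv : v ≠ 0) : coordPoint x v ∈ slit (extChartAt (𝓡 n) x).target :=
  ⟨mem_extChartAt_target x, by rw [coordPoint, toCoord_self]; exact hv⟩

lemma len_coordPoint (F : ∀ x : N, TangentSpace (𝓡 n) x → ℝ) (v : TangentSpace (𝓡 n) x) :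
    len (localFinsler F x) (coordPoint x v) = F x v :=
  localFinsler_toCoord F (mem_chart_source (E n) x) v

lemma relVec_coordPoint (hv : randers h W x v = 1) :
    relVec (coordField W x) (localFinsler (randers h W) x) (coordPoint x v)
      = toCoord x x (v - W x) := by
  rw [relVec, len_coordPoint, hv, one_smul, toCoord_sub]
  rw [coordPoint, coordField_extChartAt W (mem_chart_source (E n) x)]

lemma coordMetric_relVec (hv : randers h W x v = 1) (X : TangentSpace (𝓡 n) x) :
    coordMetric h x (coordPoint x v).1
        (relVec (coordField W x) (localFinsler (randers h W) x) (coordPoint x v)) (toCoord x x X)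
      = h.inner x (v - W x) X := by
  rw [relVec_coordPoint h hv]
  exact coordMetric_toCoord h (mem_chart_source (E n) x) _ _

lemma lineDeriv_randers
    (hW : ContMDiff (𝓡 n) (𝓡 n).tangent ∞ (fun x => (⟨x, W x⟩ : TangentBundle (𝓡 n) N)))
    (hW1 : ∀ x : N, h.inner x (W x) (W x) < 1)
    (hv : v ≠ 0) (X : TangentSpace (𝓡 n) x) :
    lineDeriv ℝ (randers h W x) v X
      = fderiv ℝ (len (localFinsler (randers h W) x)) (coordPoint x v) (0, toCoord x x X) := by
  have hR := isRandersOn_localFinsler h hW hW1 x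
  have h1 := (differentiableAt_of_smooth (hR.smooth_len (coordPoint_mem hv))).hasFDerivAt
  have h2 : (fun t : ℝ => randers h W x (v + t • X))
      = fun t => len (localFinsler (randers h W) x)
        (coordPoint x v + t • ((0, toCoord x x X) : E n × E n)) := by
    ext t
    rw [← len_coordPoint (randers h W) (v + t • X)]
    refine congrArg _ (Prod.ext (by simp [coordPoint]) ?_)
    exact (toCoord_add x x v (t • X)).trans (congrArg _ (map_smul _ _ _))
  rw [lineDeriv, h2]
  exact (h1.hasLineDerivAt (0, toCoord x x X)).deriv

/-- For a unit vector `v` the Legendre form is `h(v - W, ·)` divided by the positive factor `m`. -/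
lemma legendre_randers_eq_zero_iff
    (hW : ContMDiff (𝓡 n) (𝓡 n).tangent ∞ (fun x => (⟨x, W x⟩ : TangentBundle (𝓡 n) N)))
    (hW1 : ∀ x : N, h.inner x (W x) (W x) < 1)
    (hv : randers h W x v = 1) (X : TangentSpace (𝓡 n) x) :
    legendre (randers h W) x v X = 0 ↔ h.inner x (v - W x) X = 0 := by
  have hR := isRandersOn_localFinsler h hW hW1 x
  have hz := coordPoint_mem (ne_zero_of_randers_eq_one h hv)
  rw [legendre, hv, one_mul, lineDeriv_randers h hW hW1 (ne_zero_of_randers_eq_one h hv),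
    ← coordMetric_relVec h hv, ← hR.fderiv_len_inr hz]
  simp [(hR.relFactor_pos hz).ne']

end

variable {m : ℕ} {M : Type*} [TopologicalSpace M] [ChartedSpace (E m) M]

lemma isUnitNormal_iff (h : RMetric n N) {W : ∀ x : N, TangentSpace (𝓡 n) x}
    (hW : ContMDiff (𝓡 n) (𝓡 n).tangent ∞ (fun x => (⟨x, W x⟩ : TangentBundle (𝓡 n) N)))
    (hW1 : ∀ x : N, h.inner x (W x) (W x) < 1)
    (φ : M → N) (p : M) (v : TangentSpace (𝓡 n) (φ p)) :
    IsUnitNormal m (randers h W) φ p v ↔ IsRiemUnitNormal m h φ p (v - W (φ p)) := by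
  rw [IsUnitNormal, IsRiemUnitNormal, randers_eq_one_iff h hW1]
  refine and_congr_right fun hv => forall_congr' fun X => ?_
  exact legendre_randers_eq_zero_iff h hW hW1 ((randers_eq_one_iff h hW1 _ _).2 hv) _

lemma isLocalExtension_iff_eventually {φ : M → N}
    {P : ∀ q : M, TangentSpace (𝓡 n) (φ q) → Prop} {p : M} {v : TangentSpace (𝓡 n) (φ p)}
    {ν : ∀ q : M, TangentSpace (𝓡 n) (φ q)} :
    IsLocalExtension m φ P p v ν ↔ ν p = v ∧ ∀ᶠ q in 𝓝 p,
      ContMDiffAt (𝓡 m) (𝓡 n).tangent ∞ (fun q => (⟨φ q, ν q⟩ : TangentBundle (𝓡 n) N)) q ∧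
        P q (ν q) := by
  refine and_congr_right fun _ => ⟨?_, fun h => ⟨_, h, fun q hq => hq.1.contMDiffWithinAt,
    fun q hq => hq.2⟩⟩
  rintro ⟨U, hU, h1, h2⟩
  filter_upwards [eventually_mem_nhds_iff.2 hU] with q hq
  exact ⟨h1.contMDiffAt hq, h2 q (mem_of_mem_nhds hq)⟩

lemma contMDiffAt_sub_wind_iff {W : ∀ x : N, TangentSpace (𝓡 n) x}
    (hW : ContMDiff (𝓡 n) (𝓡 n).tangent ∞ (fun x => (⟨x, W x⟩ : TangentBundle (𝓡 n) N)))
    {φ : M → N} (hφ : ContMDiff (𝓡 m) (𝓡 n) ∞ φ) {ν : ∀ q : M, TangentSpace (𝓡 n) (φ q)} {q : M} :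
    ContMDiffAt (𝓡 m) (𝓡 n).tangent ∞
        (fun q => (⟨φ q, ν q - W (φ q)⟩ : TangentBundle (𝓡 n) N)) q ↔
      ContMDiffAt (𝓡 m) (𝓡 n).tangent ∞ (fun q => (⟨φ q, ν q⟩ : TangentBundle (𝓡 n) N)) q := by
  have hq := mem_chart_source (E n) (φ q)
  have h1 : ContMDiffAt (𝓡 m) (𝓡 n).tangent ∞
      (fun q => (⟨φ q, W (φ q)⟩ : TangentBundle (𝓡 n) N)) q :=
    ContMDiffAt.comp q hW.contMDiffAt hφ.contMDiffAt
  rw [contMDiffAt_totalSpace_iff_toCoord hq] at h1 ⊢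
  rw [contMDiffAt_totalSpace_iff_toCoord hq]
  refine and_congr_right fun _ => ⟨fun h2 => ?_, fun h2 => ?_⟩
  · refine (h2.add h1.2).congr_of_eventuallyEq (Filter.Eventually.of_forall fun y => ?_)
    simp [toCoord_sub]
  · refine (h2.sub h1.2).congr_of_eventuallyEq (Filter.Eventually.of_forall fun y => ?_)
    simp [toCoord_sub]

/-- Subtracting `W ∘ φ` is a bijection between `F`-unit and `h`-unit normal extensions, so
quantifying over either family amounts to the same. -/
lemma isLocalExtension_sub_wind_iff (h : RMetric n N) {W : ∀ x : N, TangentSpace (𝓡 n) x}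
    (hW : ContMDiff (𝓡 n) (𝓡 n).tangent ∞ (fun x => (⟨x, W x⟩ : TangentBundle (𝓡 n) N)))
    (hW1 : ∀ x : N, h.inner x (W x) (W x) < 1)
    {φ : M → N} (hφ : ContMDiff (𝓡 m) (𝓡 n) ∞ φ) {p : M} {v : TangentSpace (𝓡 n) (φ p)}
    {ν : ∀ q : M, TangentSpace (𝓡 n) (φ q)} :
    IsLocalExtension m φ (IsRiemUnitNormal m h φ) p (v - W (φ p)) (fun q => ν q - W (φ q)) ↔
      IsLocalExtension m φ (IsUnitNormal m (randers h W) φ) p v ν := by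
  rw [isLocalExtension_iff_eventually, isLocalExtension_iff_eventually]
  refine and_congr sub_left_inj (Filter.eventually_congr (Filter.Eventually.of_forall fun q => ?_))
  rw [contMDiffAt_sub_wind_iff hW hφ, isUnitNormal_iff h hW hW1]

end UnitNormal

lemma bilin_add_left {n : ℕ} (g : Fin n → Fin n → ℝ) (a b c : E n) :
    bilin g (a + b) c = bilin g a c + bilin g b c := by
  simp [bilin, mul_add, add_mul, Finset.sum_add_distrib]

/-- On vectors tangent to the indicatrix the terms in `dL` disappear. Hence `g_𝐧` and `h` are
proportional on `T_pM`, and testing tangential components in one is testing them in the other. -/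
lemma IsRandersOn.relFactor_mul_bilin_fundTensor {n : ℕ} {U : Set (E n)}
    {H : E n → E n →L[ℝ] E n →L[ℝ] ℝ} {W : E n → E n} {L : E n → E n → ℝ}
    (hR : IsRandersOn U H W L) {z : E n × E n} (hz : z ∈ slit U) (hz1 : len L z = 1) {X Y : E n}
    (hX : H z.1 (relVec W L z) X = 0) (hY : H z.1 (relVec W L z) Y = 0) :
    relFactor H W L z * bilin (fun i j => fundTensor L i j z.1 z.2) X Y = H z.1 X Y := by
  have hm := (hR.relFactor_pos hz).ne'
  have h1 : ∀ b, H z.1 (relVec W L z) b = 0 → fderiv ℝ (len L) z (0, b) = 0 := fun b hb => by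
    have := hR.fderiv_len_inr hz b
    rw [hb] at this
    exact (mul_eq_zero.1 this).resolve_right hm
  have h2 := hR.fderiv_two_len_inr hz X Y
  rw [bilin_fundTensor (hR.isFinslerOn.eventually_smooth hz), hR.fderiv_two_energy hz, hz1]
  rw [h1 X hX, h1 Y hY] at h2 ⊢
  simp only [zero_smul, sub_zero, mul_zero] at h2
  rw [← h2]
  ring

lemma fderiv_bilin_comp {V G K : Type*} [NormedAddCommGroup V] [NormedSpace ℝ V]
    [NormedAddCommGroup G] [NormedSpace ℝ G] [NormedAddCommGroup K] [NormedSpace ℝ K]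
    {H : K → G →L[ℝ] G →L[ℝ] ℝ} {f : V → K} {a b : V → G} {z : V}
    (hH : DifferentiableAt ℝ H (f z)) (hf : DifferentiableAt ℝ f z) (ha : DifferentiableAt ℝ a z)
    (hb : DifferentiableAt ℝ b z) (w : V) :
    fderiv ℝ (fun z => H (f z) (a z) (b z)) z w
      = fderiv ℝ H (f z) (fderiv ℝ f z w) (a z) (b z) + H (f z) (fderiv ℝ a z w) (b z)
        + H (f z) (a z) (fderiv ℝ b z w) := by
  have h1 : HasFDerivAt (fun z => H (f z)) ((fderiv ℝ H (f z)).comp (fderiv ℝ f z)) z :=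
    HasFDerivAt.comp (g := H) (g' := fderiv ℝ H (f z)) z hH.hasFDerivAt hf.hasFDerivAt
  rw [fderiv_bilin (H := fun z => H (f z)) h1.differentiableAt ha hb, h1.fderiv]
  rfl

/-! ### Normal fields along the immersion in coordinates. -/

section Extension

variable {n m : ℕ} {N : Type*} [TopologicalSpace N] [ChartedSpace (E n) N]
  {M : Type*} [TopologicalSpace M] [ChartedSpace (E m) M] {φ : M → N} {p : M}

lemma tendsto_ptOfCoord : Filter.Tendsto (ptOfCoord p) (𝓝 (extChartAt (𝓡 m) p p)) (𝓝 p) := by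
  have h := continuousAt_extChartAt_symm (I := 𝓡 m) p
  rw [ContinuousAt, extChartAt_to_inv] at h
  exact h

lemma eventually_mem_target_and_source (hφ : ContMDiff (𝓡 m) (𝓡 n) ∞ φ) (p : M) :
    ∀ᶠ w in 𝓝 (extChartAt (𝓡 m) p p), w ∈ (extChartAt (𝓡 m) p).target ∧
      φ (ptOfCoord p w) ∈ (chartAt (E n) (φ p)).source :=
  Filter.Eventually.and (extChartAt_target_mem_nhds p) (tendsto_ptOfCoord.eventually
    (hφ.continuous.continuousAt ((chartAt (E n) (φ p)).open_source.mem_nhds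
      (mem_chart_source (E n) (φ p)))))

variable [IsManifold (𝓡 n) ∞ N]

lemma IsLocalExtension.contMDiffAt {P : ∀ q : M, TangentSpace (𝓡 n) (φ q) → Prop}
    {v : TangentSpace (𝓡 n) (φ p)} {ν : ∀ q : M, TangentSpace (𝓡 n) (φ q)}
    (hν : IsLocalExtension m φ P p v ν) :
    ContMDiffAt (𝓡 m) (𝓡 n).tangent ∞ (fun q => (⟨φ q, ν q⟩ : TangentBundle (𝓡 n) N)) p :=
  (isLocalExtension_iff_eventually.1 hν).2.self_of_nhds.1

variable [IsManifold (𝓡 m) ∞ M]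

lemma toCoord_mfderiv_self (hφ : ContMDiff (𝓡 m) (𝓡 n) ∞ φ) (X : TangentSpace (𝓡 m) p) :
    toCoord (φ p) (φ p) (mfderiv (𝓡 m) (𝓡 n) φ p X)
      = fderiv ℝ (locMap n φ p) (extChartAt (𝓡 m) p p) X := by
  rw [toCoord_mfderiv hφ (mem_chart_source (E m) p) (mem_chart_source (E n) (φ p)), toCoord_self]

/-- The equations of the unit normal vector fields in coordinates. -/
lemma eventually_locField_normal (hφ : ContMDiff (𝓡 m) (𝓡 n) ∞ φ) (h : RMetric n N)
    {v : TangentSpace (𝓡 n) (φ p)} {ν : ∀ q : M, TangentSpace (𝓡 n) (φ q)}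
    (hν : IsLocalExtension m φ (IsRiemUnitNormal m h φ) p v ν) :
    ∀ᶠ w in 𝓝 (extChartAt (𝓡 m) p p),
      coordMetric h (φ p) (locMap n φ p w) (locField φ p ν w) (locField φ p ν w) = 1 ∧
      ∀ X : E m, coordMetric h (φ p) (locMap n φ p w) (locField φ p ν w)
        (fderiv ℝ (locMap n φ p) w X) = 0 := by
  filter_upwards [eventually_mem_target_and_source hφ p,
    tendsto_ptOfCoord.eventually (isLocalExtension_iff_eventually.1 hν).2] with w hw hw'
  refine ⟨(coordMetric_toCoord h hw.2 _ _).trans hw'.2.1, fun X => ?_⟩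
  have h1 := toCoord_mfderiv hφ (ptOfCoord_mem hw.1) hw.2 (ofCoord p w X)
  rw [toCoord_ofCoord hw.1, extChartAt_ptOfCoord hw.1] at h1
  rw [← h1]
  exact (coordMetric_toCoord h hw.2 _ _).trans (hw'.2.2 _)

lemma contDiffAt_locMap_self (hφ : ContMDiff (𝓡 m) (𝓡 n) ∞ φ) (p : M) :
    ContDiffAt ℝ ∞ (locMap n φ p) (extChartAt (𝓡 m) p p) :=
  have h := (eventually_mem_target_and_source hφ p).self_of_nhds
  contDiffAt_locMap hφ h.1 h.2

lemma contDiffAt_locField_self (hφ : ContMDiff (𝓡 m) (𝓡 n) ∞ φ)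
    {ν : ∀ q : M, TangentSpace (𝓡 n) (φ q)} (hν : ContMDiffAt (𝓡 m) (𝓡 n).tangent ∞
      (fun q => (⟨φ q, ν q⟩ : TangentBundle (𝓡 n) N)) p) :
    ContDiffAt ℝ ∞ (locField φ p ν) (extChartAt (𝓡 m) p p) := by
  have h := (eventually_mem_target_and_source hφ p).self_of_nhds
  refine contDiffAt_locField h.1 h.2 ?_
  rwa [ptOfCoord_extChartAt (mem_chart_source (E m) p)]

/-- Half the derivative of `h(ν, ν) = 1`; this is the constraint `hV` required by `bilin_chern_add`.
-/
lemma fderiv_locField_normal (hφ : ContMDiff (𝓡 m) (𝓡 n) ∞ φ) (h : RMetric n N)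
    {v : TangentSpace (𝓡 n) (φ p)} {ν : ∀ q : M, TangentSpace (𝓡 n) (φ q)}
    (hν : IsLocalExtension m φ (IsRiemUnitNormal m h φ) p v ν) (X : E m) :
    (1 / 2 : ℝ) * fderiv ℝ (coordMetric h (φ p)) (extChartAt (𝓡 n) (φ p) (φ p))
        (fderiv ℝ (locMap n φ p) (extChartAt (𝓡 m) p p) X) (toCoord (φ p) (φ p) v)
        (toCoord (φ p) (φ p) v)
      + coordMetric h (φ p) (extChartAt (𝓡 n) (φ p) (φ p)) (toCoord (φ p) (φ p) v)
        (fderiv ℝ (locField φ p ν) (extChartAt (𝓡 m) p p) X) = 0 := by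
  have hp := mem_chart_source (E m) p
  have hu : locMap n φ p (extChartAt (𝓡 m) p p) = extChartAt (𝓡 n) (φ p) (φ p) :=
    locMap_extChartAt φ hp
  have hv : locField φ p ν (extChartAt (𝓡 m) p p) = toCoord (φ p) (φ p) v := by
    rw [locField_extChartAt φ ν hp, hν.1]
  have hN := differentiableAt_of_smooth (contDiffAt_locField_self hφ hν.contMDiffAt)
  have h1 := fderiv_bilin_comp (H := coordMetric h (φ p)) (f := locMap n φ p)
    (z := extChartAt (𝓡 m) p p)
    (by rw [hu]; exact differentiableAt_of_smooth
          (contDiffAt_coordMetric h (mem_extChartAt_target (φ p))))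
    (differentiableAt_of_smooth (contDiffAt_locMap_self hφ p)) hN hN X
  have h2 : (fun w => coordMetric h (φ p) (locMap n φ p w) (locField φ p ν w)
      (locField φ p ν w)) =ᶠ[𝓝 (extChartAt (𝓡 m) p p)] fun _ => 1 :=
    (eventually_locField_normal hφ h hν).mono fun w hw => hw.1
  rw [h2.fderiv_eq, hu, hv, coordMetric_eq h _ _ (fderiv ℝ _ _ _), h.symm, ← coordMetric_eq] at h1
  simp only [fderiv_fun_const, Pi.zero_apply, zero_apply] at h1
  linarith

/-- The expression in the definition of the Riemannian shape operator, in coordinates. -/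
lemma bilin_covDeriv_christoffel (hφ : ContMDiff (𝓡 m) (𝓡 n) ∞ φ) (h : RMetric n N)
    {ν : ∀ q : M, TangentSpace (𝓡 n) (φ q)} (hν : ContMDiffAt (𝓡 m) (𝓡 n).tangent ∞
      (fun q => (⟨φ q, ν q⟩ : TangentBundle (𝓡 n) N)) p) (X Z Y : TangentSpace (𝓡 m) p) :
    bilin (fun i j => localMetric h (φ p) i j (extChartAt (𝓡 n) (φ p) (φ p)))
        (covDeriv φ p
            (fun i j k => christoffel (localMetric h (φ p)) i j k (extChartAt (𝓡 n) (φ p) (φ p)))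
            ν X
          + toCoord (φ p) (φ p) (mfderiv (𝓡 m) (𝓡 n) φ p Z))
        (toCoord (φ p) (φ p) (mfderiv (𝓡 m) (𝓡 n) φ p Y))
      = coordMetric h (φ p) (extChartAt (𝓡 n) (φ p) (φ p))
          (fderiv ℝ (locField φ p ν) (extChartAt (𝓡 m) p p) X)
          (fderiv ℝ (locMap n φ p) (extChartAt (𝓡 m) p p) Y)
        + leviCivita (coordMetric h (φ p)) (extChartAt (𝓡 n) (φ p) (φ p))
          (toCoord (φ p) (φ p) (ν p)) (fderiv ℝ (locMap n φ p) (extChartAt (𝓡 m) p p) X)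
          (fderiv ℝ (locMap n φ p) (extChartAt (𝓡 m) p p) Y)
        + h.inner (φ p) (mfderiv (𝓡 m) (𝓡 n) φ p Z) (mfderiv (𝓡 m) (𝓡 n) φ p Y) := by
  rw [bilin_add_left, covDeriv_eq hφ hν, bilin_add_left, ← coordMetric_eq_bilin,
    ← coordMetric_eq_bilin, ← coordMetric_eq_bilin,
    coordMetric_toCoord h (mem_chart_source (E n) (φ p)), toCoord_mfderiv_self hφ Y,
    bilin_christoffel h (mem_extChartAt_target (φ p))]

end Extension

/-! ### Comparison of the Finsler and Riemannian shape operators. -/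

section Relation

variable {n m : ℕ} {N : Type*} [TopologicalSpace N] [ChartedSpace (E n) N] [IsManifold (𝓡 n) ∞ N]

lemma IsotropicSCurv.sCurvCoord_eq {F : ∀ x : N, TangentSpace (𝓡 n) x → ℝ} {k : N → ℝ}
    (hS : IsotropicSCurv F k) (x : N) (y : TangentSpace (𝓡 n) x) (hy : y ≠ 0) :
    sCurvCoord (localFinsler F x) (extChartAt (𝓡 n) x x) (toCoord x x y)
      = ((n : ℝ) + 1) * k x * localFinsler F x (extChartAt (𝓡 n) x x) (toCoord x x y) := by
  rw [localFinsler_toCoord F (mem_chart_source (E n) x)]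
  exact hS x y hy

variable {M : Type*} [TopologicalSpace M] [ChartedSpace (E m) M] [IsManifold (𝓡 m) ∞ M]
  {φ : M → N} {p : M}

lemma fderiv_locField_sub_wind (hφ : ContMDiff (𝓡 m) (𝓡 n) ∞ φ) {W : ∀ x : N, TangentSpace (𝓡 n) x}
    (hW : ContMDiff (𝓡 n) (𝓡 n).tangent ∞ (fun x => (⟨x, W x⟩ : TangentBundle (𝓡 n) N)))
    {ν : ∀ q : M, TangentSpace (𝓡 n) (φ q)} (hν : ContMDiffAt (𝓡 m) (𝓡 n).tangent ∞
      (fun q => (⟨φ q, ν q⟩ : TangentBundle (𝓡 n) N)) p) (X : E m) :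
    fderiv ℝ (locField φ p fun q => ν q - W (φ q)) (extChartAt (𝓡 m) p p) X
      = fderiv ℝ (locField φ p ν) (extChartAt (𝓡 m) p p) X
        - fderiv ℝ (coordField W (φ p)) (extChartAt (𝓡 n) (φ p) (φ p))
          (fderiv ℝ (locMap n φ p) (extChartAt (𝓡 m) p p) X) := by
  have h1 : (locField φ p fun q => ν q - W (φ q)) =ᶠ[𝓝 (extChartAt (𝓡 m) p p)]
      fun w => locField φ p ν w - coordField W (φ p) (locMap n φ p w) := by
    filter_upwards [eventually_mem_target_and_source hφ p] with w hw
    rw [locField, toCoord_sub, locMap, coordField_extChartAt W hw.2]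
    rfl
  have hu : locMap n φ p (extChartAt (𝓡 m) p p) = extChartAt (𝓡 n) (φ p) (φ p) :=
    locMap_extChartAt φ (mem_chart_source (E m) p)
  have h2 : HasFDerivAt (coordField W (φ p)) (fderiv ℝ (coordField W (φ p))
      (extChartAt (𝓡 n) (φ p) (φ p))) (locMap n φ p (extChartAt (𝓡 m) p p)) := by
    rw [hu]
    exact (differentiableAt_of_smooth
      (contDiffAt_coordField hW (mem_extChartAt_target (φ p)))).hasFDerivAt
  have h3 := (differentiableAt_of_smooth (contDiffAt_locMap_self hφ p)).hasFDerivAt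
  have h4 := (differentiableAt_of_smooth (contDiffAt_locField_self hφ hν)).hasFDerivAt
  rw [h1.fderiv_eq]
  exact congrArg (fun T : E m →L[ℝ] E n => T X) (h4.fun_sub (h2.comp _ h3)).fderiv

/-- The normal derivatives in the Randers manifold `(N, F)` and in the Riemannian manifold
`(N, h)`. -/
lemma relFactor_mul_bilin_covDeriv (hφ : ContMDiff (𝓡 m) (𝓡 n) ∞ φ) (h : RMetric n N)
    {W : ∀ x : N, TangentSpace (𝓡 n) x}
    (hW : ContMDiff (𝓡 n) (𝓡 n).tangent ∞ (fun x => (⟨x, W x⟩ : TangentBundle (𝓡 n) N)))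
    (hW1 : ∀ x : N, h.inner x (W x) (W x) < 1) {k : N → ℝ}
    (hS : IsotropicSCurv (randers h W) k) {v : TangentSpace (𝓡 n) (φ p)}
    {ν : ∀ q : M, TangentSpace (𝓡 n) (φ q)}
    (hν : IsLocalExtension m φ (IsUnitNormal m (randers h W) φ) p v ν)
    (X Z Y : TangentSpace (𝓡 m) p) :
    relFactor (coordMetric h (φ p)) (coordField W (φ p)) (localFinsler (randers h W) (φ p))
        (coordPoint (φ p) v) *
      bilin (fundTensorAt (randers h W) (φ p) v)
        (covDeriv φ p (chernAt (randers h W) (φ p) v) ν X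
          + toCoord (φ p) (φ p) (mfderiv (𝓡 m) (𝓡 n) φ p Z))
        (toCoord (φ p) (φ p) (mfderiv (𝓡 m) (𝓡 n) φ p Y))
      = bilin (fun i j => localMetric h (φ p) i j (extChartAt (𝓡 n) (φ p) (φ p)))
        (covDeriv φ p
            (fun i j k => christoffel (localMetric h (φ p)) i j k (extChartAt (𝓡 n) (φ p) (φ p)))
            (fun q => ν q - W (φ q)) X
          + toCoord (φ p) (φ p) (mfderiv (𝓡 m) (𝓡 n) φ p (Z - k (φ p) • X)))
        (toCoord (φ p) (φ p) (mfderiv (𝓡 m) (𝓡 n) φ p Y)) := by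
  have hR := isRandersOn_localFinsler h hW hW1 (φ p)
  have hν' := (isLocalExtension_sub_wind_iff h hW hW1 hφ).2 hν
  have hνp : ν p = v := hν.1
  have hvn : IsUnitNormal m (randers h W) φ p v :=
    hνp ▸ (isLocalExtension_iff_eventually.1 hν).2.self_of_nhds.2
  have hvn' := (isUnitNormal_iff h hW hW1 φ p v).1 hvn
  have hz := coordPoint_mem (ne_zero_of_randers_eq_one h hvn.1)
  have hz1 : len (localFinsler (randers h W) (φ p)) (coordPoint (φ p) v) = 1 :=
    (len_coordPoint _ v).trans hvn.1
  have hT : ∀ Y : TangentSpace (𝓡 m) p, coordMetric h (φ p) (coordPoint (φ p) v).1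
      (relVec (coordField W (φ p)) (localFinsler (randers h W) (φ p)) (coordPoint (φ p) v))
      (fderiv ℝ (locMap n φ p) (extChartAt (𝓡 m) p p) Y) = 0 := fun Y => by
    rw [← toCoord_mfderiv_self hφ Y, coordMetric_relVec h hvn.1]
    exact hvn'.2 Y
  have hS' : ∀ y, y ≠ 0 → sCurvCoord (localFinsler (randers h W) (φ p)) (coordPoint (φ p) v).1 y
      = ((n : ℝ) + 1) * k (φ p) * localFinsler (randers h W) (φ p) (coordPoint (φ p) v).1 y := by
    intro y hy
    have h1 := hS.sCurvCoord_eq (φ p) (y : TangentSpace (𝓡 n) (φ p)) hy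
    have h2 : toCoord (φ p) (φ p) y = y := toCoord_self (φ p) y
    rwa [h2] at h1
  have hV := fderiv_locField_normal hφ h hν' X
  have e := fderiv_locField_sub_wind hφ hW hν.contMDiffAt X
  rw [e, ← relVec_coordPoint h hvn.1] at hV
  -- `key` compares the covariant derivatives and `key2` the vector `dφ Z`. The term `-k h(X, Y)`
  -- from `key` is absorbed by replacing `Z` with `Z - k X`.
  have key := hR.bilin_chern_add hz hz1 hS' (hT X) (hT Y) hV
  have key2 := hR.relFactor_mul_bilin_fundTensor hz hz1 (hT Z) (hT Y)
  rw [bilin_covDeriv_christoffel hφ h hν'.contMDiffAt, e,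
    hνp, ← relVec_coordPoint h hvn.1, bilin_add_left, mul_add, covDeriv_eq hφ hν.contMDiffAt, hνp,
    toCoord_mfderiv_self hφ Z, toCoord_mfderiv_self hφ Y]
  refine (congrArg₂ (· + ·) key key2).trans ?_
  have e2 : toCoord (φ p) (φ p) (mfderiv (𝓡 m) (𝓡 n) φ p (Z - k (φ p) • X))
      = fderiv ℝ (locMap n φ p) (extChartAt (𝓡 m) p p) Z
        - k (φ p) • fderiv ℝ (locMap n φ p) (extChartAt (𝓡 m) p p) X :=
    (toCoord_mfderiv_self hφ _).trans ((ContinuousLinearMap.map_sub _ _ _).trans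
      (congrArg _ (ContinuousLinearMap.map_smul _ _ _)))
  rw [← coordMetric_toCoord h (mem_chart_source (E n) (φ p)), toCoord_mfderiv_self hφ Y, e2]
  simp only [map_sub, map_smul, sub_apply, smul_apply, smul_eq_mul, coordPoint]
  ring

/-- The defining orthogonality relations differ by the factor `m` once extensions are matched by
subtracting the wind. The positivity of `m` is needed to return from the Riemannian relation to the
Finsler one. -/
lemma isShapeOperator_iff (hφ : ContMDiff (𝓡 m) (𝓡 n) ∞ φ) (h : RMetric n N)
    {W : ∀ x : N, TangentSpace (𝓡 n) x}
    (hW : ContMDiff (𝓡 n) (𝓡 n).tangent ∞ (fun x => (⟨x, W x⟩ : TangentBundle (𝓡 n) N)))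
    (hW1 : ∀ x : N, h.inner x (W x) (W x) < 1) {k : N → ℝ}
    (hS : IsotropicSCurv (randers h W) k) {v : TangentSpace (𝓡 n) (φ p)}
    (A : Module.End ℝ (TangentSpace (𝓡 m) p)) :
    IsShapeOperator m (randers h W) φ p v A ↔
      IsRiemShapeOperator m h φ p (v - W (φ p)) (A - k (φ p) • 1) := by
  have hsub : ∀ ν' : ∀ q : M, TangentSpace (𝓡 n) (φ q),
      ν' = fun q => (ν' q + W (φ q)) - W (φ q) := fun ν' => by
    ext1 q
    exact (add_sub_cancel_right _ _).symm
  constructor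
  · rintro ⟨⟨ν, hν⟩, hA⟩
    refine ⟨⟨_, (isLocalExtension_sub_wind_iff h hW hW1 hφ).2 hν⟩, fun ν' hν' X Y => ?_⟩
    rw [hsub ν', isLocalExtension_sub_wind_iff h hW hW1 hφ] at hν'
    rw [hsub ν']
    refine (relFactor_mul_bilin_covDeriv hφ h hW hW1 hS hν' X (A X) Y).symm.trans ?_
    rw [hA _ hν', mul_zero]
  · rintro ⟨⟨ν, hν⟩, hA⟩
    rw [hsub ν, isLocalExtension_sub_wind_iff h hW hW1 hφ] at hν
    refine ⟨⟨_, hν⟩, fun ν' hν' X Y => ?_⟩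
    have hvn : randers h W (φ p) v = 1 :=
      hν'.1 ▸ (isLocalExtension_iff_eventually.1 hν').2.self_of_nhds.2.1
    have hm := (isRandersOn_localFinsler h hW hW1 (φ p)).relFactor_pos
      (coordPoint_mem (ne_zero_of_randers_eq_one h hvn))
    refine (mul_eq_zero.1 ((relFactor_mul_bilin_covDeriv hφ h hW hW1 hS hν' X (A X) Y).trans
      ?_)).resolve_left hm.ne'
    exact hA _ ((isLocalExtension_sub_wind_iff h hW hW1 hφ).2 hν') X Y

end Relation

/-! ### Operators defined by positive forms, and smooth unit normals to a family of embeddings. -/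

section LinearAlgebra

lemma bijective_of_pos {P : Type*} [AddCommGroup P] [Module ℝ P] [FiniteDimensional ℝ P]
    (G : P →ₗ[ℝ] P →ₗ[ℝ] ℝ) (hG : ∀ x, x ≠ 0 → 0 < G x x) : Function.Bijective G := by
  have h1 : Function.Injective G := by
    refine (injective_iff_map_eq_zero G).2 fun x hx => ?_
    by_contra h0
    have := hG x h0
    rw [hx] at this
    exact lt_irrefl _ this
  exact ⟨h1, (LinearMap.injective_iff_surjective_of_finrank_eq_finrank
    Subspace.dual_finrank_eq.symm).1 h1⟩

lemma existsUnique_end_add_eq_zero {P : Type*} [AddCommGroup P] [Module ℝ P]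
    [FiniteDimensional ℝ P] (G C : P →ₗ[ℝ] P →ₗ[ℝ] ℝ) (hG : ∀ x, x ≠ 0 → 0 < G x x) :
    ∃! A : Module.End ℝ P, ∀ x y, C x y + G (A x) y = 0 := by
  have hb := bijective_of_pos G hG
  refine ⟨-((LinearEquiv.ofBijective G hb).symm : (P →ₗ[ℝ] ℝ) →ₗ[ℝ] P) ∘ₗ C,
    fun x y => ?_, fun A hA => ?_⟩
  · have h1 := LinearEquiv.apply_symm_apply (LinearEquiv.ofBijective G hb) (C x)
    rw [LinearEquiv.ofBijective_apply] at h1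
    simp [h1]
  · ext x
    refine hb.1 (LinearMap.ext fun y => ?_)
    have h1 := LinearEquiv.apply_symm_apply (LinearEquiv.ofBijective G hb) (C x)
    rw [LinearEquiv.ofBijective_apply] at h1
    simp [h1, eq_neg_iff_add_eq_zero, add_comm (G (A x) y), hA]

variable {V P G : Type*} [NormedAddCommGroup V] [NormedSpace ℝ V]
  [NormedAddCommGroup P] [NormedSpace ℝ P]
  [NormedAddCommGroup G] [NormedSpace ℝ G]

/-- The pullback of a bilinear form. -/
def pullbackForm (H : G →L[ℝ] G →L[ℝ] ℝ) (D : P →L[ℝ] G) : P →L[ℝ] P →L[ℝ] ℝ :=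
  ((ContinuousLinearMap.compL ℝ P G ℝ).flip D).comp (H.comp D)

variable [FiniteDimensional ℝ P]

lemma isInvertible_of_pos (K : P →L[ℝ] P →L[ℝ] ℝ) (hK : ∀ x, x ≠ 0 → 0 < K x x) :
    K.IsInvertible := by
  set T : (P →ₗ[ℝ] ℝ) ≃ₗ[ℝ] P →L[ℝ] ℝ := LinearMap.toContinuousLinearMap
  have h1 := bijective_of_pos (T.symm.toLinearMap ∘ₗ K.toLinearMap) hK
  have h2 : Function.Bijective K := by
    have : (K : P → P →L[ℝ] ℝ) = T ∘ (T.symm.toLinearMap ∘ₗ K.toLinearMap) := by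
      ext x
      simp
    rw [this]
    exact T.bijective.comp h1
  exact ⟨(LinearEquiv.ofBijective K.toLinearMap h2).toContinuousLinearEquiv, rfl⟩

/-- A unit vector normal to the range of a linear embedding extends to a smooth field of unit
normal vectors for a smooth family of embeddings. -/
lemma exists_smooth_unit_normal {H : V → G →L[ℝ] G →L[ℝ] ℝ} {D : V → P →L[ℝ] G} {w₀ : V}
    (hH : ∀ᶠ w in 𝓝 w₀, ContDiffAt ℝ ∞ H w) (hD : ∀ᶠ w in 𝓝 w₀, ContDiffAt ℝ ∞ D w)
    (hpos : ∀ x, x ≠ 0 → 0 < H w₀ x x) (hinj : Function.Injective (D w₀)) {v : G}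
    (hv : H w₀ v v = 1) (hv' : ∀ y, H w₀ v (D w₀ y) = 0) :
    ∃ N : V → G, N w₀ = v ∧ ∀ᶠ w in 𝓝 w₀, ContDiffAt ℝ ∞ N w ∧ H w (N w) (N w) = 1 ∧
      ∀ y, H w (N w) (D w y) = 0 := by
  set K : V → P →L[ℝ] P →L[ℝ] ℝ := fun w => pullbackForm (H w) (D w) with hK
  -- `r w` is the fixed vector `v` minus its `H w`-orthogonal projection to the range of `D w`, with
  -- `K w` the induced Gram form. At `w₀` the projection vanishes; nearby `K w` stays invertible and
  -- `r w` stays nonzero, so it can be normalised.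
  set r : V → G := fun w => v - D w ((K w).inverse ((H w v).comp (D w))) with hr
  have hKs : ∀ w, ContDiffAt ℝ ∞ H w → ContDiffAt ℝ ∞ D w → ContDiffAt ℝ ∞ K w := fun w h1 h2 => by
    have h3 : ContDiffAt ℝ ∞ (fun w => (ContinuousLinearMap.compL ℝ P G ℝ).flip (D w)) w :=
      contDiffAt_const.clm_apply h2
    exact h3.clm_comp (h1.clm_comp h2)
  have hinv0 : (K w₀).IsInvertible := isInvertible_of_pos _ fun x hx =>
    hpos _ fun h0 => hx (hinj (h0.trans (map_zero _).symm))
  have hinv : ∀ᶠ w in 𝓝 w₀, (K w).IsInvertible := by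
    obtain ⟨T, hT⟩ := hinv0
    have h1 := T.nhds
    rw [hT] at h1
    filter_upwards [(hKs w₀ hH.self_of_nhds hD.self_of_nhds).continuousAt h1] with w hw
    exact hw
  have hrs : ∀ᶠ w in 𝓝 w₀, ContDiffAt ℝ ∞ r w := by
    filter_upwards [hH, hD, hinv] with w h1 h2 h3
    have h4 : ContDiffAt ℝ ∞ (fun w => (K w).inverse) w :=
      ContDiffAt.comp w h3.contDiffAt_map_inverse (hKs w h1 h2)
    exact contDiffAt_const.sub (h2.clm_apply (h4.clm_apply
      ((h1.clm_apply contDiffAt_const).clm_comp h2)))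
  have hr0 : r w₀ = v := by
    have : (H w₀ v).comp (D w₀) = 0 := by
      ext y
      exact hv' y
    simp [hr, this]
  have hrr : ∀ᶠ w in 𝓝 w₀, 0 < H w (r w) (r w) := by
    have h1 : ContinuousAt (fun w => H w (r w) (r w)) w₀ :=
      ((hH.self_of_nhds.clm_apply hrs.self_of_nhds).clm_apply hrs.self_of_nhds).continuousAt
    refine h1.eventually (lt_mem_nhds ?_)
    change 0 < H w₀ (r w₀) (r w₀)
    rw [hr0, hv]
    exact one_pos
  refine ⟨fun w => (√(H w (r w) (r w)))⁻¹ • r w, by simp [hr0, hv], ?_⟩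
  filter_upwards [hH, hinv, hrs, hrr] with w h1 h2 h3 h4
  refine ⟨ContDiffAt.smul (((h1.clm_apply h3).clm_apply h3).sqrt h4.ne' |>.inv
    (Real.sqrt_pos.2 h4).ne') h3, ?_, fun y => ?_⟩
  · have h5 := Real.sq_sqrt h4.le
    have h6 := (Real.sqrt_pos.2 h4).ne'
    simp only [map_smul, smul_apply, smul_eq_mul]
    field_simp
    exact h5.symm
  · have h5 : K w ((K w).inverse ((H w v).comp (D w))) = (H w v).comp (D w) :=
      h2.self_apply_inverse _
    have h6 : H w (r w) (D w y) = 0 := by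
      simp only [hr, map_sub, sub_apply]
      exact sub_eq_zero.2 (congrArg (fun T : P →L[ℝ] ℝ => T y) h5).symm
    rw [map_smul, smul_apply, h6, smul_zero]

end LinearAlgebra

/-! ### Existence and uniqueness of the shape operators. -/

section ShapeOperator

variable {n m : ℕ} {N : Type*} [TopologicalSpace N] [ChartedSpace (E n) N] [IsManifold (𝓡 n) ∞ N]

lemma exists_toCoord_eq {x₀ x : N} (hx : x ∈ (chartAt (E n) x₀).source) (a : E n) :
    ∃ v : TangentSpace (𝓡 n) x, toCoord x₀ x v = a := by
  have : IsManifold (𝓡 n) 1 N := .of_le (n := ∞) (by norm_num)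
  have h := isInvertible_mfderiv_extChartAt (I := 𝓡 n) (x := x₀) (y := x) (by rwa [extChartAt_source])
  exact ⟨_, h.self_apply_inverse a⟩

variable {M : Type*} [TopologicalSpace M] [ChartedSpace (E m) M] [IsManifold (𝓡 m) ∞ M]
  {φ : M → N} {p : M}

lemma fderiv_locMap_injective (hφ : ContMDiff (𝓡 m) (𝓡 n) ∞ φ)
    (hφ' : Function.Injective (mfderiv (𝓡 m) (𝓡 n) φ p)) :
    Function.Injective (fderiv ℝ (locMap n φ p) (extChartAt (𝓡 m) p p)) := by
  intro X Y hXY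
  refine hφ' ?_
  have h1 := toCoord_mfderiv_self hφ (p := p) X
  have h2 := toCoord_mfderiv_self hφ (p := p) Y
  rw [toCoord_self] at h1 h2
  exact h1.trans (hXY.trans h2.symm)

lemma exists_isLocalExtension (hφ : ContMDiff (𝓡 m) (𝓡 n) ∞ φ)
    (hφ' : Function.Injective (mfderiv (𝓡 m) (𝓡 n) φ p)) (h : RMetric n N)
    {v : TangentSpace (𝓡 n) (φ p)} (hv : IsRiemUnitNormal m h φ p v) :
    ∃ ν, IsLocalExtension m φ (IsRiemUnitNormal m h φ) p v ν := by
  have hp := mem_chart_source (E m) p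
  have hφp := mem_chart_source (E n) (φ p)
  have hu : locMap n φ p (extChartAt (𝓡 m) p p) = extChartAt (𝓡 n) (φ p) (φ p) :=
    locMap_extChartAt φ hp
  have hev := eventually_mem_target_and_source hφ p
  have hs : ∀ᶠ w in 𝓝 (extChartAt (𝓡 m) p p), ContDiffAt ℝ ∞ (locMap n φ p) w :=
    hev.mono fun w hw => contDiffAt_locMap hφ hw.1 hw.2
  have hH : ∀ᶠ w in 𝓝 (extChartAt (𝓡 m) p p),
      ContDiffAt ℝ ∞ (fun w => coordMetric h (φ p) (locMap n φ p w)) w := by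
    filter_upwards [hev, hs] with w hw hw'
    exact ContDiffAt.comp (g := coordMetric h (φ p)) (f := locMap n φ p) w (contDiffAt_coordMetric h
      ((extChartAt (𝓡 n) (φ p)).map_source (by rw [extChartAt_source]; exact hw.2))) hw'
  have hpos : ∀ a, a ≠ 0 →
      0 < coordMetric h (φ p) (locMap n φ p (extChartAt (𝓡 m) p p)) a a := fun a ha => by
    obtain ⟨b, rfl⟩ := exists_toCoord_eq hφp a
    rw [hu, coordMetric_toCoord h hφp]
    refine h.pos _ _ fun hb => ha ?_
    rw [hb]
    exact map_zero _
  obtain ⟨T, hT0, hT⟩ := exists_smooth_unit_normal hH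
    (hs.mono fun w hw => hw.fderiv_right (m := ∞) (by norm_num)) hpos
    (fderiv_locMap_injective hφ hφ') (v := toCoord (φ p) (φ p) v)
    (by rw [hu, coordMetric_toCoord h hφp]; exact hv.1)
    (fun Y => by
      have h1 := toCoord_mfderiv_self hφ (p := p) Y
      rw [← h1, hu, coordMetric_toCoord h hφp]
      exact hv.2 Y)
  -- The field is prescribed only where `φ q` lies in the chart; the value `0` elsewhere is
  -- irrelevant to the germ at `p`.
  have hex : ∀ q : M, ∃ a : TangentSpace (𝓡 n) (φ q), φ q ∈ (chartAt (E n) (φ p)).source →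
      toCoord (φ p) (φ q) a = T (extChartAt (𝓡 m) p q) := fun q => by
    by_cases hq : φ q ∈ (chartAt (E n) (φ p)).source
    · obtain ⟨a, ha⟩ := exists_toCoord_eq hq (T (extChartAt (𝓡 m) p q))
      exact ⟨a, fun _ => ha⟩
    · exact ⟨0, fun h => absurd h hq⟩
  choose ν hν using hex
  refine ⟨ν, isLocalExtension_iff_eventually.2 ⟨?_, ?_⟩⟩
  · have h1 := hν p hφp
    rw [hT0, toCoord_self, toCoord_self] at h1
    exact h1
  · have hsrc : ∀ᶠ q in 𝓝 p, φ q ∈ (chartAt (E n) (φ p)).source :=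
      hφ.continuous.continuousAt ((chartAt (E n) (φ p)).open_source.mem_nhds hφp)
    filter_upwards [(chartAt (E m) p).open_source.mem_nhds hp, hsrc.eventually_nhds,
      (continuousAt_extChartAt (I := 𝓡 m) p).eventually hT] with q hq hq' hTq
    have hq'' := hq'.self_of_nhds
    refine ⟨(contMDiffAt_totalSpace_iff_toCoord hq'').2 ⟨hφ.contMDiffAt, ?_⟩, ?_, fun X => ?_⟩
    · refine (hTq.1.contMDiffAt.comp q (contMDiffAt_extChartAt' (n := ∞) hq)).congr_of_eventuallyEq
        (hq'.mono fun y hy => hν y hy)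
    · rw [← coordMetric_toCoord h hq'', hν q hq'', ← locMap_extChartAt φ hq]
      exact hTq.2.1
    · rw [← coordMetric_toCoord h hq'', hν q hq'', toCoord_mfderiv hφ hq hq'',
        ← locMap_extChartAt φ hq]
      exact hTq.2.2 _

/-- The tangential part of the normal derivative does not depend on the extension of the normal
vector. -/
lemma coordMetric_fderiv_locField (hφ : ContMDiff (𝓡 m) (𝓡 n) ∞ φ) (h : RMetric n N)
    {v : TangentSpace (𝓡 n) (φ p)} {ν : ∀ q : M, TangentSpace (𝓡 n) (φ q)}
    (hν : IsLocalExtension m φ (IsRiemUnitNormal m h φ) p v ν) (X Y : E m) :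
    coordMetric h (φ p) (extChartAt (𝓡 n) (φ p) (φ p))
        (fderiv ℝ (locField φ p ν) (extChartAt (𝓡 m) p p) X)
        (fderiv ℝ (locMap n φ p) (extChartAt (𝓡 m) p p) Y)
      = - fderiv ℝ (coordMetric h (φ p)) (extChartAt (𝓡 n) (φ p) (φ p))
          (fderiv ℝ (locMap n φ p) (extChartAt (𝓡 m) p p) X) (toCoord (φ p) (φ p) v)
          (fderiv ℝ (locMap n φ p) (extChartAt (𝓡 m) p p) Y)
        - coordMetric h (φ p) (extChartAt (𝓡 n) (φ p) (φ p)) (toCoord (φ p) (φ p) v)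
          (fderiv ℝ (fderiv ℝ (locMap n φ p)) (extChartAt (𝓡 m) p p) X Y) := by
  have hp := mem_chart_source (E m) p
  have hu : locMap n φ p (extChartAt (𝓡 m) p p) = extChartAt (𝓡 n) (φ p) (φ p) :=
    locMap_extChartAt φ hp
  have hv : locField φ p ν (extChartAt (𝓡 m) p p) = toCoord (φ p) (φ p) v := by
    rw [locField_extChartAt φ ν hp, hν.1]
  have hf := contDiffAt_locMap_self hφ p
  have hD : ContDiffAt ℝ ∞ (fderiv ℝ (locMap n φ p)) (extChartAt (𝓡 m) p p) :=
    hf.fderiv_right (by norm_num)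
  have h1 := fderiv_bilin_comp (H := coordMetric h (φ p)) (f := locMap n φ p)
    (b := fun w => fderiv ℝ (locMap n φ p) w Y) (z := extChartAt (𝓡 m) p p)
    (by rw [hu]; exact differentiableAt_of_smooth
          (contDiffAt_coordMetric h (mem_extChartAt_target (φ p))))
    (differentiableAt_of_smooth hf)
    (differentiableAt_of_smooth (contDiffAt_locField_self hφ hν.contMDiffAt))
    (differentiableAt_of_smooth (hD.clm_apply contDiffAt_const)) X
  -- Differentiating `h(ν, dφ Y) = 0` moves the derivative off `ν`; only the value `v` at `p` and
  -- the second derivative of the immersion remain.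
  have h2 : (fun w => coordMetric h (φ p) (locMap n φ p w) (locField φ p ν w)
      (fderiv ℝ (locMap n φ p) w Y)) =ᶠ[𝓝 (extChartAt (𝓡 m) p p)] fun _ => 0 :=
    (eventually_locField_normal hφ h hν).mono fun w hw => hw.2 Y
  rw [h2.fderiv_eq, hu, hv, fderiv_fderiv_apply hf] at h1
  simp only [fderiv_fun_const, Pi.zero_apply, zero_apply] at h1
  linarith

lemma existsUnique_isRiemShapeOperator (hφ : ContMDiff (𝓡 m) (𝓡 n) ∞ φ)
    (hφ' : Function.Injective (mfderiv (𝓡 m) (𝓡 n) φ p)) (h : RMetric n N)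
    {v : TangentSpace (𝓡 n) (φ p)} (hv : IsRiemUnitNormal m h φ p v) :
    ∃! A, IsRiemShapeOperator m h φ p v A := by
  obtain ⟨ν, hν⟩ := exists_isLocalExtension hφ hφ' h hv
  have : FiniteDimensional ℝ (TangentSpace (𝓡 m) p) :=
    inferInstanceAs (FiniteDimensional ℝ (E m))
  set u := extChartAt (𝓡 n) (φ p) (φ p)
  set D := fderiv ℝ (locMap n φ p) (extChartAt (𝓡 m) p p)
  set V := fderiv ℝ (locField φ p ν) (extChartAt (𝓡 m) p p)
  set dφ : E m →L[ℝ] E n := mfderiv (𝓡 m) (𝓡 n) φ p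
  let g : E n →L[ℝ] E n →L[ℝ] ℝ := h.inner (φ p)
  let G : E m →ₗ[ℝ] E m →ₗ[ℝ] ℝ := LinearMap.mk₂ ℝ
    (fun X Y => g (dφ X) (dφ Y)) (by simp) (by simp) (by simp) (by simp)
  -- `C` is `h(∇_X ν, dφ Y)` for one chosen extension, and `G` is the induced metric, positive
  -- definite since `φ` is an immersion. The shape operator is then the unique solution of `C X Y +
  -- G (A X) Y = 0`.
  let C : E m →ₗ[ℝ] E m →ₗ[ℝ] ℝ := LinearMap.mk₂ ℝ
    (fun X Y => coordMetric h (φ p) u (V X) (D Y)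
      + leviCivita (coordMetric h (φ p)) u (toCoord (φ p) (φ p) v) (D X) (D Y))
    (fun X X' Y => by simp [leviCivita]; ring) (fun c X Y => by simp [leviCivita]; ring)
    (fun X Y Y' => by simp [leviCivita]; ring) (fun c X Y => by simp [leviCivita]; ring)
  have hG : ∀ X, X ≠ 0 → 0 < G X X := fun X hX =>
    h.pos _ _ fun h0 => hX (hφ' (h0.trans (map_zero dφ).symm))
  have hiff : ∀ A : Module.End ℝ (TangentSpace (𝓡 m) p), IsRiemShapeOperator m h φ p v A ↔
      ∀ X Y, C X Y + G (A X) Y = 0 := by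
    intro A
    have hA : ∀ ν', IsLocalExtension m φ (IsRiemUnitNormal m h φ) p v ν' → ∀ X Y,
        bilin (fun i j => localMetric h (φ p) i j (extChartAt (𝓡 n) (φ p) (φ p)))
          (covDeriv φ p
              (fun i j k => christoffel (localMetric h (φ p)) i j k
                (extChartAt (𝓡 n) (φ p) (φ p))) ν' X
            + toCoord (φ p) (φ p) (mfderiv (𝓡 m) (𝓡 n) φ p (A X)))
          (toCoord (φ p) (φ p) (mfderiv (𝓡 m) (𝓡 n) φ p Y)) = C X Y + G (A X) Y := by
      intro ν' hν' X Y
      rw [bilin_covDeriv_christoffel hφ h hν'.contMDiffAt, hν'.1,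
        -- Going through the extension-free expression replaces `ν'` by the chosen `ν`.
        coordMetric_fderiv_locField hφ h hν' X Y, ← coordMetric_fderiv_locField hφ h hν X Y]
      rfl
    exact ⟨fun hA' X Y => (hA ν hν X Y).symm.trans (hA'.2 ν hν X Y),
      fun hA' => ⟨⟨ν, hν⟩, fun ν' hν' X Y => (hA ν' hν' X Y).trans (hA' X Y)⟩⟩
  simp only [hiff]
  exact existsUnique_end_add_eq_zero G C hG

/-- Transported from the Riemannian case: shifting by `k · 1` is a bijection between the operators
satisfying the two characterisations. -/
lemma existsUnique_isShapeOperator (hφ : ContMDiff (𝓡 m) (𝓡 n) ∞ φ)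
    (hφ' : Function.Injective (mfderiv (𝓡 m) (𝓡 n) φ p)) (h : RMetric n N)
    {W : ∀ x : N, TangentSpace (𝓡 n) x}
    (hW : ContMDiff (𝓡 n) (𝓡 n).tangent ∞ (fun x => (⟨x, W x⟩ : TangentBundle (𝓡 n) N)))
    (hW1 : ∀ x : N, h.inner x (W x) (W x) < 1) {k : N → ℝ}
    (hS : IsotropicSCurv (randers h W) k) {v : TangentSpace (𝓡 n) (φ p)}
    (hv : IsUnitNormal m (randers h W) φ p v) :
    ∃! A, IsShapeOperator m (randers h W) φ p v A := by
  obtain ⟨A, hA, hA'⟩ :=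
    existsUnique_isRiemShapeOperator hφ hφ' h ((isUnitNormal_iff h hW hW1 φ p v).1 hv)
  refine ⟨A + k (φ p) • 1, ?_, fun B hB => ?_⟩
  · refine (isShapeOperator_iff hφ h hW hW1 hS _).2 ?_
    rwa [add_sub_cancel_right]
  · exact sub_eq_iff_eq_add.1 (hA' _ ((isShapeOperator_iff hφ h hW hW1 hS B).1 hB))

lemma shapeOperator_eq (hφ : ContMDiff (𝓡 m) (𝓡 n) ∞ φ)
    (hφ' : Function.Injective (mfderiv (𝓡 m) (𝓡 n) φ p)) (h : RMetric n N)
    {W : ∀ x : N, TangentSpace (𝓡 n) x}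
    (hW : ContMDiff (𝓡 n) (𝓡 n).tangent ∞ (fun x => (⟨x, W x⟩ : TangentBundle (𝓡 n) N)))
    (hW1 : ∀ x : N, h.inner x (W x) (W x) < 1) {k : N → ℝ}
    (hS : IsotropicSCurv (randers h W) k) {v : TangentSpace (𝓡 n) (φ p)}
    (hv : IsUnitNormal m (randers h W) φ p v) :
    shapeOperator m (randers h W) φ p v
      = riemShapeOperator m h φ p (v - W (φ p)) + k (φ p) • 1 := by
  have h1 := existsUnique_isRiemShapeOperator hφ hφ' h ((isUnitNormal_iff h hW hW1 φ p v).1 hv)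
  have h2 : IsShapeOperator m (randers h W) φ p v (shapeOperator m (randers h W) φ p v) :=
    Classical.epsilon_spec (existsUnique_isShapeOperator hφ hφ' h hW hW1 hS hv).exists
  have h3 : IsRiemShapeOperator m h φ p (v - W (φ p)) (riemShapeOperator m h φ p (v - W (φ p))) :=
    Classical.epsilon_spec h1.exists
  rw [isShapeOperator_iff hφ h hW hW1 hS] at h2
  exact sub_eq_iff_eq_add.1 (h1.unique h2 h3)

end ShapeOperator

lemma hasEigenvector_add_smul_one_iff {V : Type*} [AddCommGroup V] [Module ℝ V]
    {A : Module.End ℝ V} {c μ : ℝ} {x : V} :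
    (A + c • (1 : Module.End ℝ V)).HasEigenvector μ x ↔ A.HasEigenvector (μ - c) x := by
  rw [Module.End.hasEigenvector_iff, Module.End.hasEigenvector_iff, Module.End.mem_eigenspace_iff,
    Module.End.mem_eigenspace_iff, sub_smul, eq_sub_iff_add_eq]
  rfl

lemma hasEigenvector_unique {V : Type*} [AddCommGroup V] [Module ℝ V] {A : Module.End ℝ V}
    {μ μ' : ℝ} {x : V} (h : A.HasEigenvector μ x) (h' : A.HasEigenvector μ' x) : μ = μ' :=
  smul_left_injective ℝ h.2 (h.apply_eq_smul.symm.trans h'.apply_eq_smul)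

end Randers

end

theorem mainTheorem2 {n m : ℕ} (hmn : m < n)
    {N : Type*} [TopologicalSpace N] [ChartedSpace (Randers.E n) N] [IsManifold (𝓡 n) ∞ N]
    {M : Type*} [TopologicalSpace M] [ChartedSpace (Randers.E m) M] [IsManifold (𝓡 m) ∞ M]
    (h : Randers.RMetric n N)
    (W : ∀ x : N, TangentSpace (𝓡 n) x)
    (hW : ContMDiff (𝓡 n) (𝓡 n).tangent ∞ (fun x => (⟨x, W x⟩ : TangentBundle (𝓡 n) N)))
    (hW1 : ∀ x : N, h.inner x (W x) (W x) < 1)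
    (k : N → ℝ) (hS : Randers.IsotropicSCurv (Randers.randers h W) k)
    (φ : M → N) (hφ : ContMDiff (𝓡 m) (𝓡 n) ∞ φ)
    (hφ' : ∀ p : M, Function.Injective (mfderiv (𝓡 m) (𝓡 n) φ p))
    (p : M) (ν : TangentSpace (𝓡 n) (φ p))
    (hν : Randers.IsUnitNormal m (Randers.randers h W) φ p ν) :
    Randers.IsRiemUnitNormal m h φ p (ν - W (φ p)) ∧
    (∃! A, Randers.IsShapeOperator m (Randers.randers h W) φ p ν A) ∧
    (∃! A, Randers.IsRiemShapeOperator m h φ p (ν - W (φ p)) A) ∧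
    (∀ X : TangentSpace (𝓡 m) p,
      (∃ μ, Randers.IsPrincipal
          (Randers.shapeOperator m (Randers.randers h W) φ p ν) μ X) ↔
        ∃ μ, Randers.IsPrincipal (Randers.riemShapeOperator m h φ p (ν - W (φ p))) μ X) ∧
    (∀ (X : TangentSpace (𝓡 m) p) (μ μ' : ℝ),
      Randers.IsPrincipal (Randers.shapeOperator m (Randers.randers h W) φ p ν) μ X →
      Randers.IsPrincipal (Randers.riemShapeOperator m h φ p (ν - W (φ p))) μ' X →
      μ = μ' + k (φ p)) := by
  have hA := Randers.shapeOperator_eq hφ (hφ' p) h hW hW1 hS hν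
  have hν' := (Randers.isUnitNormal_iff h hW hW1 φ p ν).1 hν
  refine ⟨hν', Randers.existsUnique_isShapeOperator hφ (hφ' p) h hW hW1 hS hν,
    Randers.existsUnique_isRiemShapeOperator hφ (hφ' p) h hν', fun X => ⟨?_, ?_⟩,
    fun X μ μ' h1 h2 => ?_⟩
  · rintro ⟨μ, hμ⟩
    rw [hA] at hμ
    exact ⟨_, Randers.hasEigenvector_add_smul_one_iff.1 hμ⟩
  · rintro ⟨μ, hμ⟩
    refine ⟨μ + k (φ p), ?_⟩
    rw [hA]
    refine Randers.hasEigenvector_add_smul_one_iff.2 ?_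
    rwa [add_sub_cancel_right]
  · rw [hA] at h1
    exact sub_eq_iff_eq_add.1
      (Randers.hasEigenvector_unique (Randers.hasEigenvector_add_smul_one_iff.1 h1) h2)
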